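/- Let $a_1,\dots,a_n$ be pairwise distinct real numbers, let $v_i=(a_i,1)\in\mathbb{R}^2$, let $\pi\colon\mathbb{R}^n\to\mathbb{R}^2$ be the linear map with $\pi(e_i)=v_i$, and let $Z=\pi([0,1]^n)$. For disjoint $A,B\subseteq[n]$ let $F_{A,B}$ be the face of $[0,1]^n$ given by $x_i=1$ for $i\in A$ and $x_i=0$ for $i\notin A\cup B$. A fine zonotopal tiling (not necessarily regular) of $Z$ is a collection $\mathcal{T}$ of faces $F_{A,B}$ with $|B|=2$ whose images under $\pi$ are parallelograms forming a polyhedral subdivision of $Z$, such that $\pi(F\cap F')=\pi(F)\cap\pi(F')$ for all $F,F'\in\mathcal{T}$. Its vertices are the sets $S$ with $A\subseteq S\subseteq A\cup B$ for some $F_{A,B}\in\mathcal{T}$. A circuit is a pair $C=(C^+,C^-)$ of disjoint subsets of $[n]$ such that $C^+\cup C^-$ indexes a minimal linearly dependent family of the $v_i$, having a linear dependence with positive coefficients on $C^+$ and negative coefficients on $C^-$; put $-C=(C^-,C^+)$. The tiling $\mathcal{T}$ orients $C$ positively if some vertex contains $C^+$ and avoids $C^-$ while no vertex contains $C^-$ and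 avoids $C^+$; it orients $C$ negatively if it orients $-C$ positively. Two tilings are related by a flip if they orient some circuit $C$ oppositely and orient every circuit other than $\pm C$ in the same way. Let $1\le k\le n-1$ and $\Delta_{k,n}=\{x\in[0,1]^n : x_1+\dots+x_n=k\}$. A hypertriangulation at level $k$ is a collection of edges of $\Delta_{k,n}$ whose images under $\pi$ subdivide the segment $\pi(\Delta_{k,n})$, with $\pi(E\cap E')=\pi(E)\cap\pi(E')$ for any two of its edges $E,E'$. It is lifting if it is the cross-section of some fine zonotopal tiling $\mathcal{T}$ of $Z$ at height $k$, that is, if it consists of the segments $F_{A,B}\cap\Delta_{k,n}$ with $F_{A,B}\in\mathcal{T}$ and $|A|=k-1$. The flip graph of lifting hypertriangulations at level $k$ has these as its vertices, two distinct ones being adjacent if they are the cross-sections at height $k$ of two fine zonotopal tilings related by a flip. Then this graph is connected, and its diameter is exactly $2k(n-k)-n$. -/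

import Mathlib

/-- The lift `v_i = (a_i, 1)` of the point `a_i` of a configuration on the real line. -/
def liftVec {n : ℕ} (a : Fin n → ℝ) (i : Fin n) : ℝ × ℝ := (a i, 1)

/-- The linear projection `π` with `π(e_i) = v_i`. -/
noncomputable def proj {n : ℕ} (a : Fin n → ℝ) (x : Fin n → ℝ) : ℝ × ℝ :=
  ∑ i, x i • liftVec a i

/-- The unit cube `[0,1]^n`. -/
def unitCube (n : ℕ) : Set (Fin n → ℝ) := {x | ∀ i, 0 ≤ x i ∧ x i ≤ 1}

/-- The zonotope of the lifted configuration: the Minkowski sum of the segments `[0, v_i]`,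
that is, the image of the unit cube. -/
def zonotope {n : ℕ} (a : Fin n → ℝ) : Set (ℝ × ℝ) := proj a '' unitCube n

/-- A label `(A, B)` of a face of the cube. -/
abbrev FaceLabel (n : ℕ) : Type := Finset (Fin n) × Finset (Fin n)

/-- The face `F_{A,B}` of the cube: `x_i = 1` on `A` and `x_i = 0` off `A ∪ B`. -/
def cubeFace {n : ℕ} (p : FaceLabel n) : Set (Fin n → ℝ) :=
  {x | x ∈ unitCube n ∧ (∀ i ∈ p.1, x i = 1) ∧ ∀ i, i ∉ p.1 → i ∉ p.2 → x i = 0}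

/-- The tile `Π_{A,B} = π(F_{A,B})`. -/
def tile {n : ℕ} (a : Fin n → ℝ) (p : FaceLabel n) : Set (ℝ × ℝ) := proj a '' cubeFace p

/-- `T` is a fine zonotopal tiling (not necessarily regular) of the zonotope of the lift of `a`:
a collection of two-dimensional faces of the cube whose images are parallelograms which cover the
zonotope, any two of them meeting exactly in the image of the common face of the two cube faces
(so that they meet in a common face, possibly empty). -/
structure IsFineZonotopalTiling {n : ℕ} (a : Fin n → ℝ) (T : Finset (FaceLabel n)) : Prop where
  disjoint : ∀ p ∈ T, Disjoint p.1 p.2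
  card_eq : ∀ p ∈ T, p.2.card = 2
  indep : ∀ p ∈ T, LinearIndependent ℝ (fun b : p.2 => liftVec a b)
  cover : ⋃ p ∈ T, tile a p = zonotope a
  inter : ∀ p ∈ T, ∀ q ∈ T, proj a '' (cubeFace p ∩ cubeFace q) = tile a p ∩ tile a q

/-- The set `S` is a vertex of `T`: `A ⊆ S ⊆ A ∪ B` for some tile. -/
def IsTilingVertex {n : ℕ} (T : Finset (FaceLabel n)) (S : Finset (Fin n)) : Prop :=
  ∃ p ∈ T, p.1 ⊆ S ∧ S ⊆ p.1 ∪ p.2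

/-- `C = (C⁺, C⁻)` is a circuit of the lifted configuration. -/
structure IsCircuit {n : ℕ} (a : Fin n → ℝ) (C : Finset (Fin n) × Finset (Fin n)) : Prop where
  disjoint : Disjoint C.1 C.2
  nonempty : (C.1 ∪ C.2).Nonempty
  indep : ∀ i ∈ C.1 ∪ C.2,
    LinearIndependent ℝ (fun j : ↥((C.1 ∪ C.2).erase i) => liftVec a j)
  dep : ∃ α : Fin n → ℝ, (∀ i ∈ C.1, 0 < α i) ∧ (∀ i ∈ C.2, α i < 0) ∧
    (∀ i, i ∉ C.1 ∪ C.2 → α i = 0) ∧ ∑ i, α i • liftVec a i = 0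

/-- The vertex set of `T` orients the circuit `C` positively: some vertex contains `C⁺` and avoids
`C⁻`, and no vertex contains `C⁻` and avoids `C⁺`. -/
def OrientsPos {n : ℕ} (T : Finset (FaceLabel n)) (C : Finset (Fin n) × Finset (Fin n)) : Prop :=
  (∃ S, IsTilingVertex T S ∧ C.1 ⊆ S ∧ Disjoint C.2 S) ∧
    ¬ ∃ S, IsTilingVertex T S ∧ C.2 ⊆ S ∧ Disjoint C.1 S

/-- The vertex set of `T` orients the circuit `C` negatively. -/
def OrientsNeg {n : ℕ} (T : Finset (FaceLabel n)) (C : Finset (Fin n) × Finset (Fin n)) : Prop :=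
  (∃ S, IsTilingVertex T S ∧ C.2 ⊆ S ∧ Disjoint C.1 S) ∧
    ¬ ∃ S, IsTilingVertex T S ∧ C.1 ⊆ S ∧ Disjoint C.2 S

/-- There is a flip between `T₁` and `T₂`: they orient some circuit `C` oppositely, and agree on
all circuits other than `C` and `-C`. -/
def IsFlip {n : ℕ} (a : Fin n → ℝ) (T₁ T₂ : Finset (FaceLabel n)) : Prop :=
  ∃ C, IsCircuit a C ∧
    ((OrientsPos T₁ C ∧ OrientsNeg T₂ C) ∨ (OrientsNeg T₁ C ∧ OrientsPos T₂ C)) ∧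
    ∀ C', IsCircuit a C' → C' ≠ C → C' ≠ C.swap →
      (OrientsPos T₁ C' ↔ OrientsPos T₂ C') ∧ (OrientsNeg T₁ C' ↔ OrientsNeg T₂ C')

theorem IsFlip.symm {n : ℕ} {a : Fin n → ℝ} {T₁ T₂ : Finset (FaceLabel n)}
    (h : IsFlip a T₁ T₂) : IsFlip a T₂ T₁ := by
  obtain ⟨C, hC, h1, h2⟩ := h
  refine ⟨C, hC, ?_, fun C' h3 h4 h5 => ⟨(h2 C' h3 h4 h5).1.symm, (h2 C' h3 h4 h5).2.symm⟩⟩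
  rcases h1 with h1 | h1
  · exact Or.inr ⟨h1.2, h1.1⟩
  · exact Or.inl ⟨h1.2, h1.1⟩

/-- The hypersimplex `{x ∈ [0,1]^n | x_1 + ... + x_n = k}`. -/
def hypersimplex (n k : ℕ) : Set (Fin n → ℝ) := {x | x ∈ unitCube n ∧ ∑ i, x i = k}

/-- `H` is a hypertriangulation at level `k`: a collection of edges of the `k`-th hypersimplex
whose images subdivide the image of the hypersimplex, any two images meeting exactly in the image
of the common face of the two edges. The edge with vertices the `k`-sets `A ∪ {i}` and `A ∪ {j}`
is the part of the cube face `F_{A,{i,j}}`, `|A| = k - 1`, in the hypersimplex, and it is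
represented by the label `(A, {i, j})`. -/
structure IsHypertriangulation {n : ℕ} (a : Fin n → ℝ) (k : ℕ) (H : Finset (FaceLabel n)) :
    Prop where
  disjoint : ∀ p ∈ H, Disjoint p.1 p.2
  card_fst : ∀ p ∈ H, p.1.card + 1 = k
  card_snd : ∀ p ∈ H, p.2.card = 2
  cover : ⋃ p ∈ H, proj a '' (cubeFace p ∩ hypersimplex n k) = proj a '' hypersimplex n k
  inter : ∀ p ∈ H, ∀ q ∈ H,
    proj a '' (cubeFace p ∩ cubeFace q ∩ hypersimplex n k) =
      proj a '' (cubeFace p ∩ hypersimplex n k) ∩ proj a '' (cubeFace q ∩ hypersimplex n k)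

/-- The cross-section of `T` at height `k`, as a collection of edges of the `k`-th hypersimplex:
the height `k` line cuts a tile `Π_{A,B}` in a segment exactly when `|A| = k - 1`. -/
def crossSection {n : ℕ} (k : ℕ) (T : Finset (FaceLabel n)) : Finset (FaceLabel n) :=
  T.filter (fun p => p.1.card + 1 = k)

/-- The lifting hypertriangulations at level `k`: the hypertriangulations which are cross-sections
of fine zonotopal tilings. -/
def LiftingHypertriangulation {n : ℕ} (a : Fin n → ℝ) (k : ℕ) : Type :=
  {H : Finset (FaceLabel n) // IsHypertriangulation a k H ∧
    ∃ T, IsFineZonotopalTiling a T ∧ crossSection k T = H}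

/-- The flip graph of lifting hypertriangulations at level `k`: two distinct ones are adjacent
when they are the cross-sections of two fine zonotopal tilings related by a flip. -/
def liftingFlipGraph {n : ℕ} (a : Fin n → ℝ) (k : ℕ) :
    SimpleGraph (LiftingHypertriangulation a k) where
  Adj H₁ H₂ := H₁ ≠ H₂ ∧ ∃ T₁ T₂, IsFineZonotopalTiling a T₁ ∧ IsFineZonotopalTiling a T₂ ∧
    crossSection k T₁ = H₁.1 ∧ crossSection k T₂ = H₂.1 ∧ IsFlip a T₁ T₂
  symm := ⟨fun _ _ ⟨h, T₁, T₂, h1, h2, h3, h4, h5⟩ => ⟨h.symm, T₂, T₁, h2, h1, h4, h3, h5.symm⟩⟩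
  loopless := ⟨fun _ h => h.1 rfl⟩

/-!
The indices are ordered by the reals `a i`. By `isCircuit_iff` the circuits are the alternating
triples `x < y < z`, so a tiling assigns a sign to every triple: positive if its vertices contain
`y` without `x, z`, negative if they contain `x, z` without `y`.

*From geometry to combinatorics.* The fine zonotopal tilings are exactly the collections
`labelTiling f` with one tile `(f B, B)` for each pair `B` such that no two vertices orient a
triple in opposite ways (`IsArrangement`). One direction (`IsArrangement.isFineZonotopalTiling`):
a linear dependence alternates in sign (`exists_alternating`), so compatible tiles meet only in
common faces, and since there is one tile for each pair they have the area of the zonotope, which is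
computed with the tiling `between a`. Other direction
(`IsFineZonotopalTiling.exists_isArrangement`): sweep a monotone path over the tiling from left to
right. As long as the path is not the right boundary, it contains both left edges of some tile
(`exists_up_down`), over which it advances, inverting a pair that stays inverted. Thus every pair is
inverted exactly once, and the vertices passed never disagree on a triple.

*Flips.* If a triple is negative, some hexagon of three tiles has a negative triple
(`IsArrangement.exists_hexagon`, again by a sweep argument), and exchanging the three tiles makes
just this triple positive (`IsArrangement.isFlipAt_flipHexagon`). Conversely every flip is such an
exchange (`IsFlipAt.hexagon`). By complementation the same holds with the signs reversed. So each
tiling lies on a monotone sequence of flips from the all negative to the all positive tiling.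

*Distances.* The potential `∑ (1 + 2 * #{s ∈ A strictly between the elements of B})`, summed over
the edges `(A, B)` of a cross-section, increases by one with each flip of a negative to a positive
triple that changes the cross-section (`IsFlipAt.potential_eq_or`). It is `k` for the all negative
tiling and `(n - k) * (2 * k - 1)` for the all positive one; the difference is
`D = 2 * k * (n - k) - n`. Hence these two are at distance at least `D`. For any two cross-sections,
the walk through the maximum and the walk through the minimum have total length `2 * D`, so one of
them has length at most `D`.
-/

/-! ### Linear dependences of points on a line -/

theorem proj_fst {n : ℕ} (a x : Fin n → ℝ) : (proj a x).1 = ∑ i, x i * a i := by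
  simp [proj, liftVec, Prod.fst_sum]

theorem proj_snd {n : ℕ} (a x : Fin n → ℝ) : (proj a x).2 = ∑ i, x i := by
  simp [proj, liftVec, Prod.snd_sum]

theorem proj_eq_iff {n : ℕ} (a x y : Fin n → ℝ) :
    proj a x = proj a y ↔ ∑ i, (x i - y i) = 0 ∧ ∑ i, (x i - y i) * a i = 0 := by
  rw [Prod.ext_iff, proj_fst, proj_fst, proj_snd, proj_snd]
  simp only [sub_mul, Finset.sum_sub_distrib, sub_eq_zero]
  tauto

theorem exists_alternating_of_pos {n : ℕ} {a : Fin n → ℝ} (ha : Function.Injective a)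
    {d : Fin n → ℝ} (h0 : ∑ i, d i = 0) (h1 : ∑ i, d i * a i = 0) {m : Fin n} (hm : 0 < d m)
    (hmin : ∀ i, d i ≠ 0 → a m ≤ a i) :
    ∃ x y z, a x < a y ∧ a y < a z ∧ 0 < d x ∧ d y < 0 ∧ 0 < d z := by
  obtain ⟨q0, -, hq0⟩ : ∃ q ∈ Finset.univ, d q < 0 := by
    by_contra! h
    have := (Finset.sum_eq_zero_iff_of_nonneg h).1 h0 m (Finset.mem_univ _)
    linarith
  obtain ⟨q, hq, hqmin⟩ := Finset.exists_min_image (Finset.univ.filter fun i => d i < 0) a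
    ⟨q0, by simpa using hq0⟩
  simp only [Finset.mem_filter, Finset.mem_univ, true_and] at hq hqmin
  have hmq : a m < a q := lt_of_le_of_ne (hmin q hq.ne)
    fun h => by rw [ha h] at hm; linarith
  by_contra! hno
  -- Without a positive coordinate to the right of `q`, all terms `d i * (a i - a q)` are `≤ 0`.
  have hle : ∀ i ∈ Finset.univ, 0 ≤ -(d i * (a i - a q)) := by
    intro i _
    rcases lt_trichotomy (d i) 0 with h | h | h
    · have := hqmin i h
      nlinarith
    · simp [h]
    · have : a i ≤ a q := by
        by_contra! hlt
        exact absurd (hno m q i hmq hlt hm hq) (by linarith)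
      nlinarith
  have hsum : ∑ i, -(d i * (a i - a q)) = 0 := by
    simp only [mul_sub, Finset.sum_neg_distrib, Finset.sum_sub_distrib, ← Finset.sum_mul, h0, h1]
    simp
  have := (Finset.sum_eq_zero_iff_of_nonneg hle).1 hsum m (Finset.mem_univ _)
  nlinarith

/-- A nonzero linear dependence of the lifted points alternates in sign along the line: a vector
whose coordinates change sign only once pairs nontrivially with an affine function that changes
sign at the same place. -/
theorem exists_alternating {n : ℕ} {a : Fin n → ℝ} (ha : Function.Injective a) {d : Fin n → ℝ}
    (h0 : ∑ i, d i = 0) (h1 : ∑ i, d i * a i = 0) (hd : d ≠ 0) :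
    ∃ x y z, a x < a y ∧ a y < a z ∧
      ((0 < d x ∧ d y < 0 ∧ 0 < d z) ∨ (d x < 0 ∧ 0 < d y ∧ d z < 0)) := by
  obtain ⟨m0, hm0⟩ := Function.ne_iff.1 hd
  obtain ⟨m, hm, hmin⟩ := Finset.exists_min_image (Finset.univ.filter fun i => d i ≠ 0) a
    ⟨m0, by simpa using hm0⟩
  simp only [Finset.mem_filter, Finset.mem_univ, true_and] at hm hmin
  rcases lt_or_gt_of_ne hm with h | h
  · obtain ⟨x, y, z, h2, h3, h4, h5, h6⟩ := exists_alternating_of_pos ha (d := -d) (m := m)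
      (by simp [h0]) (by simp [h1]) (by simpa using h) (by simpa using hmin)
    simp only [Pi.neg_apply, Left.neg_pos_iff, Left.neg_neg_iff] at h4 h5 h6
    exact ⟨x, y, z, h2, h3, Or.inr ⟨h4, h5, h6⟩⟩
  · obtain ⟨x, y, z, h2, h3, h4⟩ := exists_alternating_of_pos ha h0 h1 h hmin
    exact ⟨x, y, z, h2, h3, Or.inl h4⟩

/-- Two points with the same image are equal unless their difference alternates in sign along some
triple; this is how the injectivity statements below are proved. -/
theorem eq_of_proj_eq {n : ℕ} {a : Fin n → ℝ} (ha : Function.Injective a) {u w : Fin n → ℝ}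
    (h : proj a u = proj a w)
    (hno : ∀ x y z, a x < a y → a y < a z →
      ¬ ((w x < u x ∧ u y < w y ∧ w z < u z) ∨ (u x < w x ∧ w y < u y ∧ u z < w z))) :
    u = w := by
  by_contra hne
  obtain ⟨h0, h1⟩ := (proj_eq_iff a u w).1 h
  obtain ⟨x, y, z, hxy, hyz, h2⟩ := exists_alternating ha (d := fun i => u i - w i) h0 h1
    fun h => hne (funext fun i => sub_eq_zero.1 (congrFun h i))
  refine hno x y z hxy hyz ?_
  simpa only [sub_pos, sub_neg] using h2

theorem mem_cubeFace {n : ℕ} {p : FaceLabel n} {u : Fin n → ℝ} :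
    u ∈ cubeFace p ↔ (∀ i, 0 ≤ u i ∧ u i ≤ 1) ∧ (∀ i ∈ p.1, u i = 1) ∧
      ∀ i, i ∉ p.1 → i ∉ p.2 → u i = 0 := Iff.rfl

theorem cubeFace_mem_fst_union_snd {n : ℕ} {p : FaceLabel n} {u : Fin n → ℝ}
    (hu : u ∈ cubeFace p) {i : Fin n} (h : 0 < u i) : i ∈ p.1 ∪ p.2 := by
  by_contra hi
  rw [Finset.mem_union, not_or] at hi
  exact h.ne' (hu.2.2 i hi.1 hi.2)

theorem cubeFace_notMem_fst {n : ℕ} {p : FaceLabel n} {u : Fin n → ℝ}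
    (hu : u ∈ cubeFace p) {i : Fin n} (h : u i < 1) : i ∉ p.1 :=
  fun hi => h.ne (hu.2.1 i hi)

theorem cubeFace_eq_of_notMem {n : ℕ} {p : FaceLabel n} {u w : Fin n → ℝ}
    (hu : u ∈ cubeFace p) (hw : w ∈ cubeFace p) {i : Fin n} (h : i ∉ p.2) : u i = w i := by
  by_cases hi : i ∈ p.1
  · rw [hu.2.1 i hi, hw.2.1 i hi]
  · rw [hu.2.2 i hi h, hw.2.2 i hi h]

theorem two_lt_card_of_lt_lt {n : ℕ} {a : Fin n → ℝ} {B : Finset (Fin n)} {x y z : Fin n}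
    (hxy : a x < a y) (hyz : a y < a z) (hx : x ∈ B) (hy : y ∈ B) (hz : z ∈ B) : 2 < B.card :=
  Finset.two_lt_card.2 ⟨x, hx, y, hy, z, hz, fun h => by simp [h] at hxy,
    fun h => by rw [h] at hxy; exact lt_asymm hxy hyz, fun h => by simp [h] at hyz⟩

/-- The projection is injective on a two-dimensional face of the cube, because an alternating
dependence needs three nonzero coordinates. -/
theorem proj_injOn_cubeFace {n : ℕ} {a : Fin n → ℝ} (ha : Function.Injective a) {p : FaceLabel n}
    (hp : p.2.card = 2) : Set.InjOn (proj a) (cubeFace p) := by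
  intro u hu w hw h
  refine eq_of_proj_eq ha h fun x y z hxy hyz hno => ?_
  have key : ∀ i, u i ≠ w i → i ∈ p.2 := fun i hi => by
    by_contra h'
    exact hi (cubeFace_eq_of_notMem hu hw h')
  have hx : x ∈ p.2 := key x (by rcases hno with h | h; exacts [h.1.ne', h.1.ne])
  have hy : y ∈ p.2 := key y (by rcases hno with h | h; exacts [h.2.1.ne, h.2.1.ne'])
  have hz : z ∈ p.2 := key z (by rcases hno with h | h; exacts [h.2.2.ne', h.2.2.ne])
  exact absurd (two_lt_card_of_lt_lt hxy hyz hx hy hz) (by omega)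

/-- In a fine zonotopal tiling, a point of the zonotope has at most one preimage in the faces of
the cube that are used by the tiling. -/
theorem IsFineZonotopalTiling.preimage_unique {n : ℕ} {a : Fin n → ℝ}
    (ha : Function.Injective a) {T : Finset (FaceLabel n)} (hT : IsFineZonotopalTiling a T)
    {p q : FaceLabel n} (hp : p ∈ T) (hq : q ∈ T) {u w : Fin n → ℝ} (hu : u ∈ cubeFace p)
    (hw : w ∈ cubeFace q) (h : proj a u = proj a w) : u = w := by
  have h1 : proj a u ∈ tile a p ∩ tile a q := ⟨⟨u, hu, rfl⟩, ⟨w, hw, h.symm⟩⟩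
  rw [← hT.inter p hp q hq] at h1
  obtain ⟨t, ⟨ht1, ht2⟩, ht⟩ := h1
  rw [← proj_injOn_cubeFace ha (hT.card_eq p hp) ht1 hu ht]
  exact proj_injOn_cubeFace ha (hT.card_eq q hq) ht2 hw (ht.trans h)

/-- The lifted vectors indexed by a pair are linearly independent. -/
theorem linearIndependent_liftVec_pair {n : ℕ} {a : Fin n → ℝ} (ha : Function.Injective a)
    {B : Finset (Fin n)} (hB : B.card ≤ 2) : LinearIndependent ℝ (fun b : B => liftVec a b) := by
  rw [Fintype.linearIndependent_iff]
  intro g hg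
  classical
  set d : Fin n → ℝ := fun i => if h : i ∈ B then g ⟨i, h⟩ else 0 with hd
  have hd0 : ∀ i, i ∉ B → d i = 0 := fun i hi => by simp [hd, hi]
  have hsum : ∀ c : Fin n → ℝ, ∑ b : B, g b * c b = ∑ i, d i * c i := by
    intro c
    rw [← Finset.sum_subset (Finset.subset_univ B)
      (fun i _ hi => by rw [hd0 i hi, zero_mul]), ← Finset.sum_coe_sort B]
    exact Finset.sum_congr rfl fun b _ => by simp [hd]
  have h1 : ∑ i, d i * a i = 0 := by
    rw [← hsum]; simpa [liftVec, Prod.fst_sum] using congrArg Prod.fst hg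
  have h0 : ∑ i, d i = 0 := by
    have := hsum fun _ => 1
    simp only [mul_one] at this
    rw [← this]; simpa [liftVec, Prod.snd_sum] using congrArg Prod.snd hg
  by_contra! hne
  obtain ⟨b, hb⟩ := hne
  obtain ⟨x, y, z, hxy, hyz, h⟩ := exists_alternating ha h0 h1
    fun h => hb (by simpa [hd] using congrFun h b)
  have key : ∀ i, d i ≠ 0 → i ∈ B := fun i hi => by
    by_contra h'
    exact hi (hd0 i h')
  have hx : x ∈ B := key x (by rcases h with h | h; exacts [h.1.ne', h.1.ne])
  have hy : y ∈ B := key y (by rcases h with h | h; exacts [h.2.1.ne, h.2.1.ne'])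
  have hz : z ∈ B := key z (by rcases h with h | h; exacts [h.2.2.ne', h.2.2.ne])
  exact absurd (two_lt_card_of_lt_lt hxy hyz hx hy hz) (by omega)

/-! ### Combinatorial tilings and the covering by intervals -/

/-- A combinatorial tiling: the function `f` assigns to each pair `B` the set `f B` which together
with `B` labels a tile, and the vertices of the tiles do not orient any circuit in both ways. The
values of `f` on sets that are not pairs are irrelevant. -/
structure IsArrangement {n : ℕ} (a : Fin n → ℝ) (f : Finset (Fin n) → Finset (Fin n)) :
    Prop where
  disj : ∀ B, B.card = 2 → Disjoint (f B) B
  compat : ∀ B B', B.card = 2 → B'.card = 2 → ∀ x y z, a x < a y → a y < a z →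
    y ∈ f B ∪ B → x ∉ f B → z ∉ f B → x ∈ f B' ∪ B' → z ∈ f B' ∪ B' → y ∈ f B'

/-- The collection of tiles `(f B, B)`, for `B` a pair. -/
def labelTiling {n : ℕ} (f : Finset (Fin n) → Finset (Fin n)) : Finset (FaceLabel n) :=
  (Finset.univ.powersetCard 2).image fun B => (f B, B)

theorem mem_labelTiling {n : ℕ} {f : Finset (Fin n) → Finset (Fin n)} {p : FaceLabel n} :
    p ∈ labelTiling f ↔ p.2.card = 2 ∧ f p.2 = p.1 := by
  obtain ⟨A, B⟩ := p
  simp only [labelTiling, Finset.mem_image, Finset.mem_powersetCard, Finset.subset_univ, true_and,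
    Prod.mk.injEq]
  constructor
  · rintro ⟨B, h, rfl, rfl⟩; exact ⟨h, rfl⟩
  · rintro ⟨h, rfl⟩; exact ⟨B, h, rfl, rfl⟩

theorem mk_mem_labelTiling {n : ℕ} (f : Finset (Fin n) → Finset (Fin n)) {B : Finset (Fin n)}
    (hB : B.card = 2) : (f B, B) ∈ labelTiling f :=
  mem_labelTiling.2 ⟨hB, rfl⟩

/-- The tiles of a combinatorial tiling use each point of the zonotope at most once: by
`exists_alternating`, two preimages would differ along a circuit that two tiles orient in opposite
ways. -/
theorem IsArrangement.preimage_unique {n : ℕ} {a : Fin n → ℝ} (ha : Function.Injective a)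
    {f : Finset (Fin n) → Finset (Fin n)} (hf : IsArrangement a f) {p q : FaceLabel n}
    (hp : p ∈ labelTiling f) (hq : q ∈ labelTiling f) {u w : Fin n → ℝ} (hu : u ∈ cubeFace p)
    (hw : w ∈ cubeFace q) (h : proj a u = proj a w) : u = w := by
  obtain ⟨hp1, hp2⟩ := mem_labelTiling.1 hp
  obtain ⟨hq1, hq2⟩ := mem_labelTiling.1 hq
  have key : ∀ {p q : FaceLabel n}, p.2.card = 2 → q.2.card = 2 → f p.2 = p.1 → f q.2 = q.1 →
      ∀ {u w : Fin n → ℝ}, u ∈ cubeFace p → w ∈ cubeFace q → ∀ {x y z}, a x < a y → a y < a z →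
      ¬ (w x < u x ∧ u y < w y ∧ w z < u z) := by
    rintro p q hp1 hq1 hp2 hq2 u w hu hw x y z hxy hyz ⟨h1, h2, h3⟩
    have b1 := fun i => hu.1 i
    have b2 := fun i => hw.1 i
    refine cubeFace_notMem_fst hu (h2.trans_le (b2 y).2) (hp2 ▸
      hf.compat q.2 p.2 hq1 hp1 x y z hxy hyz ?_ ?_ ?_ ?_ ?_)
    · rw [hq2]; exact cubeFace_mem_fst_union_snd hw ((b1 y).1.trans_lt h2)
    · rw [hq2]; exact cubeFace_notMem_fst hw (h1.trans_le (b1 x).2)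
    · rw [hq2]; exact cubeFace_notMem_fst hw (h3.trans_le (b1 z).2)
    · rw [hp2]; exact cubeFace_mem_fst_union_snd hu ((b2 x).1.trans_lt h1)
    · rw [hp2]; exact cubeFace_mem_fst_union_snd hu ((b2 z).1.trans_lt h3)
  refine eq_of_proj_eq ha h fun x y z hxy hyz hno => ?_
  rcases hno with hno | hno
  · exact key hp1 hq1 hp2 hq2 hu hw hxy hyz hno
  · exact key hq1 hp1 hq2 hp2 hw hu hxy hyz hno

theorem image_inter_eq_of_preimage_unique {n : ℕ} {a : Fin n → ℝ} {s t : Set (Fin n → ℝ)}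
    (h : ∀ u ∈ s, ∀ w ∈ t, proj a u = proj a w → u = w) :
    proj a '' (s ∩ t) = proj a '' s ∩ proj a '' t := by
  refine (Set.image_inter_subset _ _ _).antisymm ?_
  rintro _ ⟨⟨u, hu, rfl⟩, w, hw, hwu⟩
  exact ⟨u, ⟨hu, h u hu w hw hwu.symm ▸ hw⟩, rfl⟩

/-- A combinatorial tiling is a fine zonotopal tiling as soon as it covers the zonotope. -/
theorem IsArrangement.isFineZonotopalTiling_of_cover {n : ℕ} {a : Fin n → ℝ}
    (ha : Function.Injective a) {f : Finset (Fin n) → Finset (Fin n)} (hf : IsArrangement a f)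
    (h : ⋃ p ∈ labelTiling f, tile a p = zonotope a) :
    IsFineZonotopalTiling a (labelTiling f) where
  disjoint p hp := by
    obtain ⟨h1, h2⟩ := mem_labelTiling.1 hp
    exact h2 ▸ hf.disj _ h1
  card_eq p hp := (mem_labelTiling.1 hp).1
  indep p hp := linearIndependent_liftVec_pair ha (mem_labelTiling.1 hp).1.le
  cover := h
  inter p hp q hq := image_inter_eq_of_preimage_unique fun u hu w hw h =>
    hf.preimage_unique ha hp hq hu hw h

/-- The elements whose points lie strictly between two points indexed by `B`. -/
noncomputable def between {n : ℕ} (a : Fin n → ℝ) (B : Finset (Fin n)) : Finset (Fin n) :=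
  Finset.univ.filter fun s => (∃ i ∈ B, a i < a s) ∧ ∃ j ∈ B, a s < a j

theorem mem_between {n : ℕ} {a : Fin n → ℝ} {B : Finset (Fin n)} {s : Fin n} :
    s ∈ between a B ↔ (∃ i ∈ B, a i < a s) ∧ ∃ j ∈ B, a s < a j := by
  simp [between]

theorem mem_between_pair {n : ℕ} {a : Fin n → ℝ} {i j s : Fin n} (h : a i < a j) :
    s ∈ between a {i, j} ↔ a i < a s ∧ a s < a j := by
  simp only [mem_between, Finset.mem_insert, Finset.mem_singleton, exists_eq_or_imp,
    exists_eq_left]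
  constructor
  · rintro ⟨h1 | h1, h2 | h2⟩
    · exact absurd h1 h2.not_gt
    · exact ⟨h1, h2⟩
    · exact absurd (h1.trans h2) h.not_gt
    · exact absurd h1 h2.not_gt
  · rintro ⟨h1, h2⟩; exact ⟨.inl h1, .inr h2⟩

theorem exists_pair_eq {n : ℕ} {a : Fin n → ℝ} (ha : Function.Injective a) {B : Finset (Fin n)}
    (hB : B.card = 2) : ∃ i j, a i < a j ∧ B = {i, j} := by
  obtain ⟨i, j, hij, rfl⟩ := Finset.card_eq_two.1 hB
  rcases lt_or_gt_of_ne (ha.ne hij) with h | h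
  · exact ⟨i, j, h, rfl⟩
  · exact ⟨j, i, h, Finset.pair_comm i j⟩

theorem isArrangement_between {n : ℕ} {a : Fin n → ℝ} (ha : Function.Injective a) :
    IsArrangement a (between a) where
  disj B hB := by
    obtain ⟨i, j, hij, rfl⟩ := exists_pair_eq ha hB
    rw [Finset.disjoint_left]
    intro s hs
    rw [mem_between_pair hij] at hs
    rw [Finset.mem_insert, Finset.mem_singleton]
    rintro (rfl | rfl)
    exacts [lt_irrefl _ hs.1, lt_irrefl _ hs.2]
  compat B B' hB hB' x y z hxy hyz _ _ _ hx hz := by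
    have h1 : ∃ i ∈ B', a i < a y := by
      rcases Finset.mem_union.1 hx with h | h
      · obtain ⟨⟨i, hi, h⟩, -⟩ := mem_between.1 h
        exact ⟨i, hi, h.trans hxy⟩
      · exact ⟨x, h, hxy⟩
    have h2 : ∃ i ∈ B', a y < a i := by
      rcases Finset.mem_union.1 hz with h | h
      · obtain ⟨-, i, hi, h⟩ := mem_between.1 h
        exact ⟨i, hi, hyz.trans h⟩
      · exact ⟨z, h, hyz⟩
    exact mem_between.2 ⟨h1, h2⟩

theorem continuous_proj {n : ℕ} (a : Fin n → ℝ) : Continuous (proj a) := by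
  unfold proj; fun_prop

theorem isCompact_unitCube (n : ℕ) : IsCompact (unitCube n) := by
  have : unitCube n = Set.univ.pi fun _ => Set.Icc 0 1 := by
    ext x; simp [unitCube, -Set.pi_univ_Icc]
  rw [this]
  exact isCompact_univ_pi fun _ => isCompact_Icc

theorem cubeFace_subset_unitCube {n : ℕ} (p : FaceLabel n) : cubeFace p ⊆ unitCube n :=
  fun _ h => h.1

theorem isClosed_cubeFace {n : ℕ} (p : FaceLabel n) : IsClosed (cubeFace p) := by
  have : cubeFace p = unitCube n ∩ ((⋂ i ∈ p.1, {x | x i = 1}) ∩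
      ⋂ i, ⋂ (_ : i ∉ p.1), ⋂ (_ : i ∉ p.2), {x | x i = 0}) := by
    ext x; simp [cubeFace]; tauto
  rw [this]
  exact (isCompact_unitCube n).isClosed.inter ((isClosed_biInter fun i _ =>
    isClosed_eq (continuous_apply i) continuous_const).inter (isClosed_iInter fun i =>
    isClosed_iInter fun _ => isClosed_iInter fun _ =>
    isClosed_eq (continuous_apply i) continuous_const))

theorem isCompact_cubeFace {n : ℕ} (p : FaceLabel n) : IsCompact (cubeFace p) :=
  (isCompact_unitCube n).of_isClosed_subset (isClosed_cubeFace p) (cubeFace_subset_unitCube p)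

theorem isCompact_tile {n : ℕ} (a : Fin n → ℝ) (p : FaceLabel n) : IsCompact (tile a p) :=
  (isCompact_cubeFace p).image (continuous_proj a)

theorem tile_subset_zonotope {n : ℕ} (a : Fin n → ℝ) (p : FaceLabel n) :
    tile a p ⊆ zonotope a :=
  Set.image_mono (cubeFace_subset_unitCube p)

/-- The pairing with a vector supported on three coordinates, which need not be distinct: a vector
supported on two coordinates is treated as one with a zero entry at a repeated coordinate. -/
theorem sum_ite_mul_three {n : ℕ} (x y z : Fin n) (α β γ : ℝ) (g : Fin n → ℝ) :
    ∑ i, ((if i = x then α else 0) + (if i = y then β else 0) + (if i = z then γ else 0)) * g i =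
      α * g x + β * g y + γ * g z := by
  simp [add_mul, Finset.sum_add_distrib, ite_mul]

/-- Every point of the zonotope has a preimage in the cube without the pattern `y i > 0`,
`y j < 1`, `y l > 0` for `a i < a j < a l`: take the preimage that minimizes the sum
of the squares `a i ^ 2` with weights `y i`. -/
theorem exists_preimage_unimodal {n : ℕ} (a : Fin n → ℝ) {u : Fin n → ℝ} (hu : u ∈ unitCube n) :
    ∃ y ∈ unitCube n, proj a y = proj a u ∧
      ∀ i j l, a i < a j → a j < a l → 0 < y i → 0 < y l → y j = 1 := by
  have hK : IsCompact (unitCube n ∩ {y | proj a y = proj a u}) :=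
    (isCompact_unitCube n).inter_right (isClosed_eq (continuous_proj a) continuous_const)
  obtain ⟨y, ⟨hy, hyu⟩, hmin⟩ := hK.exists_isMinOn ⟨u, hu, rfl⟩
    (f := fun y => ∑ i, y i * a i ^ 2) (by fun_prop)
  refine ⟨y, hy, hyu, fun i j l hij hjl h1 h2 => ?_⟩
  by_contra hj
  have hj1 : y j < 1 := lt_of_le_of_ne (hy j).2 hj
  have nij : i ≠ j := fun h => by simp [h] at hij
  have njl : j ≠ l := fun h => by simp [h] at hjl
  have nil : i ≠ l := fun h => by rw [h] at hij; exact lt_asymm hij hjl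
  set α := a l - a j with hα
  set β := a l - a i with hβ
  set γ := a j - a i with hγ
  have p1 : 0 < α := by linarith
  have p2 : 0 < β := by linarith
  have p3 : 0 < γ := by linarith
  obtain ⟨ε, hε, e1, e2, e3⟩ : ∃ ε > 0, ε * α ≤ y i ∧ ε * β ≤ 1 - y j ∧ ε * γ ≤ y l := by
    refine ⟨min (y i / α) (min ((1 - y j) / β) (y l / γ)), ?_, ?_, ?_, ?_⟩
    · have : 0 < 1 - y j := by linarith
      positivity
    · rw [← le_div_iff₀ p1]; exact min_le_left _ _
    · rw [← le_div_iff₀ p2]; exact (min_le_right _ _).trans (min_le_left _ _)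
    · rw [← le_div_iff₀ p3]; exact (min_le_right _ _).trans (min_le_right _ _)
  let d : Fin n → ℝ := fun s => (if s = i then -(ε * α) else 0) + (if s = j then ε * β else 0) +
    (if s = l then -(ε * γ) else 0)
  have hd : ∀ g : Fin n → ℝ, ∑ s, d s * g s = -(ε * α) * g i + ε * β * g j + -(ε * γ) * g l :=
    sum_ite_mul_three i j l _ _ _
  have hmem : y + d ∈ unitCube n := by
    intro s
    have := hy s
    by_cases s1 : s = i
    · subst s1
      have : d s = -(ε * α) := by simp [d, nij, nil]
      simp only [Pi.add_apply, this]
      constructor <;> nlinarith [mul_pos hε p1]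
    by_cases s2 : s = j
    · subst s2
      have : d s = ε * β := by simp [d, s1, njl]
      simp only [Pi.add_apply, this]
      constructor <;> nlinarith [mul_pos hε p2]
    by_cases s3 : s = l
    · subst s3
      have : d s = -(ε * γ) := by simp [d, s1, s2]
      simp only [Pi.add_apply, this]
      constructor <;> nlinarith [mul_pos hε p3]
    · have : d s = 0 := by simp [d, s1, s2, s3]
      simpa [this] using hy s
  have hproj : proj a (y + d) = proj a u := by
    rw [← hyu, proj_eq_iff]
    simp only [Pi.add_apply, add_sub_cancel_left]
    have := hd fun _ => 1
    simp only [mul_one] at this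
    refine ⟨?_, ?_⟩
    · rw [this]; simp only [hα, hβ, hγ]; ring
    · rw [hd]; simp only [hα, hβ, hγ]; ring
  have := hmin ⟨hmem, hproj⟩
  simp only [Set.mem_ofPred_eq, Pi.add_apply, add_mul, Finset.sum_add_distrib, hd] at this
  have h3 : -(ε * α) * a i ^ 2 + ε * β * a j ^ 2 + -(ε * γ) * a l ^ 2 = -(ε * (α * β * γ)) := by
    simp only [hα, hβ, hγ]; ring
  have h4 : 0 < ε * (α * β * γ) := by positivity
  linarith

/-- The tiles `(between a B, B)` cover the zonotope: the preimage of `exists_preimage_unimodal`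
is `1` strictly between its outermost positive coordinates. -/
theorem cover_between {n : ℕ} (hn : 2 ≤ n) {a : Fin n → ℝ} (ha : Function.Injective a) :
    ⋃ p ∈ labelTiling (between a), tile a p = zonotope a := by
  refine (Set.iUnion₂_subset fun p _ => tile_subset_zonotope a p).antisymm ?_
  rintro _ ⟨u, hu, rfl⟩
  obtain ⟨y, hy, hyu, hpat⟩ := exists_preimage_unimodal a hu
  suffices ∃ i j, a i < a j ∧ (∀ s, a i < a s → a s < a j → y s = 1) ∧
      ∀ s, 0 < y s → a i ≤ a s ∧ a s ≤ a j by
    obtain ⟨i, j, hij, h1, h2⟩ := this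
    have hB : ({i, j} : Finset (Fin n)).card = 2 :=
      Finset.card_pair fun h => by simp [h] at hij
    refine Set.mem_biUnion (mk_mem_labelTiling _ hB) ⟨y, ⟨hy, ?_, ?_⟩, hyu⟩
    · intro s hs
      rw [mem_between_pair hij] at hs
      exact h1 s hs.1 hs.2
    · intro s hs1 hs2
      by_contra hs
      obtain ⟨h3, h4⟩ := h2 s (lt_of_le_of_ne (hy s).1 (Ne.symm hs))
      simp only [Finset.mem_insert, Finset.mem_singleton, not_or] at hs2
      exact hs1 ((mem_between_pair hij).2
        ⟨lt_of_le_of_ne h3 (ha.ne (Ne.symm hs2.1)), lt_of_le_of_ne h4 (ha.ne hs2.2)⟩)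
  by_cases hone : ∃ i, ∀ s, 0 < y s → s = i
  · -- At most one positive coordinate: use a pair of neighbours on the line.
    obtain ⟨i, hi⟩ := hone
    obtain ⟨j0, hj0⟩ : ∃ j, j ≠ i := by
      have : Nontrivial (Fin n) := Fin.nontrivial_iff_two_le.2 hn
      exact exists_ne i
    obtain ⟨j, hj, hjmin⟩ := Finset.exists_min_image (Finset.univ.erase i)
      (fun j => |a j - a i|) ⟨j0, by simpa using hj0⟩
    have hji : j ≠ i := (Finset.mem_erase.1 hj).1
    have hclose : ∀ s, s ≠ i → |a j - a i| ≤ |a s - a i| := fun s hs => hjmin s (by simpa using hs)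
    rcases lt_or_gt_of_ne (ha.ne hji) with h | h
    · refine ⟨j, i, h, fun s h1 h2 => ?_, fun s hs => by rw [hi s hs]; exact ⟨h.le, le_rfl⟩⟩
      have := hclose s fun h => by simp [h] at h2
      rw [abs_of_neg (by linarith), abs_of_neg (by linarith)] at this
      linarith
    · refine ⟨i, j, h, fun s h1 h2 => ?_, fun s hs => by rw [hi s hs]; exact ⟨le_rfl, h.le⟩⟩
      have := hclose s fun h => by simp [h] at h1
      rw [abs_of_pos (by linarith), abs_of_pos (by linarith)] at this
      linarith
  · push Not at hone
    obtain ⟨s0, hs0, -⟩ := hone ⟨0, by omega⟩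
    have hne : (Finset.univ.filter fun s => 0 < y s).Nonempty := ⟨s0, by simpa using hs0⟩
    obtain ⟨i, hi, himin⟩ := Finset.exists_min_image _ a hne
    obtain ⟨j, hj, hjmax⟩ := Finset.exists_max_image _ a hne
    simp only [Finset.mem_filter, Finset.mem_univ, true_and] at hi hj himin hjmax
    obtain ⟨s, hs, hsi⟩ := hone i
    refine ⟨i, j, ?_, fun s h1 h2 => hpat i s j h1 h2 hi hj, fun s hs => ⟨himin s hs, hjmax s hs⟩⟩
    exact (lt_of_le_of_ne (himin s hs) (ha.ne hsi.symm)).trans_le (hjmax s hs)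

/-! ### Areas of tiles -/

open MeasureTheory in
theorem volume_level_set {c d : ℝ} : volume {v : ℝ × ℝ | v.1 - c * v.2 = d} = 0 := by
  let φ : ℝ × ℝ →ₗ[ℝ] ℝ := LinearMap.fst ℝ ℝ ℝ - c • LinearMap.snd ℝ ℝ ℝ
  have hφ : ∀ v : ℝ × ℝ, φ v = v.1 - c * v.2 := fun v => by simp [φ]
  have hker : volume ((LinearMap.ker φ : Submodule ℝ (ℝ × ℝ)) : Set (ℝ × ℝ)) = 0 := by
    refine Measure.addHaar_submodule _ _ fun h => ?_
    have : ((1 : ℝ), (0 : ℝ)) ∈ LinearMap.ker φ := h ▸ Submodule.mem_top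
    rw [LinearMap.mem_ker, hφ] at this
    simp at this
  have : {v : ℝ × ℝ | v.1 - c * v.2 = d} =
      (fun v => v + (-d, 0)) ⁻¹' ((LinearMap.ker φ : Submodule ℝ (ℝ × ℝ)) : Set (ℝ × ℝ)) := by
    ext v
    simp only [Set.mem_ofPred_eq, Set.mem_preimage, SetLike.mem_coe, LinearMap.mem_ker, hφ,
      Prod.fst_add, Prod.snd_add]
    constructor <;> intro h <;> linarith
  rw [this, measure_preimage_add_right, hker]

/-- The point of the cube with support `S`. -/
def cubeVertex {n : ℕ} (S : Finset (Fin n)) : Fin n → ℝ := fun i => if i ∈ S then 1 else 0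

theorem proj_add {n : ℕ} (a x y : Fin n → ℝ) : proj a (x + y) = proj a x + proj a y := by
  simp [proj, add_smul, Finset.sum_add_distrib]

theorem tile_eq_translate {n : ℕ} (a : Fin n → ℝ) {A B : Finset (Fin n)} (h : Disjoint A B) :
    tile a (A, B) = (fun v => proj a (cubeVertex A) + v) '' tile a (∅, B) := by
  ext v
  simp only [tile, Set.mem_image, mem_cubeFace, exists_exists_and_eq_and, ← proj_add]
  constructor
  · rintro ⟨u, ⟨h1, h2, h3⟩, rfl⟩
    refine ⟨u - cubeVertex A, ⟨fun i => ?_, by simp, fun i _ hi => ?_⟩, by simp⟩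
    · by_cases hi : i ∈ A
      · simp [cubeVertex, hi, h2 i hi]
      · simpa [cubeVertex, hi] using h1 i
    · by_cases hA : i ∈ A
      · simp [cubeVertex, hA, h2 i hA]
      · simp [cubeVertex, hA, h3 i hA hi]
  · rintro ⟨u, ⟨h1, -, h3⟩, rfl⟩
    refine ⟨cubeVertex A + u, ⟨fun i => ?_, fun i hi => ?_, fun i hi1 hi2 => ?_⟩, rfl⟩
    · by_cases hi : i ∈ A
      · simp [cubeVertex, hi, h3 i (by simp) (Finset.disjoint_left.1 h hi)]
      · simpa [cubeVertex, hi] using h1 i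
    · simp [cubeVertex, hi, h3 i (by simp) (Finset.disjoint_left.1 h hi)]
    · simp [cubeVertex, hi1, h3 i (by simp) hi2]

open MeasureTheory in
theorem volume_tile {n : ℕ} (a : Fin n → ℝ) {p : FaceLabel n} (h : Disjoint p.1 p.2) :
    volume (tile a p) = volume (tile a (∅, p.2)) := by
  obtain ⟨A, B⟩ := p
  rw [tile_eq_translate a h, Set.image_add_left, measure_preimage_add]

open MeasureTheory in
theorem volume_tile_pos {n : ℕ} {a : Fin n → ℝ} (ha : Function.Injective a)
    {B : Finset (Fin n)} (hB : B.card = 2) : 0 < volume (tile a (∅, B)) := by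
  obtain ⟨i, j, hij, rfl⟩ := exists_pair_eq ha hB
  have hne : i ≠ j := fun h => by simp [h] at hij
  -- The coordinates of a point with respect to the basis `liftVec a i`, `liftVec a j`.
  let s : ℝ × ℝ → ℝ := fun v => (a j * v.2 - v.1) / (a j - a i)
  let t : ℝ × ℝ → ℝ := fun v => (v.1 - a i * v.2) / (a j - a i)
  have hpos : 0 < a j - a i := sub_pos.2 hij
  let O : Set (ℝ × ℝ) := s ⁻¹' Set.Ioo 0 1 ∩ t ⁻¹' Set.Ioo 0 1
  have hO : IsOpen O :=
    (isOpen_Ioo.preimage (by fun_prop)).inter (isOpen_Ioo.preimage (by fun_prop))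
  have hOne : O.Nonempty := by
    refine ⟨((a i + a j) / 2, 1), ?_, ?_⟩ <;>
    simp only [s, t, Set.mem_preimage, Set.mem_Ioo] <;>
    constructor <;> first | (rw [div_lt_one hpos]; linarith) | (apply div_pos _ hpos; linarith)
  refine (hO.measure_pos volume hOne).trans_le (measure_mono ?_)
  rintro v ⟨⟨h1, h2⟩, h3, h4⟩
  let d : Fin n → ℝ := fun k => (if k = i then s v else 0) + (if k = j then t v else 0) +
    (if k = j then 0 else 0)
  have hd : ∀ g : Fin n → ℝ, ∑ k, d k * g k = s v * g i + t v * g j + 0 * g j :=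
    sum_ite_mul_three i j j _ _ _
  refine ⟨d, ⟨fun k => ?_, by simp, fun k _ hk => ?_⟩, ?_⟩
  · by_cases hk : k = i
    · subst hk; simp [d, hne, h1.le, h2.le]
    · by_cases hk' : k = j
      · subst hk'; simp [d, hk, h3.le, h4.le]
      · simp [d, hk, hk']
  · simp only [Finset.mem_insert, Finset.mem_singleton, not_or] at hk
    simp [d, hk.1, hk.2]
  · have h5 := hd fun _ => 1
    simp only [mul_one] at h5
    rw [Prod.ext_iff, proj_fst, proj_snd, h5, hd]
    simp only [s, t]
    constructor <;> (field_simp; ring)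

open MeasureTheory in
/-- Two different tiles overlap in a null set: one of them has a free coordinate that is constant
on the common face, so the intersection lies on a line. -/
theorem volume_tile_inter_tile {n : ℕ} {a : Fin n → ℝ}
    {p q : FaceLabel n} (hp : p.2.card = 2) (hq : q.2.card = 2) (hpq : p ≠ q)
    (hdp : Disjoint p.1 p.2) (hdq : Disjoint q.1 q.2)
    (h : proj a '' (cubeFace p ∩ cubeFace q) = tile a p ∩ tile a q) :
    volume (tile a p ∩ tile a q) = 0 := by
  rw [← h]
  obtain ⟨A, B⟩ := p
  obtain ⟨A', B'⟩ := q
  simp only at hp hq hdp hdq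
  by_cases hB : B = B'
  · subst hB
    have hA : A ≠ A' := fun h => hpq (by rw [h])
    suffices cubeFace (A, B) ∩ cubeFace (A', B) = ∅ by simp [this]
    rw [Set.eq_empty_iff_forall_notMem]
    rintro u ⟨hu1, hu2⟩
    refine hA (Finset.ext fun s => ⟨fun hs => ?_, fun hs => ?_⟩)
    · by_contra hs'
      have h1 := hu2.2.2 s hs' (Finset.disjoint_left.1 hdp hs)
      rw [hu1.2.1 s hs] at h1
      exact one_ne_zero h1
    · by_contra hs'
      have h1 := hu1.2.2 s hs' (Finset.disjoint_left.1 hdq hs)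
      rw [hu2.2.1 s hs] at h1
      exact one_ne_zero h1
  · obtain ⟨i, hi, hi'⟩ : ∃ i ∈ B, i ∉ B' := by
      by_contra! hsub
      exact hB (Finset.eq_of_subset_of_card_le hsub (by omega))
    obtain ⟨j, hj⟩ : ∃ j, B.erase i = {j} := Finset.card_eq_one.1 (by
      rw [Finset.card_erase_of_mem hi, hp])
    by_cases hne : (cubeFace (A, B) ∩ cubeFace (A', B')).Nonempty
    swap
    · simp [Set.not_nonempty_iff_eq_empty.1 hne]
    obtain ⟨w, hw1, hw2⟩ := hne
    refine measure_mono_null ?_ (volume_level_set (c := a j)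
      (d := (proj a w).1 - a j * (proj a w).2))
    rintro _ ⟨u, ⟨hu1, hu2⟩, rfl⟩
    have key : ∑ s, u s * (a s - a j) = ∑ s, w s * (a s - a j) := by
      refine Finset.sum_congr rfl fun s _ => ?_
      by_cases hsi : s = i
      · rw [hsi, cubeFace_eq_of_notMem hu2 hw2 hi']
      · by_cases hsj : s = j
        · simp [hsj]
        · rw [cubeFace_eq_of_notMem hu1 hw1]
          intro hs
          have : s ∈ B.erase i := Finset.mem_erase.2 ⟨hsi, hs⟩
          rw [hj, Finset.mem_singleton] at this
          exact hsj this
    simp only [mul_sub, Finset.sum_sub_distrib, ← Finset.sum_mul] at key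
    simp only [Set.mem_ofPred_eq, proj_fst, proj_snd]
    linarith

open MeasureTheory in
theorem volume_iUnion_tile {n : ℕ} {a : Fin n → ℝ}
    {T : Finset (FaceLabel n)} (hT : ∀ p ∈ T, Disjoint p.1 p.2) (hT2 : ∀ p ∈ T, p.2.card = 2)
    (h : ∀ p ∈ T, ∀ q ∈ T, proj a '' (cubeFace p ∩ cubeFace q) = tile a p ∩ tile a q) :
    volume (⋃ p ∈ T, tile a p) = ∑ p ∈ T, volume (tile a (∅, p.2)) := by
  rw [measure_biUnion_finset₀ (fun p hp q hq hpq => volume_tile_inter_tile (hT2 p hp) (hT2 q hq)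
    hpq (hT p hp) (hT q hq) (h p hp q hq))
    fun p _ => (isCompact_tile a p).measurableSet.nullMeasurableSet]
  exact Finset.sum_congr rfl fun p hp => volume_tile a (hT p hp)

open MeasureTheory in
theorem IsArrangement.volume_iUnion_labelTiling {n : ℕ} {a : Fin n → ℝ} (ha : Function.Injective a)
    {f : Finset (Fin n) → Finset (Fin n)} (hf : IsArrangement a f) :
    volume (⋃ p ∈ labelTiling f, tile a p) =
      ∑ B ∈ Finset.univ.powersetCard 2, volume (tile a (∅, B)) := by
  rw [volume_iUnion_tile
    (fun p hp => (mem_labelTiling.1 hp).2 ▸ hf.disj _ (mem_labelTiling.1 hp).1)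
    (fun p hp => (mem_labelTiling.1 hp).1)
    (fun p hp q hq => image_inter_eq_of_preimage_unique fun u hu w hw h =>
      hf.preimage_unique ha hp hq hu hw h), labelTiling, Finset.sum_image]
  rintro B - B' - h
  exact (Prod.mk.inj h).2

open MeasureTheory in
theorem volume_zonotope {n : ℕ} (hn : 2 ≤ n) {a : Fin n → ℝ} (ha : Function.Injective a) :
    volume (zonotope a) = ∑ B ∈ Finset.univ.powersetCard 2, volume (tile a (∅, B)) := by
  rw [← cover_between hn ha, (isArrangement_between ha).volume_iUnion_labelTiling ha]

theorem convex_zonotope {n : ℕ} (a : Fin n → ℝ) : Convex ℝ (zonotope a) := by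
  have : IsLinearMap ℝ (proj a) :=
    ⟨proj_add a, fun c x => by simp [proj, Finset.smul_sum, mul_smul]⟩
  refine Convex.is_linear_image ?_ this
  intro x hx y hy s t hs ht hst i
  have h1 := hx i
  have h2 := hy i
  simp only [Pi.add_apply, Pi.smul_apply, smul_eq_mul]
  constructor
  · have := mul_nonneg hs h1.1
    have := mul_nonneg ht h2.1
    linarith
  · nlinarith

open MeasureTheory in
/-- Every combinatorial tiling is a fine zonotopal tiling: it has one tile for each pair, so it
has the area of the whole zonotope. -/
theorem IsArrangement.isFineZonotopalTiling {n : ℕ} (hn : 2 ≤ n) {a : Fin n → ℝ}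
    (ha : Function.Injective a) {f : Finset (Fin n) → Finset (Fin n)} (hf : IsArrangement a f) :
    IsFineZonotopalTiling a (labelTiling f) := by
  refine hf.isFineZonotopalTiling_of_cover ha ?_
  set V := ⋃ p ∈ labelTiling f, tile a p with hV
  have hVZ : V ⊆ zonotope a := Set.iUnion₂_subset fun p _ => tile_subset_zonotope a p
  have hVc : IsCompact V := (labelTiling f).isCompact_biUnion fun p _ => isCompact_tile a p
  have hZfin : volume (zonotope a) ≠ ⊤ :=
    ((isCompact_unitCube n).image (continuous_proj a)).measure_lt_top.ne
  have hvol : volume V = volume (zonotope a) := by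
    rw [hV, hf.volume_iUnion_labelTiling ha, volume_zonotope hn ha]
  have hdiff : volume (zonotope a \ V) = 0 := by
    rw [measure_sdiff hVZ hVc.measurableSet.nullMeasurableSet (hvol ▸ hZfin), hvol, tsub_self]
  have hpos : 0 < volume (zonotope a) := by
    have hB : ({⟨0, by omega⟩, ⟨1, by omega⟩} : Finset (Fin n)).card = 2 :=
      Finset.card_pair (by simp)
    exact (volume_tile_pos ha hB).trans_le (measure_mono (tile_subset_zonotope a _))
  have hint : (interior (zonotope a)).Nonempty := by
    rw [Set.nonempty_iff_ne_empty]
    intro h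
    have h1 := (convex_zonotope a).addHaar_frontier volume
    rw [frontier, h, Set.sdiff_empty] at h1
    exact hpos.ne' (measure_mono_null subset_closure h1)
  refine hVZ.antisymm fun z hz => ?_
  by_contra hzV
  have hcl : z ∈ closure (interior (zonotope a)) := by
    rw [(convex_zonotope a).closure_interior_eq_closure_of_nonempty_interior hint]
    exact subset_closure hz
  have hO : (Vᶜ ∩ interior (zonotope a)).Nonempty :=
    mem_closure_iff.1 hcl _ hVc.isClosed.isOpen_compl hzV
  refine ((hVc.isClosed.isOpen_compl.inter isOpen_interior).measure_pos volume hO).ne' ?_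
  exact measure_mono_null (t := zonotope a \ V) (fun v hv => ⟨interior_subset hv.2, hv.1⟩) hdiff

open MeasureTheory in
/-- A fine zonotopal tiling has no room for tiles besides a subcollection with one tile for each
pair. -/
theorem IsFineZonotopalTiling.eq_labelTiling {n : ℕ} (hn : 2 ≤ n) {a : Fin n → ℝ}
    (ha : Function.Injective a) {T : Finset (FaceLabel n)} (hT : IsFineZonotopalTiling a T)
    {f : Finset (Fin n) → Finset (Fin n)} (hfT : labelTiling f ⊆ T) : T = labelTiling f := by
  have h1 := volume_iUnion_tile hT.disjoint hT.card_eq hT.inter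
  have h2 : ∑ p ∈ labelTiling f, volume (tile a (∅, p.2)) = volume (zonotope a) := by
    rw [volume_zonotope hn ha, labelTiling, Finset.sum_image]
    rintro B - B' - h
    exact (Prod.mk.inj h).2
  rw [hT.cover, ← Finset.sum_sdiff hfT, h2] at h1
  have hZfin : volume (zonotope a) ≠ ⊤ :=
    ((isCompact_unitCube n).image (continuous_proj a)).measure_lt_top.ne
  have h3 : ∑ p ∈ T \ labelTiling f, volume (tile a (∅, p.2)) = 0 := by
    have h4 : 0 + volume (zonotope a) =
        ∑ p ∈ T \ labelTiling f, volume (tile a (∅, p.2)) + volume (zonotope a) := by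
      rw [zero_add, ← h1]
    exact ((ENNReal.add_left_inj hZfin).1 h4).symm
  refine Finset.Subset.antisymm (fun p hp => ?_) hfT
  by_contra hpf
  exact (volume_tile_pos ha (hT.card_eq p hp)).ne'
    (Finset.sum_eq_zero_iff.1 h3 p (Finset.mem_sdiff.2 ⟨hp, hpf⟩))

/-! ### Tiles to the right of an edge -/

/-- The midpoint of the edge of the cube from `S` to `S ∪ {i}`, for `i ∉ S`. -/
noncomputable def edgeMid {n : ℕ} (S : Finset (Fin n)) (i : Fin n) : Fin n → ℝ :=
  fun s => if s ∈ S then 1 else if s = i then 1 / 2 else 0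

/-- The image of the midpoint of the cube edge from `S` to `S ∪ {i}` has no other preimage in the
faces of the cube in `T`. This holds for the edges of the tiles and on the left boundary. -/
def IsUniqueEdge {n : ℕ} (a : Fin n → ℝ) (T : Finset (FaceLabel n)) (S : Finset (Fin n))
    (i : Fin n) : Prop :=
  ∀ q ∈ T, ∀ w ∈ cubeFace q, proj a w = proj a (edgeMid S i) → w = edgeMid S i

theorem sum_sub_mul_of_mem_cubeFace {n : ℕ} {p : FaceLabel n} {i r : Fin n} (hir : i ≠ r)
    (hp : p.2 = {i, r}) {u w : Fin n → ℝ} (hu : u ∈ cubeFace p) (hw : w ∈ cubeFace p)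
    (g : Fin n → ℝ) :
    ∑ s, (w s - u s) * g s = (w i - u i) * g i + (w r - u r) * g r := by
  rw [← Finset.sum_subset (Finset.subset_univ {i, r}) fun s _ hs => ?_, Finset.sum_pair hir]
  rw [cubeFace_eq_of_notMem hw hu (hp ▸ hs), sub_self, zero_mul]

theorem edgeMid_mem_unitCube {n : ℕ} (S : Finset (Fin n)) (i : Fin n) :
    edgeMid S i ∈ unitCube n := by
  intro s
  unfold edgeMid
  split_ifs <;> norm_num

open Filter Topology in
/-- An edge of the tiling that is not on the right boundary of the zonotope is the lower left or
the upper left edge of a tile: some tile contains points arbitrarily close to the midpoint of the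
edge on its right, hence also the midpoint. -/
theorem IsFineZonotopalTiling.exists_right_tile {n : ℕ} {a : Fin n → ℝ}
    (ha : Function.Injective a) {T : Finset (FaceLabel n)} (hT : IsFineZonotopalTiling a T)
    {S : Finset (Fin n)} {i : Fin n} (hi : i ∉ S) (hE : IsUniqueEdge a T S i)
    (hne : S ≠ Finset.univ.filter fun s => a i < a s) :
    (∃ r, a i < a r ∧ r ∉ S ∧ (S, {i, r}) ∈ T) ∨
      ∃ r ∈ S, a r < a i ∧ (S.erase r, {r, i}) ∈ T := by
  set u := edgeMid S i with hu
  have hui : u i = 1 / 2 := by simp [hu, edgeMid, hi]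
  have huS : ∀ s ∈ S, u s = 1 := fun s hs => by simp [hu, edgeMid, hs]
  have huS' : ∀ s, s ∉ S → s ≠ i → u s = 0 := fun s hs hsi => by simp [hu, edgeMid, hs, hsi]
  -- A direction `c • (e_r - e_i)` that leads from `u` into the cube and to the right.
  obtain ⟨r, c, hri, hκ, hcube⟩ : ∃ r c, r ≠ i ∧ 0 < c * (a r - a i) ∧
      ((c = 1 ∧ u r = 0) ∨ (c = -1 ∧ u r = 1)) := by
    by_contra! hno
    refine hne (Finset.ext fun s => ?_)
    simp only [Finset.mem_filter, Finset.mem_univ, true_and]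
    constructor
    · intro hs
      have hsi : s ≠ i := fun h => hi (h ▸ hs)
      by_contra! hlt
      have hlt' := lt_of_le_of_ne hlt (ha.ne hsi)
      exact (hno s (-1) hsi (by linarith)).2 rfl (huS s hs)
    · intro hs
      have hsi : s ≠ i := fun h => by simp [h] at hs
      by_contra hS
      exact (hno s 1 hsi (by linarith)).1 rfl (huS' s hS hsi)
  let d : Fin n → ℝ := fun s => (if s = r then c else 0) + (if s = i then -c else 0) +
    (if s = i then 0 else 0)
  have hd : ∀ g : Fin n → ℝ, ∑ s, d s * g s = c * g r + -c * g i + 0 * g i :=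
    sum_ite_mul_three r i i _ _ _
  let γ : ℝ → ℝ × ℝ := fun t => proj a (u + t • d)
  have hγ : Continuous γ := (continuous_proj a).comp (by fun_prop)
  have hγ0 : γ 0 = proj a u := by simp [γ]
  have hev : ∀ᶠ t in 𝓝[>] (0 : ℝ), ∃ q ∈ T, γ t ∈ tile a q := by
    filter_upwards [Ioo_mem_nhdsGT (show (0 : ℝ) < 1 / 2 by norm_num)] with t ht
    have hmem : γ t ∈ zonotope a := by
      refine ⟨_, fun s => ?_, rfl⟩
      have hs := edgeMid_mem_unitCube S i s
      rw [← hu] at hs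
      simp only [Pi.add_apply, Pi.smul_apply, smul_eq_mul, d]
      have h1 := ht.1
      have h2 := ht.2
      by_cases hsr : s = r
      · subst hsr
        rcases hcube with ⟨rfl, h⟩ | ⟨rfl, h⟩ <;> simp only [h, hri, if_true, if_false] <;>
          constructor <;> linarith
      · by_cases hsi : s = i
        · subst hsi
          rcases hcube with ⟨rfl, h⟩ | ⟨rfl, h⟩ <;> simp only [hui, hsr, if_true, if_false] <;>
          constructor <;> linarith
        · simpa [hsr, hsi] using hs
    rw [← hT.cover] at hmem
    simpa using hmem
  obtain ⟨q, hq, hfreq⟩ : ∃ q ∈ T, ∃ᶠ t in 𝓝[>] (0 : ℝ), γ t ∈ tile a q := by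
    by_contra! hno
    have := (Filter.eventually_all_finset T).2 hno
    obtain ⟨t, ⟨q, hq, h1⟩, h2⟩ := (hev.and this).exists
    exact h2 q hq h1
  have huq : u ∈ cubeFace q := by
    obtain ⟨w, hw, hwu⟩ : proj a u ∈ tile a q := by
      rw [← hγ0]
      exact (isCompact_tile a q).isClosed.mem_of_frequently_of_tendsto hfreq
        (hγ.continuousWithinAt.tendsto)
    rw [hu, ← hE q hq w hw hwu]
    exact hw
  obtain ⟨t, ⟨w, hw, hwt⟩, ht⟩ := (hfreq.and_eventually self_mem_nhdsWithin).exists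
  have ht : 0 < t := ht
  obtain ⟨h0, h1⟩ := (proj_eq_iff a _ _).1 hwt
  have hs0 : ∑ s, (w s - u s) = 0 := by
    have h2 := hd fun _ => 1
    have h3 : ∑ s, (w s - (u + t • d) s) = ∑ s, (w s - u s) - t * ∑ s, d s * 1 := by
      rw [Finset.mul_sum, ← Finset.sum_sub_distrib]
      exact Finset.sum_congr rfl fun s _ => by simp; ring
    rw [h3, h2] at h0
    linarith
  have hs1 : ∑ s, (w s - u s) * a s = t * (c * (a r - a i)) := by
    have h2 := hd a
    have h3 : ∑ s, (w s - (u + t • d) s) * a s =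
        ∑ s, (w s - u s) * a s - t * ∑ s, d s * a s := by
      rw [Finset.mul_sum, ← Finset.sum_sub_distrib]
      exact Finset.sum_congr rfl fun s _ => by simp; ring
    rw [h3, h2] at h1
    linarith
  have hiB : i ∈ q.2 := by
    have h2 := cubeFace_mem_fst_union_snd huq (i := i) (by rw [hui]; norm_num)
    have h3 := cubeFace_notMem_fst huq (i := i) (by rw [hui]; norm_num)
    exact (Finset.mem_union.1 h2).resolve_left h3
  obtain ⟨r', hr'⟩ : ∃ r', q.2.erase i = {r'} := Finset.card_eq_one.1 (by
    rw [Finset.card_erase_of_mem hiB, hT.card_eq q hq])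
  have hB : q.2 = {i, r'} := by rw [← Finset.insert_erase hiB, hr']
  have hr'B : r' ∈ q.2.erase i := hr' ▸ Finset.mem_singleton_self _
  have hir' : i ≠ r' := (Finset.ne_of_mem_erase hr'B).symm
  have hr'A : r' ∉ q.1 := Finset.disjoint_right.1 (hT.disjoint q hq) (Finset.mem_of_mem_erase hr'B)
  have hiA : i ∉ q.1 := Finset.disjoint_right.1 (hT.disjoint q hq) hiB
  have e0 := sum_sub_mul_of_mem_cubeFace hir' hB huq hw fun _ => 1
  have e1 := sum_sub_mul_of_mem_cubeFace hir' hB huq hw a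
  simp only [mul_one] at e0
  rw [hs0] at e0
  rw [hs1] at e1
  have hprod : 0 < (w r' - u r') * (a r' - a i) := by
    have h2 : (w r' - u r') * (a r' - a i) = t * (c * (a r - a i)) := by
      rw [e1]; linear_combination a i * e0
    rw [h2]; positivity
  have hA : ∀ s, s ≠ i → s ≠ r' → (s ∈ q.1 ↔ s ∈ S) := by
    intro s hsi hsr
    constructor
    · intro hs
      by_contra hS
      have := huq.2.1 s hs
      rw [huS' s hS hsi] at this
      exact zero_ne_one this
    · intro hS
      by_contra hs
      have := huq.2.2 s hs (by simp [hB, hsi, hsr])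
      rw [huS s hS] at this
      exact one_ne_zero this
  by_cases hrS : r' ∈ S
  · right
    have hlt : a r' < a i := by
      have := (hw.1 r').2
      rw [huS r' hrS] at hprod
      nlinarith
    refine ⟨r', hrS, hlt, ?_⟩
    have : q = (S.erase r', {r', i}) := Prod.ext (Finset.ext fun s => ?_)
      (by rw [hB, Finset.pair_comm])
    · exact this ▸ hq
    · rw [Finset.mem_erase]
      by_cases hsi : s = i
      · subst hsi; simp [hiA, hi]
      · by_cases hsr : s = r'
        · subst hsr; simp [hr'A]
        · simp [hA s hsi hsr, hsr]
  · left
    have hlt : a i < a r' := by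
      have := (hw.1 r').1
      rw [huS' r' hrS hir'.symm] at hprod
      nlinarith
    refine ⟨r', hlt, hrS, ?_⟩
    have : q = (S, {i, r'}) := Prod.ext (Finset.ext fun s => ?_) hB
    · exact this ▸ hq
    · by_cases hsi : s = i
      · subst hsi; simp [hiA, hi]
      · by_cases hsr : s = r'
        · subst hsr; simp [hr'A, hrS]
        · exact hA s hsi hsr

/-- A tile to the upper right and a tile to the lower right of the same vertex `S ∪ {i}` both
contain the points directly to the right of this vertex, so they are equal. -/
theorem IsFineZonotopalTiling.right_tiles_eq {n : ℕ} {a : Fin n → ℝ}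
    (ha : Function.Injective a) {T : Finset (FaceLabel n)} (hT : IsFineZonotopalTiling a T)
    {S : Finset (Fin n)} {i r r' j : Fin n} (hir : a i < a r) (hp : (S, {i, r}) ∈ T)
    (hr' : r' ∈ insert i S) (hrj : a r' < a j) (hq : ((insert i S).erase r', {r', j}) ∈ T) :
    j = r ∧ r' = i := by
  have d1 := hT.disjoint _ hp
  have d2 := hT.disjoint _ hq
  simp only [Finset.disjoint_insert_right, Finset.disjoint_singleton_right, Finset.mem_erase,
    not_and] at d1 d2
  obtain ⟨hiS, hrS⟩ := d1
  have nir : i ≠ r := fun h => by simp [h] at hir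
  have nrj : r' ≠ j := fun h => by simp [h] at hrj
  have hj : j ∉ insert i S := d2.2 nrj.symm
  set M := (a r - a i) + (a j - a r') with hM
  have hM0 : 0 < M := by linarith
  set t := (a j - a r') / M with ht
  set t' := (a r - a i) / M with ht'
  have ht0 : 0 < t := div_pos (by linarith) hM0
  have ht0' : 0 < t' := div_pos (by linarith) hM0
  have ht1 : t < 1 := by rw [ht, div_lt_one hM0]; linarith
  have ht1' : t' < 1 := by rw [ht', div_lt_one hM0]; linarith
  have htt : t * (a r - a i) = t' * (a j - a r') := by rw [ht, ht']; ring
  let d : Fin n → ℝ := fun s => (if s = r then t else 0) + (if s = i then -t else 0) +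
    (if s = i then 0 else 0)
  have hd : ∀ g : Fin n → ℝ, ∑ s, d s * g s = t * g r + -t * g i + 0 * g i :=
    sum_ite_mul_three r i i _ _ _
  let d' : Fin n → ℝ := fun s => (if s = j then t' else 0) + (if s = r' then -t' else 0) +
    (if s = r' then 0 else 0)
  have hd' : ∀ g : Fin n → ℝ, ∑ s, d' s * g s = t' * g j + -t' * g r' + 0 * g r' :=
    sum_ite_mul_three j r' r' _ _ _
  have hmem : ∀ {x y : Fin n} {τ : ℝ} (B : Finset (Fin n)), x ∈ insert i S → y ∉ insert i S →
      0 < τ → τ < 1 → B = {x, y} → cubeVertex (insert i S) +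
      (fun s => (if s = y then τ else 0) + (if s = x then -τ else 0) + (if s = x then 0 else 0)) ∈
        cubeFace ((insert i S).erase x, B) := by
    intro x y τ B hx hy h0 h1 hB
    have hxy : x ≠ y := fun h => hy (h ▸ hx)
    refine ⟨fun s => ?_, fun s hs => ?_, fun s hs1 hs2 => ?_⟩
    · simp only [cubeVertex, Pi.add_apply]
      by_cases hsx : s = x
      · subst hsx; simp only [hx, hxy, if_true, if_false]; constructor <;> linarith
      · by_cases hsy : s = y
        · subst hsy; simp only [hy, hsx, if_true, if_false]; constructor <;> linarith
        · simp only [hsx, hsy, if_false]; split_ifs <;> norm_num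
    · obtain ⟨h2, h3⟩ := Finset.mem_erase.1 hs
      have hsy : s ≠ y := fun h => hy (h ▸ h3)
      simp only [cubeVertex, Pi.add_apply, h2, h3, hsy, if_true, if_false]; norm_num
    · simp only [hB, Finset.mem_insert, Finset.mem_singleton, not_or] at hs2
      have h3 : s ∉ insert i S := fun h => hs1 (Finset.mem_erase.2 ⟨hs2.1, h⟩)
      simp only [cubeVertex, Pi.add_apply, hs2.1, h3, hs2.2, if_false]; norm_num
  have hr1 : r ∉ insert i S := by simp [nir.symm, hrS]
  have hu := hmem {i, r} (Finset.mem_insert_self i S) hr1 ht0 ht1 rfl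
  rw [Finset.erase_insert hiS] at hu
  have hw := hmem {r', j} hr' hj ht0' ht1' rfl
  have heq := hT.preimage_unique ha hp hq hu hw (by
    have h1 := hd fun _ => 1
    have h2 := hd' fun _ => 1
    have h3 := hd a
    have h4 := hd' a
    simp only [mul_one] at h1 h2
    rw [proj_add, proj_add]
    congr 1
    rw [Prod.ext_iff, proj_fst, proj_snd, proj_fst, proj_snd]
    change ∑ s, d s * a s = ∑ s, d' s * a s ∧ ∑ s, d s = ∑ s, d' s
    rw [h1, h2, h3, h4]
    constructor <;> linarith)
  have heq' : ∀ s, d s = d' s := fun s => by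
    have := congrFun heq s
    simpa only [Pi.add_apply, add_right_inj] using this
  have nrr : r ≠ r' := fun h => hr1 (h ▸ hr')
  have h1 : j = r := by
    by_contra hjr
    have := heq' r
    simp only [d, d', nir.symm, nrr, Ne.symm hjr, if_true, if_false] at this
    linarith
  subst h1
  refine ⟨rfl, ?_⟩
  by_contra h2
  have := heq' i
  simp only [d, d', nir, Ne.symm h2, if_true, if_false] at this
  linarith

/-- The sets `P i` of predecessors of the elements `i` of `I` in a linear order of `I`. -/
structure IsPrecedence {n : ℕ} (I : Finset (Fin n)) (P : Fin n → Finset (Fin n)) : Prop where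
  sub : ∀ i ∈ I, P i ⊆ I
  irr : ∀ i ∈ I, i ∉ P i
  tot : ∀ i ∈ I, ∀ j ∈ I, i ≠ j → i ∈ P j ∨ j ∈ P i
  trans : ∀ j ∈ I, ∀ i ∈ P j, P i ⊆ P j

/-- In a linear order of `I`, suppose that each `i` whose predecessors are not exactly the elements
above `i` is of type `Up` or `Down`. Unless the linear order is the decreasing one, some `i` of type
`Up` is immediately followed by some `j` of type `Down`. -/
theorem exists_up_down {n : ℕ} {a : Fin n → ℝ} (ha : Function.Injective a) {I : Finset (Fin n)}
    {P : Fin n → Finset (Fin n)} (hP : IsPrecedence I P) (Up Down : Fin n → Fin n → Prop)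
    (htri : ∀ i ∈ I, (∃ r ∈ I, a i < a r ∧ r ∉ P i ∧ Up i r) ∨
      (∃ r ∈ P i, a r < a i ∧ Down i r) ∨ P i = I.filter fun s => a i < a s)
    (hnot : ∃ i ∈ I, P i ≠ I.filter fun s => a i < a s) :
    ∃ i ∈ I, ∃ j ∈ I, P j = insert i (P i) ∧ (∃ r, a i < a r ∧ Up i r) ∧
      ∃ r ∈ P j, a r < a j ∧ Down j r := by
  classical
  obtain ⟨hsub, hirr, htot, htrans⟩ := hP
  have hcard : ∀ j ∈ I, ∀ i ∈ P j, (P i).card < (P j).card := fun j hj i hi =>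
    Finset.card_lt_card (Finset.ssubset_iff_of_subset (htrans j hj i hi) |>.2
      ⟨i, hi, hirr i (hsub j hj hi)⟩)
  -- Some element is of type `Up`: otherwise look at the first element of type `Down`.
  have hup : ∃ i ∈ I, ∃ r ∈ I, a i < a r ∧ r ∉ P i ∧ Up i r := by
    by_contra! hno
    obtain ⟨i0, hi0, hi0'⟩ := hnot
    obtain ⟨i, hi, hmin⟩ := Finset.exists_min_image
      (I.filter fun i => P i ≠ I.filter fun s => a i < a s) (fun i => (P i).card)
      ⟨i0, Finset.mem_filter.2 ⟨hi0, hi0'⟩⟩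
    obtain ⟨hiI, hiP⟩ := Finset.mem_filter.1 hi
    rcases htri i hiI with ⟨r, hr, h1, h2, h3⟩ | ⟨r, hr, h1, -⟩ | h
    · exact hno i hiI r hr h1 h2 h3
    · obtain ⟨j, hj, hjmax⟩ := Finset.exists_max_image (P i) (fun j => (P j).card) ⟨r, hr⟩
      have hjI := hsub i hiI hj
      have hjP : P j = I.filter fun s => a j < a s := by
        by_contra hne
        exact absurd (hmin j (Finset.mem_filter.2 ⟨hjI, hne⟩)) (hcard i hiI j hj).not_ge
      have hij : a i < a j := by
        refine lt_of_le_of_ne ?_ fun h => hirr i hiI (by rw [← ha h] at hj; exact hj)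
        by_contra! hji
        have : i ∈ P j := hjP ▸ Finset.mem_filter.2 ⟨hiI, hji⟩
        exact hirr i hiI (htrans i hiI j hj this)
      have hrj : r ≠ j := fun h => by rw [h] at h1; exact lt_asymm h1 hij
      rcases htot r (hsub i hiI hr) j hjI hrj with h2 | h2
      · rw [hjP, Finset.mem_filter] at h2
        linarith [h2.2]
      · exact absurd (hjmax r hr) (hcard r (hsub i hiI hr) j h2).not_ge
    · exact hiP h
  obtain ⟨i, hi, hmax⟩ := Finset.exists_max_image
    (I.filter fun i => ∃ r ∈ I, a i < a r ∧ r ∉ P i ∧ Up i r) (fun i => (P i).card) (by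
      obtain ⟨i, hi, h⟩ := hup
      exact ⟨i, Finset.mem_filter.2 ⟨hi, h⟩⟩)
  obtain ⟨hiI, r, hrI, hir, hrP, hur⟩ := Finset.mem_filter.1 hi
  have hri : r ≠ i := fun h => by simp [h] at hir
  have hir' : i ∈ P r := (htot i hiI r hrI hri.symm).resolve_right hrP
  obtain ⟨j, hj, hjmin⟩ := Finset.exists_min_image (I.filter fun j => i ∈ P j)
    (fun j => (P j).card) ⟨r, Finset.mem_filter.2 ⟨hrI, hir'⟩⟩
  obtain ⟨hjI, hij⟩ := Finset.mem_filter.1 hj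
  have hPj : P j = insert i (P i) := by
    refine Finset.Subset.antisymm (fun s hs => ?_)
      (Finset.insert_subset hij (htrans j hjI i hij))
    by_contra hs'
    rw [Finset.mem_insert, not_or] at hs'
    have hsI := hsub j hjI hs
    have his := (htot i hiI s hsI (Ne.symm hs'.1)).resolve_right hs'.2
    exact absurd (hjmin s (Finset.mem_filter.2 ⟨hsI, his⟩)) (hcard j hjI s hs).not_ge
  refine ⟨i, hiI, j, hjI, hPj, ⟨r, hir, hur⟩, ?_⟩
  rcases htri j hjI with h | h | h
  · exact absurd (hmax j (Finset.mem_filter.2 ⟨hjI, h⟩)) (hcard j hjI i hij).not_ge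
  · exact h
  · have h1 : a j < a i := by
      rw [h] at hij
      exact (Finset.mem_filter.1 hij).2
    have h2 : r ∈ P j := by
      rw [h]
      exact Finset.mem_filter.2 ⟨hrI, h1.trans hir⟩
    rw [hPj, Finset.mem_insert] at h2
    exact absurd h2 (by tauto)

/-! ### Sweeping a tiling -/

theorem edgeMid_mem_cubeFace_lower {n : ℕ} {A : Finset (Fin n)} {i j : Fin n} :
    edgeMid A i ∈ cubeFace (A, {i, j}) := by
  refine ⟨edgeMid_mem_unitCube A i, fun s hs => by simp [edgeMid, show s ∈ A from hs],
    fun s hs1 hs2 => ?_⟩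
  simp only [Finset.mem_insert, Finset.mem_singleton, not_or] at hs1 hs2
  simp [edgeMid, hs1, hs2.1]

theorem edgeMid_mem_cubeFace_upper {n : ℕ} {A : Finset (Fin n)} {i j : Fin n} :
    edgeMid (insert j A) i ∈ cubeFace (A, {i, j}) := by
  refine ⟨edgeMid_mem_unitCube _ i, fun s hs => by simp [edgeMid, show s ∈ A from hs],
    fun s hs1 hs2 => ?_⟩
  simp only [Finset.mem_insert, Finset.mem_singleton, not_or] at hs1 hs2
  simp [edgeMid, hs1, hs2.1, hs2.2]

theorem IsFineZonotopalTiling.isUniqueEdge {n : ℕ} {a : Fin n → ℝ}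
    (ha : Function.Injective a) {T : Finset (FaceLabel n)} (hT : IsFineZonotopalTiling a T)
    {p : FaceLabel n} (hp : p ∈ T) {S : Finset (Fin n)} {i : Fin n}
    (h : edgeMid S i ∈ cubeFace p) : IsUniqueEdge a T S i :=
  fun _ hq _ hw hwu => hT.preimage_unique ha hq hp hw h hwu

/-- The points of the left boundary have a unique preimage in the cube. -/
theorem isUniqueEdge_left_boundary {n : ℕ} {a : Fin n → ℝ} (ha : Function.Injective a)
    (T : Finset (FaceLabel n)) (i : Fin n) :
    IsUniqueEdge a T (Finset.univ.filter fun s => a s < a i) i := by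
  intro q _ w hw hwu
  set u := edgeMid (Finset.univ.filter fun s => a s < a i) i with hu
  have h1 : ∀ s, a s < a i → u s = 1 := fun s hs => by simp [hu, edgeMid, hs]
  have h2 : ∀ s, a i < a s → u s = 0 := fun s hs => by
    have : s ≠ i := fun h => by simp [h] at hs
    simp [hu, edgeMid, hs.le, this]
  refine eq_of_proj_eq ha hwu fun x y z hxy hyz hno => ?_
  have hw' := hw.1
  rcases hno with ⟨hx, hy, hz⟩ | ⟨hx, hy, hz⟩
  · have h3 : a i ≤ a x := by
      by_contra! h
      linarith [h1 x h, (hw' x).2]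
    linarith [h2 y (h3.trans_lt hxy), (hw' y).1]
  · have h3 : a i ≤ a y := by
      by_contra! h
      linarith [h1 y h, (hw' y).2]
    linarith [h2 z (h3.trans_lt hyz), (hw' z).1]

/-- A stage of a sweep of a tiling `T` from left to right: `P` describes a monotone path of edges
(the edge of direction `i` leads from `P i` to `P i ∪ {i}`), and `U` consists of the tiles swept so
far. The pairs that the path has inverted are those of the tiles in `U`, and all the vertices
passed have `y` without `x`, for `a x < a y`, only if `(x, y)` has been inverted; this makes their
orientations of the circuits agree. -/
structure IsSweep {n : ℕ} (a : Fin n → ℝ) (T : Finset (FaceLabel n))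
    (P : Fin n → Finset (Fin n)) (U : Finset (FaceLabel n)) : Prop where
  prec : IsPrecedence Finset.univ P
  edge : ∀ i, IsUniqueEdge a T (P i) i
  subset : U ⊆ T
  exists_tile : ∀ x y, a x < a y → y ∈ P x → ∃ A, (A, {x, y}) ∈ U
  inverted : ∀ p ∈ U, ∀ x y, a x < a y → y ∈ p.1 ∪ p.2 → x ∉ p.1 → y ∈ P x
  compat : ∀ p ∈ U, ∀ q ∈ U, ∀ x y z, a x < a y → a y < a z → y ∈ p.1 ∪ p.2 → x ∉ p.1 →
    z ∉ p.1 → x ∈ q.1 ∪ q.2 → z ∈ q.1 ∪ q.2 → y ∈ q.1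

theorem isSweep_initial {n : ℕ} {a : Fin n → ℝ} (ha : Function.Injective a)
    (T : Finset (FaceLabel n)) :
    IsSweep a T (fun i => Finset.univ.filter fun s => a s < a i) ∅ where
  prec := by
    refine ⟨fun i _ => Finset.subset_univ _, by simp, fun i _ j _ hij => ?_,
      fun j _ i hi s hs => ?_⟩
    · simpa using lt_or_gt_of_ne (ha.ne hij)
    · simp only [Finset.mem_filter, Finset.mem_univ, true_and] at hi hs ⊢
      exact hs.trans hi
  edge := isUniqueEdge_left_boundary ha T
  subset := Finset.empty_subset T
  exists_tile x y hxy hy := by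
    simp only [Finset.mem_filter, Finset.mem_univ, true_and] at hy
    exact absurd hxy hy.not_gt
  inverted := by simp
  compat := by simp

/-- A sweep advances over a tile of which the two left edges lie on the path. -/
theorem IsSweep.step {n : ℕ} {a : Fin n → ℝ} (ha : Function.Injective a)
    {T : Finset (FaceLabel n)} (hT : IsFineZonotopalTiling a T) {P : Fin n → Finset (Fin n)}
    {U : Finset (FaceLabel n)} (h : IsSweep a T P U) {i j : Fin n} (hij : a i < a j)
    (hP : P j = insert i (P i)) (hp : (P i, {i, j}) ∈ T) :
    ∃ P', IsSweep a T P' (insert (P i, {i, j}) U) ∧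
      (∀ x y, a x < a y → y ∈ P x → y ∈ P' x) ∧ j ∈ P' i ∧ j ∉ P i := by
  have hne : i ≠ j := fun h => by simp [h] at hij
  have hirr : ∀ s, s ∉ P s := fun s => h.prec.irr s (Finset.mem_univ s)
  have htot : ∀ s t, s ≠ t → s ∈ P t ∨ t ∈ P s := fun s t =>
    h.prec.tot s (Finset.mem_univ s) t (Finset.mem_univ t)
  have htrans : ∀ {s t}, s ∈ P t → P s ⊆ P t := fun {s t} =>
    h.prec.trans t (Finset.mem_univ t) s
  have hji : j ∉ P i := fun hj => hirr j (hP ▸ Finset.mem_insert_of_mem hj)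
  have hijP : i ∈ P j := hP ▸ Finset.mem_insert_self i _
  let P' : Fin n → Finset (Fin n) := fun s => if s = j then P i else if s = i then insert j (P i)
    else P s
  have hPj : P' j = P i := by simp [P']
  have hPi : P' i = insert j (P i) := by simp [P', hne]
  have hPs : ∀ s, s ≠ i → s ≠ j → P' s = P s := fun s h1 h2 => by simp [P', h1, h2]
  -- Outside the pair, `i` and `j` have the same successors.
  have hsucc : ∀ s, s ≠ i → s ≠ j → i ∈ P s → j ∈ P s := by
    intro s h1 h2 h3
    refine (htot j s (Ne.symm h2)).resolve_right fun h4 => ?_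
    rw [hP, Finset.mem_insert] at h4
    exact hirr i (htrans (h4.resolve_left h1) h3)
  have hpers : ∀ x y, a x < a y → y ∈ P x → y ∈ P' x := by
    intro x y hxy hy
    by_cases hx : x = j
    · subst hx
      rw [hP, Finset.mem_insert] at hy
      rw [hPj]
      exact hy.resolve_left fun h => by rw [h] at hxy; exact lt_asymm hxy hij
    · by_cases hx' : x = i
      · subst hx'; rw [hPi]; exact Finset.mem_insert_of_mem hy
      · rwa [hPs x hx' hx]
  -- Vertices of the new tile are unions of initial segments of the path.
  have hdown : ∀ x y, a x < a y → x ∈ P i ∪ {i, j} → y ∈ P x → y ∈ P i := by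
    intro x y hxy hx hy
    simp only [Finset.mem_union, Finset.mem_insert, Finset.mem_singleton] at hx
    rcases hx with hx | rfl | rfl
    · exact htrans hx hy
    · exact hy
    · rw [hP, Finset.mem_insert] at hy
      exact hy.resolve_left fun h => by rw [h] at hxy; exact lt_asymm hxy hij
  refine ⟨P', ⟨⟨fun _ _ => Finset.subset_univ _, fun s _ => ?_, fun s _ t _ hst => ?_,
    fun s _ t ht => ?_⟩, fun s => ?_, Finset.insert_subset hp h.subset, fun x y hxy hy => ?_,
    fun p hp' x y hxy hy hx => ?_, fun p hp' q hq' x y z hxy hyz hyp hxp hzp hxq hzq => ?_⟩,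
    hpers, by simp [hPi], hji⟩
  · by_cases h1 : s = j
    · rw [h1, hPj]; exact hji
    · by_cases h2 : s = i
      · rw [h2, hPi, Finset.mem_insert, not_or]; exact ⟨hne, hirr i⟩
      · rw [hPs s h2 h1]; exact hirr s
  · have key : ∀ t, t ≠ j → (j ∈ P' t ∨ t ∈ P' j) ∧ (t ≠ i → i ∈ P' t ∨ t ∈ P' i) := by
      intro t htj
      by_cases hti : t = i
      · subst hti
        exact ⟨.inl (by simp [hPi]), fun h => absurd rfl h⟩
      · rw [hPj, hPs t hti htj, hPi]
        rcases htot i t (Ne.symm hti) with h1 | h1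
        · exact ⟨.inl (hsucc t hti htj h1), fun _ => .inl h1⟩
        · exact ⟨.inr h1, fun _ => .inr (Finset.mem_insert_of_mem h1)⟩
    by_cases hsj : s = j
    · subst hsj; exact (key t hst.symm).1
    by_cases htj : t = j
    · subst htj; exact (key s hst).1.symm
    by_cases hsi : s = i
    · subst hsi; exact (key t htj).2 hst.symm
    by_cases hti : t = i
    · subst hti; exact ((key s hsj).2 hst).symm
    rw [hPs s hsi hsj, hPs t hti htj]
    exact htot s t hst
  · have key : ∀ t, t ∈ P i → P' t ⊆ P i := by
      intro t ht
      rw [hPs t (fun h => hirr i (h ▸ ht)) (fun h => hji (h ▸ ht))]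
      exact htrans ht
    by_cases hsj : s = j
    · subst hsj; rw [hPj] at ht ⊢; exact key t ht
    by_cases hsi : s = i
    · subst hsi
      rw [hPi, Finset.mem_insert] at ht
      rw [hPi]
      rcases ht with rfl | ht
      · rw [hPj]; exact Finset.subset_insert _ _
      · exact (key t ht).trans (Finset.subset_insert _ _)
    rw [hPs s hsi hsj] at ht ⊢
    by_cases htj : t = j
    · subst htj; rw [hPj]; exact htrans (htrans ht hijP)
    by_cases hti : t = i
    · subst hti; rw [hPi]; exact Finset.insert_subset (hsucc s hsi hsj ht) (htrans ht)
    rw [hPs t hti htj]; exact htrans ht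
  · by_cases h1 : s = j
    · rw [h1, hPj]
      exact hT.isUniqueEdge ha hp (Finset.pair_comm j i ▸ edgeMid_mem_cubeFace_lower)
    · by_cases h2 : s = i
      · rw [h2, hPi]
        exact hT.isUniqueEdge ha hp edgeMid_mem_cubeFace_upper
      · rw [hPs s h2 h1]; exact h.edge s
  · have key : y ∈ P x ∨ (x = i ∧ y = j) := by
      by_cases h1 : x = j
      · subst h1; rw [hPj] at hy; exact .inl (htrans hijP hy)
      · by_cases h2 : x = i
        · subst h2
          rw [hPi, Finset.mem_insert] at hy
          exact hy.symm.imp id fun h => ⟨rfl, h⟩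
        · rw [hPs x h2 h1] at hy; exact .inl hy
    rcases key with key | ⟨rfl, rfl⟩
    · obtain ⟨A, hA⟩ := h.exists_tile x y hxy key
      exact ⟨A, Finset.mem_insert_of_mem hA⟩
    · exact ⟨_, Finset.mem_insert_self _ _⟩
  · rcases Finset.mem_insert.1 hp' with rfl | hp'
    · simp only at hy hx
      have hy' := hy
      simp only [Finset.mem_union, Finset.mem_insert, Finset.mem_singleton] at hy'
      by_cases h1 : x = j
      · subst h1
        rw [hPj]
        rcases hy' with h1 | rfl | rfl
        · exact h1
        · exact absurd hxy hij.not_gt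
        · exact absurd hxy (lt_irrefl _)
      by_cases h2 : x = i
      · subst h2
        rw [hPi, Finset.mem_insert]
        rcases hy' with h1 | rfl | rfl
        · exact .inr h1
        · exact absurd hxy (lt_irrefl _)
        · exact .inl rfl
      have h3 : x ∉ P j := by rw [hP, Finset.mem_insert]; tauto
      have h4 := (htot j x (Ne.symm h1)).resolve_right h3
      rw [hPs x h2 h1]
      rcases hy' with h5 | rfl | rfl
      · exact htrans h4 (htrans hijP h5)
      · exact htrans h4 hijP
      · exact h4
    · exact hpers x y hxy (h.inverted p hp' x y hxy hy hx)
  · rcases Finset.mem_insert.1 hp' with rfl | hp' <;> rcases Finset.mem_insert.1 hq' with rfl | hq'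
    · simp only [Finset.mem_union, Finset.mem_insert, Finset.mem_singleton] at hyp hxp hzp hxq hzq ⊢
      rcases hyp with h1 | rfl | rfl
      · exact h1
      · rcases hxq.resolve_left hxp with rfl | rfl
        · exact absurd hxy (lt_irrefl _)
        · exact absurd hxy hij.not_gt
      · rcases hzq.resolve_left hzp with rfl | rfl
        · exact absurd hyz hij.not_gt
        · exact absurd hyz (lt_irrefl _)
    · by_contra hyq
      exact hzp (hdown y z hyz hyp (h.inverted q hq' y z hyz hzq hyq))
    · exact hdown x y hxy hxq (h.inverted p hp' x y hxy hyp hxp)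
    · exact h.compat p hp' q hq' x y z hxy hyz hyp hxp hzp hxq hzq

/-- A sweep advances until all pairs are inverted, by induction on the number `m` of pairs that are
not yet inverted. -/
theorem IsSweep.exists_complete {n : ℕ} {a : Fin n → ℝ} (ha : Function.Injective a)
    {T : Finset (FaceLabel n)} (hT : IsFineZonotopalTiling a T) (m : ℕ) :
    ∀ {P : Fin n → Finset (Fin n)} {U : Finset (FaceLabel n)}, IsSweep a T P U →
      (Finset.univ.filter fun x : Fin n × Fin n => a x.1 < a x.2 ∧ x.2 ∉ P x.1).card = m →
      ∃ P' U', IsSweep a T P' U' ∧ ∀ x y, a x < a y → y ∈ P' x := by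
  induction m using Nat.strong_induction_on with
  | _ m ih =>
    intro P U h hm
    by_cases hlast : ∀ i, P i = Finset.univ.filter fun s => a i < a s
    · refine ⟨P, U, h, fun x y hxy => ?_⟩
      rw [hlast x]
      simpa using hxy
    push Not at hlast
    obtain ⟨i, -, j, -, hPj, ⟨r, hir, hup⟩, r', hr', hrj, hdown⟩ :=
      exists_up_down ha h.prec (fun i r => (P i, {i, r}) ∈ T)
        (fun j r => ((P j).erase r, {r, j}) ∈ T)
        (fun i _ => by
          by_cases hi : P i = Finset.univ.filter fun s => a i < a s
          · exact .inr (.inr hi)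
          · rcases hT.exists_right_tile ha (h.prec.irr i (Finset.mem_univ i)) (h.edge i) hi with
              ⟨r, h1, h2, h3⟩ | h1
            · exact .inl ⟨r, Finset.mem_univ r, h1, h2, h3⟩
            · exact .inr (.inl h1))
        (by obtain ⟨i, hi⟩ := hlast; exact ⟨i, Finset.mem_univ i, hi⟩)
    rw [hPj] at hr' hdown
    obtain ⟨rfl, rfl⟩ := hT.right_tiles_eq ha hir hup hr' hrj hdown
    obtain ⟨P', hs, h1, h2, h3⟩ := h.step ha hT hir hPj hup
    refine ih _ ?_ hs rfl
    rw [← hm]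
    refine Finset.card_lt_card (Finset.ssubset_iff_of_subset (fun x hx => ?_) |>.2
      ⟨(r', j), by simp [hir, h3], by simp [h2]⟩)
    simp only [Finset.mem_filter, Finset.mem_univ, true_and] at hx ⊢
    exact ⟨hx.1, fun hx' => hx.2 (h1 _ _ hx.1 hx')⟩

/-- Every fine zonotopal tiling is combinatorial: it is obtained by a sweep, and the tiles passed by
a sweep do not orient any circuit in both ways. -/
theorem IsFineZonotopalTiling.exists_isArrangement {n : ℕ} (hn : 2 ≤ n) {a : Fin n → ℝ}
    (ha : Function.Injective a) {T : Finset (FaceLabel n)} (hT : IsFineZonotopalTiling a T) :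
    ∃ f, IsArrangement a f ∧ T = labelTiling f := by
  obtain ⟨P, U, h, hP⟩ := IsSweep.exists_complete ha hT _ (isSweep_initial ha T) rfl
  have key : ∀ B : Finset (Fin n), ∃ A, B.card = 2 → (A, B) ∈ U := by
    intro B
    by_cases hB : B.card = 2
    · obtain ⟨x, y, hxy, rfl⟩ := exists_pair_eq ha hB
      obtain ⟨A, hA⟩ := h.exists_tile x y hxy (hP x y hxy)
      exact ⟨A, fun _ => hA⟩
    · exact ⟨∅, fun h => absurd h hB⟩
  choose f hf using key
  refine ⟨f, ⟨fun B hB => hT.disjoint _ (h.subset (hf B hB)), fun B B' hB hB' =>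
    h.compat _ (hf B hB) _ (hf B' hB')⟩, hT.eq_labelTiling hn ha fun p hp => ?_⟩
  obtain ⟨h1, h2⟩ := mem_labelTiling.1 hp
  have := h.subset (hf p.2 h1)
  rwa [h2] at this

/-! ### Circuits and signs of triples -/

theorem IsCircuit.swap {n : ℕ} {a : Fin n → ℝ} {C : Finset (Fin n) × Finset (Fin n)}
    (h : IsCircuit a C) : IsCircuit a C.swap where
  disjoint := h.disjoint.symm
  nonempty := by simpa [Finset.union_comm] using h.nonempty
  indep := by
    have := h.indep
    rw [Finset.union_comm] at this
    exact this
  dep := by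
    obtain ⟨α, h1, h2, h3, h4⟩ := h.dep
    refine ⟨-α, fun i hi => by simpa using h2 i hi, fun i hi => by simpa using h1 i hi,
      fun i hi => ?_, by simpa using h4⟩
    rw [Prod.fst_swap, Prod.snd_swap, Finset.union_comm] at hi
    simp [h3 i hi]

theorem isCircuit_of_lt_lt {n : ℕ} {a : Fin n → ℝ} (ha : Function.Injective a) {x y z : Fin n}
    (hxy : a x < a y) (hyz : a y < a z) : IsCircuit a ({y}, {x, z}) := by
  have nxy : x ≠ y := fun h => by simp [h] at hxy
  have nyz : y ≠ z := fun h => by simp [h] at hyz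
  have nxz : x ≠ z := fun h => by rw [h] at hxy; exact lt_asymm hxy hyz
  refine ⟨by simp [nxy.symm, nyz], ⟨y, by simp⟩, fun i hi => ?_, ?_⟩
  · refine linearIndependent_liftVec_pair ha ?_
    rw [Finset.card_erase_of_mem hi]
    have := Finset.card_union_le {y} ({x, z} : Finset (Fin n))
    have := Finset.card_le_two (a := x) (b := z)
    simp only [Finset.card_singleton] at *
    omega
  · let d : Fin n → ℝ := fun s => (if s = x then -(a z - a y) else 0) +
      (if s = y then a z - a x else 0) + (if s = z then -(a y - a x) else 0)
    have hd : ∀ g : Fin n → ℝ, ∑ s, d s * g s =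
        -(a z - a y) * g x + (a z - a x) * g y + -(a y - a x) * g z := sum_ite_mul_three x y z _ _ _
    refine ⟨d, fun i hi => ?_, fun i hi => ?_, fun i hi => ?_, ?_⟩
    · obtain rfl := Finset.mem_singleton.1 hi
      simp only [d, nxy.symm, nyz, if_true, if_false]
      linarith
    · simp only [Finset.mem_insert, Finset.mem_singleton] at hi
      rcases hi with rfl | rfl
      · simp only [d, nxy, nxz, if_true, if_false]; linarith
      · simp only [d, nxz.symm, nyz.symm, if_true, if_false]; linarith
    · simp only [Finset.mem_union, Finset.mem_insert, Finset.mem_singleton, not_or] at hi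
      simp [d, hi.1, hi.2.1, hi.2.2]
    · change proj a d = 0
      have h0 := hd fun _ => 1
      simp only [mul_one] at h0
      rw [Prod.ext_iff, proj_fst, proj_snd, hd, h0]
      simp only [Prod.fst_zero, Prod.snd_zero]
      constructor <;> ring

/-- The circuits of the lifted points on a line are the alternating triples. -/
theorem isCircuit_iff {n : ℕ} {a : Fin n → ℝ} (ha : Function.Injective a)
    {C : Finset (Fin n) × Finset (Fin n)} :
    IsCircuit a C ↔ ∃ x y z, a x < a y ∧ a y < a z ∧ (C = ({y}, {x, z}) ∨ C = ({x, z}, {y})) := by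
  constructor
  swap
  · rintro ⟨x, y, z, hxy, hyz, rfl | rfl⟩
    · exact isCircuit_of_lt_lt ha hxy hyz
    · exact (isCircuit_of_lt_lt ha hxy hyz).swap
  intro h
  have key : ∀ {C : Finset (Fin n) × Finset (Fin n)}, IsCircuit a C → ∀ {α : Fin n → ℝ},
      (∀ i ∈ C.1, 0 < α i) → (∀ i ∈ C.2, α i < 0) → (∀ i, i ∉ C.1 ∪ C.2 → α i = 0) →
      ∀ {x y z}, a x < a y → a y < a z → α x < 0 → 0 < α y → α z < 0 → C = ({y}, {x, z}) := by
    intro C h α h1 h2 h3 x y z hxy hyz hx hy hz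
    have hm : ∀ s, α s ≠ 0 → s ∈ C.1 ∪ C.2 := fun s hs => by
      by_contra hs'
      exact hs (h3 s hs')
    have hpos : ∀ s, 0 < α s → s ∈ C.1 := fun s hs =>
      (Finset.mem_union.1 (hm s hs.ne')).resolve_right fun h => lt_asymm hs (h2 s h)
    have hneg : ∀ s, α s < 0 → s ∈ C.2 := fun s hs =>
      (Finset.mem_union.1 (hm s hs.ne)).resolve_left fun h => lt_asymm hs (h1 s h)
    have hall : ∀ s ∈ C.1 ∪ C.2, s = x ∨ s = y ∨ s = z := by
      intro s hs
      by_contra! hne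
      -- Three vectors of the plane cannot be linearly independent.
      have hc := (h.indep s hs).fintype_card_le_finrank
      rw [Fintype.card_coe, Module.finrank_prod, Module.finrank_self] at hc
      refine absurd (two_lt_card_of_lt_lt hxy hyz (B := (C.1 ∪ C.2).erase s) ?_ ?_ ?_) (by omega)
      · exact Finset.mem_erase.2 ⟨hne.1.symm, hm x hx.ne⟩
      · exact Finset.mem_erase.2 ⟨hne.2.1.symm, hm y hy.ne'⟩
      · exact Finset.mem_erase.2 ⟨hne.2.2.symm, hm z hz.ne⟩
    refine Prod.ext (Finset.ext fun s => ?_) (Finset.ext fun s => ?_)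
    · rw [Finset.mem_singleton]
      constructor
      · intro hs
        rcases hall s (Finset.mem_union_left _ hs) with rfl | rfl | rfl
        · exact absurd (h1 _ hs) hx.not_gt
        · rfl
        · exact absurd (h1 _ hs) hz.not_gt
      · rintro rfl; exact hpos _ hy
    · simp only [Finset.mem_insert, Finset.mem_singleton]
      constructor
      · intro hs
        rcases hall s (Finset.mem_union_right _ hs) with rfl | rfl | rfl
        · exact .inl rfl
        · exact absurd (h2 _ hs) hy.not_gt
        · exact .inr rfl
      · rintro (rfl | rfl)
        exacts [hneg _ hx, hneg _ hz]
  obtain ⟨α, h1, h2, h3, h4⟩ := h.dep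
  have h4' : proj a α = 0 := h4
  rw [Prod.ext_iff, proj_fst, proj_snd] at h4'
  obtain ⟨i, hi⟩ := h.nonempty
  obtain ⟨x, y, z, hxy, hyz, hα⟩ := exists_alternating ha h4'.2 h4'.1 fun h0 => by
    rcases Finset.mem_union.1 hi with hi | hi
    · exact (h1 i hi).ne' (congrFun h0 i)
    · exact (h2 i hi).ne (congrFun h0 i)
  refine ⟨x, y, z, hxy, hyz, ?_⟩
  rcases hα with ⟨hx, hy, hz⟩ | ⟨hx, hy, hz⟩
  · right
    have := key h.swap (α := -α) (fun i hi => by simpa using h2 i hi)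
      (fun i hi => by simpa using h1 i hi)
      (fun i hi => by
        rw [Prod.fst_swap, Prod.snd_swap, Finset.union_comm] at hi
        simp [h3 i hi]) hxy hyz (by simpa using hx) (by simpa using hy) (by simpa using hz)
    rw [← Prod.swap_swap C, this]
    rfl
  · exact .inl (key h h1 h2 h3 hxy hyz hx hy hz)

section Sign

variable {n : ℕ} {a : Fin n → ℝ} {f f' : Finset (Fin n) → Finset (Fin n)}

theorem card_pair_of_lt {x y : Fin n} (hxy : a x < a y) : ({x, y} : Finset (Fin n)).card = 2 :=
  Finset.card_pair fun h => by simp [h] at hxy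

theorem IsArrangement.notMem_left (hf : IsArrangement a f) {x y : Fin n} (hxy : a x < a y) :
    x ∉ f {x, y} :=
  Finset.disjoint_right.1 (hf.disj _ (card_pair_of_lt hxy)) (by simp)

theorem IsArrangement.notMem_right (hf : IsArrangement a f) {x y : Fin n} (hxy : a x < a y) :
    y ∉ f {x, y} :=
  Finset.disjoint_right.1 (hf.disj _ (card_pair_of_lt hxy)) (by simp)

theorem isTilingVertex_labelTiling {S : Finset (Fin n)} :
    IsTilingVertex (labelTiling f) S ↔ ∃ B, B.card = 2 ∧ f B ⊆ S ∧ S ⊆ f B ∪ B := by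
  constructor
  · rintro ⟨⟨A, B⟩, hp, h1, h2⟩
    obtain ⟨h3, h4⟩ := mem_labelTiling.1 hp
    change f B = A at h4
    subst h4
    exact ⟨B, h3, h1, h2⟩
  · rintro ⟨B, h1, h2, h3⟩
    exact ⟨(f B, B), mk_mem_labelTiling f h1, h2, h3⟩

theorem IsArrangement.vertex_compat (hf : IsArrangement a f) {S S' : Finset (Fin n)}
    (hS : IsTilingVertex (labelTiling f) S) (hS' : IsTilingVertex (labelTiling f) S')
    {x y z : Fin n} (hxy : a x < a y) (hyz : a y < a z) (h1 : y ∈ S) (h2 : x ∉ S) (h3 : z ∉ S)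
    (h4 : x ∈ S') (h5 : z ∈ S') : y ∈ S' := by
  obtain ⟨B, hB, hB1, hB2⟩ := isTilingVertex_labelTiling.1 hS
  obtain ⟨B', hB', hB1', hB2'⟩ := isTilingVertex_labelTiling.1 hS'
  exact hB1' (hf.compat B B' hB hB' x y z hxy hyz (hB2 h1) (fun h => h2 (hB1 h))
    (fun h => h3 (hB1 h)) (hB2' h4) (hB2' h5))

theorem isArrangement_of_vertex_compat (hdisj : ∀ B, B.card = 2 → Disjoint (f B) B)
    (h : ∀ S S', IsTilingVertex (labelTiling f) S → IsTilingVertex (labelTiling f) S' →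
      ∀ x y z, a x < a y → a y < a z → y ∈ S → x ∉ S → z ∉ S → x ∈ S' → z ∈ S' → y ∈ S') :
    IsArrangement a f where
  disj := hdisj
  compat B B' hB hB' x y z hxy hyz h1 h2 h3 h4 h5 := by
    have nxy : x ≠ y := fun h => by simp [h] at hxy
    have nyz : y ≠ z := fun h => by simp [h] at hyz
    have := h (f B ∪ B ∩ {y}) (f B' ∪ B' ∩ {x, z})
      (isTilingVertex_labelTiling.2 ⟨B, hB, Finset.subset_union_left,
        Finset.union_subset_union_right Finset.inter_subset_left⟩)
      (isTilingVertex_labelTiling.2 ⟨B', hB', Finset.subset_union_left,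
        Finset.union_subset_union_right Finset.inter_subset_left⟩) x y z hxy hyz
    simpa [nxy, nyz.symm, nyz, nxy.symm, h2, h3, Finset.mem_union.1 h1, Finset.mem_union.1 h4,
      Finset.mem_union.1 h5] using this

theorem isTilingVertex_label {B : Finset (Fin n)} (hB : B.card = 2) :
    IsTilingVertex (labelTiling f) (f B) :=
  isTilingVertex_labelTiling.2 ⟨B, hB, Finset.Subset.refl _, Finset.subset_union_left⟩

theorem isTilingVertex_label_union {B : Finset (Fin n)} (hB : B.card = 2) :
    IsTilingVertex (labelTiling f) (f B ∪ B) :=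
  isTilingVertex_labelTiling.2 ⟨B, hB, Finset.subset_union_left, Finset.Subset.refl _⟩

/-- The sign of the triple `x, y, z` in the arrangement is positive if `y ∈ f {x, z}`; this is read
off from any vertex that contains `y` but not `x` and `z`. -/
theorem IsArrangement.pos_of_vertex (hf : IsArrangement a f) {S : Finset (Fin n)}
    (hS : IsTilingVertex (labelTiling f) S) {x y z : Fin n} (hxy : a x < a y) (hyz : a y < a z)
    (h1 : y ∈ S) (h2 : x ∉ S) (h3 : z ∉ S) : y ∈ f {x, z} := by
  have nxy : x ≠ y := fun h => by simp [h] at hxy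
  have nyz : y ≠ z := fun h => by simp [h] at hyz
  have := hf.vertex_compat hS (isTilingVertex_label_union (card_pair_of_lt (hxy.trans hyz)))
    hxy hyz h1 h2 h3 (by simp) (by simp)
  simpa [nxy.symm, nyz] using this

theorem IsArrangement.neg_of_vertex (hf : IsArrangement a f) {S : Finset (Fin n)}
    (hS : IsTilingVertex (labelTiling f) S) {x y z : Fin n} (hxy : a x < a y) (hyz : a y < a z)
    (h1 : x ∈ S) (h2 : z ∈ S) (h3 : y ∉ S) : y ∉ f {x, z} := fun h =>
  h3 (hf.vertex_compat (isTilingVertex_label (card_pair_of_lt (hxy.trans hyz))) hS hxy hyz h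
    (hf.notMem_left (hxy.trans hyz)) (hf.notMem_right (hxy.trans hyz)) h1 h2)

theorem IsArrangement.mem_right_iff (hf : IsArrangement a f) {x y z : Fin n} (hxy : a x < a y)
    (hyz : a y < a z) : z ∈ f {x, y} ↔ y ∉ f {x, z} := by
  have nyz : y ≠ z := fun h => by simp [h] at hyz
  have nxz : x ≠ z := fun h => by rw [h] at hxy; exact lt_asymm hxy hyz
  have hB := card_pair_of_lt hxy
  constructor
  · intro h
    refine hf.neg_of_vertex (S := insert x (f {x, y})) (isTilingVertex_labelTiling.2 ⟨_, hB,
      Finset.subset_insert _ _, ?_⟩) hxy hyz (by simp) (by simp [h]) ?_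
    · exact Finset.insert_subset (by simp) Finset.subset_union_left
    · simp only [Finset.mem_insert, not_or]
      exact ⟨fun h => by simp [h] at hxy, hf.notMem_right hxy⟩
  · intro h
    by_contra hz
    refine h (hf.pos_of_vertex (S := insert y (f {x, y})) (isTilingVertex_labelTiling.2 ⟨_, hB,
      Finset.subset_insert _ _, ?_⟩) hxy hyz (by simp) ?_ (by simp [hz, nyz.symm]))
    · exact Finset.insert_subset (by simp) Finset.subset_union_left
    · simp only [Finset.mem_insert, not_or]
      exact ⟨fun h => by simp [h] at hxy, hf.notMem_left hxy⟩

theorem IsArrangement.mem_left_iff (hf : IsArrangement a f) {x y z : Fin n} (hxy : a x < a y)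
    (hyz : a y < a z) : x ∈ f {y, z} ↔ y ∉ f {x, z} := by
  have nxy : x ≠ y := fun h => by simp [h] at hxy
  have hB := card_pair_of_lt hyz
  constructor
  · intro h
    refine hf.neg_of_vertex (S := insert z (f {y, z})) (isTilingVertex_labelTiling.2 ⟨_, hB,
      Finset.subset_insert _ _, ?_⟩) hxy hyz (by simp [h]) (by simp) ?_
    · exact Finset.insert_subset (by simp) Finset.subset_union_left
    · simp only [Finset.mem_insert, not_or]
      exact ⟨fun h => by simp [h] at hyz, hf.notMem_left hyz⟩
  · intro h
    by_contra hx
    refine h (hf.pos_of_vertex (S := insert y (f {y, z})) (isTilingVertex_labelTiling.2 ⟨_, hB,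
      Finset.subset_insert _ _, ?_⟩) hxy hyz (by simp) (by simp [hx, nxy]) ?_)
    · exact Finset.insert_subset (by simp) Finset.subset_union_left
    · simp only [Finset.mem_insert, not_or]
      exact ⟨fun h => by simp [h] at hyz, hf.notMem_right hyz⟩

theorem IsArrangement.orientsPos_iff (hf : IsArrangement a f) {x y z : Fin n} (hxy : a x < a y)
    (hyz : a y < a z) : OrientsPos (labelTiling f) ({y}, {x, z}) ↔ y ∈ f {x, z} := by
  simp only [OrientsPos, Finset.singleton_subset_iff, Finset.disjoint_insert_left,
    Finset.disjoint_singleton_left, Finset.insert_subset_iff]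
  constructor
  · rintro ⟨⟨S, hS, h1, h2, h3⟩, -⟩
    exact hf.pos_of_vertex hS hxy hyz h1 h2 h3
  · intro h
    refine ⟨⟨_, isTilingVertex_label (card_pair_of_lt (hxy.trans hyz)), h,
      hf.notMem_left (hxy.trans hyz), hf.notMem_right (hxy.trans hyz)⟩, ?_⟩
    rintro ⟨S, hS, ⟨h1, h2⟩, h3⟩
    exact hf.neg_of_vertex hS hxy hyz h1 h2 h3 h

theorem IsArrangement.orientsNeg_iff (hf : IsArrangement a f) {x y z : Fin n} (hxy : a x < a y)
    (hyz : a y < a z) : OrientsNeg (labelTiling f) ({y}, {x, z}) ↔ y ∉ f {x, z} := by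
  simp only [OrientsNeg, Finset.singleton_subset_iff, Finset.disjoint_insert_left,
    Finset.disjoint_singleton_left, Finset.insert_subset_iff]
  constructor
  · rintro ⟨⟨S, hS, ⟨h1, h2⟩, h3⟩, -⟩
    exact hf.neg_of_vertex hS hxy hyz h1 h2 h3
  · intro h
    have nxy : x ≠ y := fun h => by simp [h] at hxy
    have nyz : y ≠ z := fun h => by simp [h] at hyz
    refine ⟨⟨_, isTilingVertex_label_union (card_pair_of_lt (hxy.trans hyz)), by simp,
      by simp [h, nxy.symm, nyz]⟩, ?_⟩
    rintro ⟨S, hS, h1, h2, h3⟩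
    exact h (hf.pos_of_vertex hS hxy hyz h1 h2 h3)

theorem orientsPos_swap {T : Finset (FaceLabel n)} {C : Finset (Fin n) × Finset (Fin n)} :
    OrientsPos T C.swap ↔ OrientsNeg T C := Iff.rfl

theorem orientsNeg_swap {T : Finset (FaceLabel n)} {C : Finset (Fin n) × Finset (Fin n)} :
    OrientsNeg T C.swap ↔ OrientsPos T C := Iff.rfl

/-- The arrangements `f` and `f'` have opposite signs, negative and positive, at the triple
`x, y, z`, and the same sign at all other triples. -/
structure IsFlipAt (a : Fin n → ℝ) (f f' : Finset (Fin n) → Finset (Fin n)) (x y z : Fin n) :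
    Prop where
  lt_left : a x < a y
  lt_right : a y < a z
  neg : y ∉ f {x, z}
  pos : y ∈ f' {x, z}
  iff : ∀ u v w, a u < a v → a v < a w → ¬ (u = x ∧ v = y ∧ w = z) →
    (v ∈ f {u, w} ↔ v ∈ f' {u, w})

theorem pair_eq_pair_of_lt {x z u w : Fin n} (hxz : a x < a z) (huw : a u < a w)
    (h : ({u, w} : Finset (Fin n)) = {x, z}) : u = x ∧ w = z := by
  have h1 : u ∈ ({x, z} : Finset (Fin n)) := h ▸ by simp
  have h2 : w ∈ ({x, z} : Finset (Fin n)) := h ▸ by simp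
  simp only [Finset.mem_insert, Finset.mem_singleton] at h1 h2
  rcases h1 with rfl | rfl <;> rcases h2 with rfl | rfl
  · exact absurd huw (lt_irrefl _)
  · exact ⟨rfl, rfl⟩
  · exact absurd huw hxz.not_gt
  · exact absurd huw (lt_irrefl _)

theorem IsFlipAt.isFlip (ha : Function.Injective a) (hf : IsArrangement a f)
    (hf' : IsArrangement a f') {x y z : Fin n} (h : IsFlipAt a f f' x y z) :
    IsFlip a (labelTiling f) (labelTiling f') := by
  refine ⟨({y}, {x, z}), isCircuit_of_lt_lt ha h.lt_left h.lt_right,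
    .inr ⟨(hf.orientsNeg_iff h.lt_left h.lt_right).2 h.neg,
      (hf'.orientsPos_iff h.lt_left h.lt_right).2 h.pos⟩, fun C hC h1 h2 => ?_⟩
  obtain ⟨u, v, w, huv, hvw, hC'⟩ := (isCircuit_iff ha).1 hC
  have key : (v ∈ f {u, w} ↔ v ∈ f' {u, w}) := by
    refine h.iff u v w huv hvw ?_
    rintro ⟨rfl, rfl, rfl⟩
    rcases hC' with rfl | rfl
    exacts [h1 rfl, h2 rfl]
  rcases hC' with rfl | rfl
  · rw [hf.orientsPos_iff huv hvw, hf'.orientsPos_iff huv hvw, hf.orientsNeg_iff huv hvw,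
      hf'.orientsNeg_iff huv hvw, key]
    exact ⟨Iff.rfl, Iff.rfl⟩
  · have : (({u, w}, {v}) : Finset (Fin n) × Finset (Fin n)) = Prod.swap ({v}, {u, w}) := rfl
    rw [this, orientsPos_swap, orientsPos_swap, orientsNeg_swap, orientsNeg_swap,
      hf.orientsPos_iff huv hvw, hf'.orientsPos_iff huv hvw, hf.orientsNeg_iff huv hvw,
      hf'.orientsNeg_iff huv hvw, key]
    exact ⟨Iff.rfl, Iff.rfl⟩

theorem IsFlip.exists_isFlipAt (ha : Function.Injective a) (hf : IsArrangement a f)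
    (hf' : IsArrangement a f') (h : IsFlip a (labelTiling f) (labelTiling f')) :
    ∃ x y z, IsFlipAt a f f' x y z ∨ IsFlipAt a f' f x y z := by
  obtain ⟨C, hC, h1, h2⟩ := h
  obtain ⟨x, y, z, hxy, hyz, hC'⟩ := (isCircuit_iff ha).1 hC
  have key : ∀ u v w, a u < a v → a v < a w → ¬ (u = x ∧ v = y ∧ w = z) →
      (v ∈ f {u, w} ↔ v ∈ f' {u, w}) := by
    intro u v w huv hvw hne
    have n1 : (({v}, {u, w}) : Finset (Fin n) × Finset (Fin n)) ≠ ({y}, {x, z}) := fun h => by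
      obtain ⟨h3, h4⟩ := Prod.mk.inj h
      obtain ⟨h5, h6⟩ := pair_eq_pair_of_lt (hxy.trans hyz) (huv.trans hvw) h4
      exact hne ⟨h5, Finset.singleton_injective h3, h6⟩
    have n2 : (({v}, {u, w}) : Finset (Fin n) × Finset (Fin n)) ≠ ({x, z}, {y}) := fun h => by
      have := congrArg Finset.card (Prod.mk.inj h).1
      rw [card_pair_of_lt (hxy.trans hyz), Finset.card_singleton] at this
      omega
    have h3 : ({v}, {u, w}) ≠ C ∧ ({v}, {u, w}) ≠ C.swap := by
      rcases hC' with rfl | rfl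
      exacts [⟨n1, n2⟩, ⟨n2, n1⟩]
    have := (h2 _ (isCircuit_of_lt_lt ha huv hvw) h3.1 h3.2).1
    rwa [hf.orientsPos_iff huv hvw, hf'.orientsPos_iff huv hvw] at this
  have h3 : (OrientsPos (labelTiling f) ({y}, {x, z}) ∧ OrientsNeg (labelTiling f') ({y}, {x, z})) ∨
      (OrientsNeg (labelTiling f) ({y}, {x, z}) ∧ OrientsPos (labelTiling f') ({y}, {x, z})) := by
    rcases hC' with rfl | rfl
    exacts [h1, h1.symm]
  rw [hf.orientsPos_iff hxy hyz, hf'.orientsPos_iff hxy hyz, hf.orientsNeg_iff hxy hyz,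
    hf'.orientsNeg_iff hxy hyz] at h3
  refine ⟨x, y, z, ?_⟩
  rcases h3 with ⟨h3, h4⟩ | ⟨h3, h4⟩
  · exact .inr ⟨hxy, hyz, h4, h3, fun u v w h5 h6 h7 => (key u v w h5 h6 h7).symm⟩
  · exact .inl ⟨hxy, hyz, h3, h4, key⟩

end Sign

/-! ### Existence of flips -/

section Flip

variable {n : ℕ} {a : Fin n → ℝ} {f f' : Finset (Fin n) → Finset (Fin n)}

/-- The relation `i ∈ f {j, l}` is acyclic on the elements below `l`: the tiles of the pairs that
contain `l` are linearly ordered. -/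
theorem IsArrangement.not_cycle (hf : IsArrangement a f) {i j r l : Fin n}
    (ha : Function.Injective a) (hij : i ≠ j) (hjr : j ≠ r) (hir : i ≠ r)
    (hi : a i < a l) (hj : a j < a l) (hr : a r < a l) (h1 : i ∈ f {j, l}) (h1' : j ∉ f {i, l})
    (h2 : j ∈ f {r, l}) (h2' : r ∉ f {j, l}) (h3 : r ∈ f {i, l}) (h3' : i ∉ f {r, l}) : False := by
  have c1 := card_pair_of_lt hi
  have c2 := card_pair_of_lt hj
  have c3 := card_pair_of_lt hr
  have m1 := hf.notMem_left hi
  have m2 := hf.notMem_left hj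
  have m3 := hf.notMem_left hr
  -- The vertices of the three tiles meet `{i, j, r}` in all subsets but `∅` and `{i, j, r}`.
  have key : ∀ x y z, a x < a y → a y < a z → ∀ B B' : Finset (Fin n), B.card = 2 → B'.card = 2 →
      y ∈ f B → x ∉ f B → z ∉ f B → x ∈ f B' ∪ B' → z ∈ f B' ∪ B' → y ∉ f B' → False :=
    fun x y z hxy hyz B B' hB hB' g1 g2 g3 g4 g5 g6 =>
      g6 (hf.compat B B' hB hB' x y z hxy hyz (Finset.mem_union_left _ g1) g2 g3 g4 g5)
  rcases lt_or_gt_of_ne (ha.ne hij) with h | h <;>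
    rcases lt_or_gt_of_ne (ha.ne hjr) with h' | h' <;>
    rcases lt_or_gt_of_ne (ha.ne hir) with h'' | h''
  · exact key i j r h h' {r, l} {i, l} c3 c1 h2 h3' m3 (by simp) (by simp [h3]) h1'
  · linarith
  · exact key i r j h'' h' {i, l} {j, l} c1 c2 h3 m1 h1' (by simp [h1]) (by simp) h2'
  · exact key r i j h'' h {j, l} {r, l} c2 c3 h1 h2' m2 (by simp) (by simp [h2]) h3'
  · exact key j i r h h'' {j, l} {r, l} c2 c3 h1 m2 h2' (by simp [h2]) (by simp) h3'
  · exact key j r i h' h'' {i, l} {j, l} c1 c2 h3 h1' m1 (by simp) (by simp [h1]) h2'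
  · linarith
  · exact key r j i h' h {r, l} {i, l} c3 c1 h2 m3 h3' (by simp [h3]) (by simp) h1'

/-- If some triple is negative, then three tiles form a hexagon with a negative triple. Let `l` be
the largest top element of a negative triple. The upper right edges of the tiles of the pairs
`{i, l}`, for `i` below `l`, form a path, and to the right of this path there is a tile of which
both left edges lie on the path. -/
theorem IsArrangement.exists_hexagon (hn : 2 ≤ n) (ha : Function.Injective a)
    (hf : IsArrangement a f) (hneg : ∃ x y z, a x < a y ∧ a y < a z ∧ y ∉ f {x, z}) :
    ∃ x y z, a x < a y ∧ a y < a z ∧ f {y, z} = insert x (f {x, z}) ∧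
      f {x, y} = insert z (f {x, z}) := by
  classical
  have hT := hf.isFineZonotopalTiling hn ha
  obtain ⟨x0, y0, z0, h0⟩ := hneg
  obtain ⟨l, hl, hmax⟩ := Finset.exists_max_image
    (Finset.univ.filter fun z => ∃ x y, a x < a y ∧ a y < a z ∧ y ∉ f {x, z}) a
    ⟨z0, by simpa using ⟨x0, y0, h0⟩⟩
  simp only [Finset.mem_filter, Finset.mem_univ, true_and] at hl hmax
  obtain ⟨x, y, hxy, hyl, hneg⟩ := hl
  have hpos : ∀ u v w, a u < a v → a v < a w → a l < a w → v ∈ f {u, w} := by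
    intro u v w huv hvw hw
    by_contra h
    exact absurd (hmax w ⟨u, v, huv, hvw, h⟩) hw.not_ge
  set I := Finset.univ.filter fun s => a s < a l with hI
  have memI : ∀ s, s ∈ I ↔ a s < a l := fun s => by simp [hI]
  have hne : ∀ {s t : Fin n}, a s < a t → s ≠ t := fun h h' => by simp [h'] at h
  have hxor : ∀ i ∈ I, ∀ j ∈ I, i ≠ j → (i ∈ f {j, l} ↔ j ∉ f {i, l}) := by
    intro i hi j hj hij
    rw [memI] at hi hj
    rcases lt_or_gt_of_ne (ha.ne hij) with h | h
    · exact hf.mem_left_iff h hj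
    · have := hf.mem_left_iff h hi
      tauto
  have hsub : ∀ i ∈ I, ∀ s ∈ f {i, l}, s ∈ I := by
    intro i hi s hs
    rw [memI] at hi ⊢
    by_contra! hs'
    have hsl : s ≠ l := fun h => hf.notMem_right hi (h ▸ hs)
    have hls := lt_of_le_of_ne hs' (ha.ne hsl.symm)
    exact (hf.mem_right_iff hi hls).1 hs (hpos i l s hi hls hls)
  have hP : IsPrecedence I fun i => f {i, l} := by
    refine ⟨hsub, fun i hi => hf.notMem_left ((memI i).1 hi), fun i hi j hj hij => ?_,
      fun j hj i hij r hr => ?_⟩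
    · have := hxor i hi j hj hij
      tauto
    · have hi := hsub j hj i hij
      have hrI := hsub i hi r hr
      have nij : i ≠ j := fun h => hf.notMem_left ((memI j).1 hj) (by rw [h] at hij; exact hij)
      have nri : r ≠ i := fun h => hf.notMem_left ((memI i).1 hi) (by rw [h] at hr; exact hr)
      have h1 := (hxor i hi j hj nij).1 hij
      have h2 := (hxor r hrI i hi nri).1 hr
      by_contra hrj
      have nrj : r ≠ j := fun h => h1 (h ▸ hr)
      have h3 : j ∈ f {r, l} := (hxor j hj r hrI nrj.symm).2 hrj
      exact hf.not_cycle ha nij nrj.symm nri.symm ((memI i).1 hi) ((memI j).1 hj) ((memI r).1 hrI)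
        hij h1 h3 hrj hr h2
  obtain ⟨i, hi, j, hj, hPj, ⟨r, hir, hup⟩, r', hr', hrj, hdown⟩ :=
    exists_up_down ha hP (fun i r => (insert l (f {i, l}), {i, r}) ∈ labelTiling f)
      (fun j r => ((insert l (f {j, l})).erase r, {r, j}) ∈ labelTiling f) (fun i hi => by
        have hil := (memI i).1 hi
        have hiS : i ∉ insert l (f {i, l}) := by
          rw [Finset.mem_insert, not_or]
          exact ⟨hne hil, hP.irr i hi⟩
        by_cases hlast : f {i, l} = I.filter fun s => a i < a s
        · exact .inr (.inr hlast)
        rcases hT.exists_right_tile ha hiS (hT.isUniqueEdge ha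
          (mk_mem_labelTiling f (card_pair_of_lt hil)) edgeMid_mem_cubeFace_upper)
          (fun h => hlast (Finset.ext fun s => by
            rw [Finset.mem_filter]
            have h2 := congrArg (s ∈ ·) h
            simp only [Finset.mem_insert, Finset.mem_filter, Finset.mem_univ, true_and,
              eq_iff_iff] at h2
            constructor
            · exact fun hs => ⟨hP.sub i hi hs, h2.1 (.inr hs)⟩
            · rintro ⟨h3, h4⟩
              exact (h2.2 h4).resolve_left (hne ((memI s).1 h3)))) with
          ⟨r, h1, h2, h3⟩ | ⟨r, h1, h2, h3⟩
        · rw [Finset.mem_insert, not_or] at h2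
          by_cases hrI : r ∈ I
          · exact .inl ⟨r, hrI, h1, h2.2, h3⟩
          -- A tile with `r` above `l` occurs only after the last tile of `i` within `I`.
          exfalso
          have hlr : a l < a r := by
            rw [memI, not_lt] at hrI
            exact lt_of_le_of_ne hrI (ha.ne (Ne.symm h2.1))
          have hfir : f {i, r} = insert l (f {i, l}) := (mem_labelTiling.1 h3).2
          refine hlast (Finset.ext fun s => ?_)
          rw [Finset.mem_filter]
          constructor
          · intro hs
            have hsI := hP.sub i hi hs
            refine ⟨hsI, ?_⟩
            by_contra! hsi
            have hsi' := lt_of_le_of_ne hsi (ha.ne fun h => hP.irr i hi (by rw [h] at hs; exact hs))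
            have h4 : s ∈ f {i, r} := hfir ▸ Finset.mem_insert_of_mem hs
            exact (hf.mem_left_iff hsi' h1).1 h4 (hpos s i r hsi' h1 hlr)
          · rintro ⟨hsI, his⟩
            have h4 := hpos i s r his (((memI s).1 hsI).trans hlr) hlr
            rw [hfir, Finset.mem_insert] at h4
            exact h4.resolve_left (hne ((memI s).1 hsI))
        · rw [Finset.mem_insert] at h1
          exact .inr (.inl ⟨r, h1.resolve_left (hne (h2.trans hil)), h2, h3⟩))
      ⟨x, (memI x).2 (hxy.trans hyl), fun h => hneg (by
        rw [h, Finset.mem_filter]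
        exact ⟨(memI y).2 hyl, hxy⟩)⟩
  rw [hPj] at hr' hdown
  rw [Finset.insert_comm] at hdown
  obtain ⟨rfl, rfl⟩ := hT.right_tiles_eq ha hir hup (by
    rw [Finset.mem_insert] at hr' ⊢
    exact hr'.imp id Finset.mem_insert_of_mem) hrj hdown
  exact ⟨r', j, l, hir, (memI j).1 hj, hPj, (mem_labelTiling.1 hup).2⟩

/-- The labels obtained from `f` by exchanging the three tiles of a hexagon with bottom vertex
`A = f {x, z}` and center `A ∪ {x, z}` for those with center `A ∪ {y}`. -/
def flipHexagon (f : Finset (Fin n) → Finset (Fin n)) (x y z : Fin n) :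
    Finset (Fin n) → Finset (Fin n) := fun B =>
  if B = {x, z} then insert y (f {x, z}) else if B = {y, z} then f {x, z}
  else if B = {x, y} then f {x, z} else f B

/-- If three tiles form a hexagon with center `f {x, z} ∪ {x, z}`, then this center is the only
vertex of the tiling that contains `x` and `z` but not `y`. -/
theorem IsArrangement.eq_center (ha : Function.Injective a) (hf : IsArrangement a f)
    {x y z : Fin n} (hxy : a x < a y) (hyz : a y < a z) (h1 : f {y, z} = insert x (f {x, z}))
    (h2 : f {x, y} = insert z (f {x, z})) {S : Finset (Fin n)}
    (hS : IsTilingVertex (labelTiling f) S) (hx : x ∈ S) (hz : z ∈ S) (hy : y ∉ S) :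
    S = insert x (insert z (f {x, z})) := by
  have nxy : x ≠ y := fun h => by simp [h] at hxy
  have nyz : y ≠ z := fun h => by simp [h] at hyz
  have hxz := hxy.trans hyz
  have nxz : x ≠ z := fun h => by simp [h] at hxz
  set A := f {x, z} with hA
  have xA : x ∉ A := hf.notMem_left hxz
  have zA : z ∉ A := hf.notMem_right hxz
  have yA : y ∉ A := fun h => hf.notMem_left hyz (h1 ▸ Finset.mem_insert_of_mem h)
  have v0 : IsTilingVertex (labelTiling f) A := isTilingVertex_label (card_pair_of_lt hxz)
  have v1 : IsTilingVertex (labelTiling f) (insert y (insert x A)) :=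
    isTilingVertex_labelTiling.2 ⟨{y, z}, card_pair_of_lt hyz, by
      rw [h1]; exact Finset.subset_insert _ _, by rw [h1]; intro s; simp; tauto⟩
  have v2 : IsTilingVertex (labelTiling f) (insert y (insert z A)) :=
    isTilingVertex_labelTiling.2 ⟨{x, y}, card_pair_of_lt hxy, by
      rw [h2]; exact Finset.subset_insert _ _, by rw [h2]; intro s; simp; tauto⟩
  ext r
  by_cases hrx : r = x
  · subst hrx; simp [hx]
  by_cases hrz : r = z
  · subst hrz; simp [hz]
  by_cases hry : r = y
  · subst hry; simp [hy, nxy.symm, nyz, yA]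
  simp only [Finset.mem_insert, hrx, hrz, false_or]
  constructor
  · intro hr
    by_contra hrA
    rcases lt_or_gt_of_ne (ha.ne hry) with h | h
    · exact hy (hf.vertex_compat v1 hS h hyz (by simp) (by simp [hrx, hry, hrA])
        (by simp [nyz.symm, nxz.symm, zA]) hr hz)
    · exact hy (hf.vertex_compat v2 hS hxy h (by simp) (by simp [nxy, nxz, xA])
        (by simp [hry, hrz, hrA]) hx hr)
  · intro hrA
    by_contra hr
    rcases lt_or_gt_of_ne (ha.ne hrx) with h | h
    · have := hf.vertex_compat hS v2 h hxy hx hr hy (by simp [hrA]) (by simp)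
      simp [nxy, nxz, xA] at this
    rcases lt_or_gt_of_ne (ha.ne hrz) with h' | h'
    · exact hr (hf.vertex_compat v0 hS h h' hrA xA zA hx hz)
    · have := hf.vertex_compat hS v1 hyz h' hz hy hr (by simp) (by simp [hrA])
      simp [nyz.symm, nxz.symm, zA] at this

theorem IsArrangement.isFlipAt_flipHexagon (ha : Function.Injective a) (hf : IsArrangement a f)
    {x y z : Fin n} (hxy : a x < a y) (hyz : a y < a z) (h1 : f {y, z} = insert x (f {x, z}))
    (h2 : f {x, y} = insert z (f {x, z})) :
    IsArrangement a (flipHexagon f x y z) ∧ IsFlipAt a f (flipHexagon f x y z) x y z := by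
  have nxy : x ≠ y := fun h => by simp [h] at hxy
  have nyz : y ≠ z := fun h => by simp [h] at hyz
  have hxz := hxy.trans hyz
  have nxz : x ≠ z := fun h => by simp [h] at hxz
  have hcen := fun {S} => hf.eq_center ha hxy hyz h1 h2 (S := S)
  have fxz : flipHexagon f x y z {x, z} = insert y (f {x, z}) := by simp [flipHexagon]
  have fyz : flipHexagon f x y z {y, z} = f {x, z} := by
    rw [flipHexagon, if_neg fun h => ?_, if_pos rfl]
    have : y ∈ ({x, z} : Finset (Fin n)) := h ▸ by simp
    simp [nxy.symm, nyz] at this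
  have fxy : flipHexagon f x y z {x, y} = f {x, z} := by
    rw [flipHexagon, if_neg fun h => ?_, if_neg fun h => ?_, if_pos rfl]
    · have : x ∈ ({y, z} : Finset (Fin n)) := h ▸ by simp
      simp [nxy, nxz] at this
    · have : y ∈ ({x, z} : Finset (Fin n)) := h ▸ by simp
      simp [nxy.symm, nyz] at this
  have fB : ∀ B, B ≠ {x, z} → B ≠ {y, z} → B ≠ {x, y} → flipHexagon f x y z B = f B :=
    fun B h1 h2 h3 => by simp [flipHexagon, h1, h2, h3]
  set f' := flipHexagon f x y z with hf'
  set A := f {x, z} with hA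
  have xA : x ∉ A := hf.notMem_left hxz
  have zA : z ∉ A := hf.notMem_right hxz
  have yA : y ∉ A := fun h => hf.notMem_left hyz (h1 ▸ Finset.mem_insert_of_mem h)
  have v0 : IsTilingVertex (labelTiling f) A := isTilingVertex_label (card_pair_of_lt hxz)
  have vz : IsTilingVertex (labelTiling f) (insert z A) :=
    h2 ▸ isTilingVertex_label (card_pair_of_lt hxy)
  have v1 : IsTilingVertex (labelTiling f) (insert x (insert y A)) :=
    isTilingVertex_labelTiling.2 ⟨{y, z}, card_pair_of_lt hyz, by
      rw [h1]; exact Finset.insert_subset_insert _ (Finset.subset_insert _ _),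
      by rw [h1]; intro s; simp; tauto⟩
  have v2 : IsTilingVertex (labelTiling f) (insert z (insert y A)) :=
    isTilingVertex_labelTiling.2 ⟨{x, y}, card_pair_of_lt hxy, by
      rw [h2]; exact Finset.insert_subset_insert _ (Finset.subset_insert _ _),
      by rw [h2]; intro s; simp; tauto⟩
  have v3 : IsTilingVertex (labelTiling f) (insert x (insert y (insert z A))) :=
    isTilingVertex_labelTiling.2 ⟨{y, z}, card_pair_of_lt hyz, by rw [h1]; intro s; simp; tauto,
      by rw [h1]; intro s; simp; tauto⟩
  -- The vertices after the flip, and their signs at the triple of the hexagon.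
  have hvert : ∀ S, IsTilingVertex (labelTiling f') S →
      (IsTilingVertex (labelTiling f) S ∨ S = insert y A) ∧ ¬ (x ∈ S ∧ z ∈ S ∧ y ∉ S) := by
    intro S hS
    obtain ⟨B, hB, hS1, hS2⟩ := isTilingVertex_labelTiling.1 hS
    have hsplit : ∀ (p : Fin n) (C : Finset (Fin n)), C ⊆ S → S ⊆ insert p C →
        S = C ∨ S = insert p C := by
      intro p C hc1 hc2
      by_cases hp : p ∈ S
      · exact .inr (hc2.antisymm (Finset.insert_subset hp hc1))
      · refine .inl (Finset.Subset.antisymm (fun s hs => ?_) hc1)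
        exact (Finset.mem_insert.1 (hc2 hs)).resolve_left fun h => hp (h ▸ hs)
    have hsplit2 : ∀ (p q : Fin n) (C : Finset (Fin n)), C ⊆ S → S ⊆ C ∪ {p, q} →
        S = C ∨ S = insert p C ∨ S = insert q C ∨ S = insert p (insert q C) := by
      intro p q C hc1 hc2
      by_cases hp : q ∈ S
      · rcases hsplit p (insert q C) (Finset.insert_subset hp hc1)
          (fun s hs => by have := hc2 hs; simp at this ⊢; tauto) with h | h <;> tauto
      · rcases hsplit p C hc1 (fun s hs => by
          have := hc2 hs
          have hsq : s ≠ q := fun h => hp (h ▸ hs)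
          simp at this ⊢; tauto) with h | h <;> tauto
    by_cases b1 : B = {x, z}
    · subst b1
      rw [fxz] at hS1 hS2
      refine ⟨?_, fun h => h.2.2 (hS1 (Finset.mem_insert_self _ _))⟩
      rcases hsplit2 x z _ hS1 hS2 with rfl | rfl | rfl | rfl
      · exact .inr rfl
      · exact .inl v1
      · exact .inl v2
      · rw [Finset.insert_comm z y]; exact .inl v3
    by_cases b2 : B = {y, z}
    · subst b2
      rw [fyz] at hS1 hS2
      refine ⟨?_, fun h => by have := hS2 h.1; simp [xA, nxy, nxz] at this⟩
      rcases hsplit2 y z _ hS1 hS2 with rfl | rfl | rfl | rfl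
      · exact .inl v0
      · exact .inr rfl
      · exact .inl vz
      · rw [Finset.insert_comm]; exact .inl v2
    by_cases b3 : B = {x, y}
    · subst b3
      rw [fxy] at hS1 hS2
      refine ⟨?_, fun h => by have := hS2 h.2.1; simp [zA, nyz.symm, nxz.symm] at this⟩
      rcases hsplit2 x y _ hS1 hS2 with rfl | rfl | rfl | rfl
      · exact .inl v0
      · exact .inl (h1 ▸ isTilingVertex_label (card_pair_of_lt hyz))
      · exact .inr rfl
      · exact .inl v1
    rw [fB B b1 b2 b3] at hS1 hS2
    have hSf : IsTilingVertex (labelTiling f) S := isTilingVertex_labelTiling.2 ⟨B, hB, hS1, hS2⟩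
    refine ⟨.inl hSf, fun ⟨hx, hz, hy⟩ => ?_⟩
    -- Such a vertex would be the old center, and so would be its neighbour in another direction.
    obtain ⟨r, hr, hrx, hry, hrz⟩ : ∃ r ∈ B, r ≠ x ∧ r ≠ y ∧ r ≠ z := by
      by_contra! hno
      obtain ⟨s, t, hst, rfl⟩ := Finset.card_eq_two.1 hB
      have hs := hno s (by simp)
      have ht := hno t (by simp)
      have p1 := Finset.pair_comm z x
      have p2 := Finset.pair_comm z y
      have p3 := Finset.pair_comm y x
      by_cases sx : s = x
      · subst sx
        by_cases ty : t = y
        · subst ty; exact b3 rfl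
        · exact b1 (by rw [ht hst.symm ty])
      · by_cases sy : s = y
        · subst sy
          by_cases tx : t = x
          · subst tx; exact b3 p3
          · exact b2 (by rw [ht tx hst.symm])
        · have sz := hs sx sy
          subst sz
          by_cases tx : t = x
          · subst tx; exact b1 p1
          · have ty : t = y := by
              by_contra h
              exact hst (ht tx h).symm
            subst ty; exact b2 p2
    have hrf : r ∉ f B := Finset.disjoint_right.1 (hf.disj B hB) hr
    have e1 := hcen hSf hx hz hy
    by_cases hrS : r ∈ S
    · have e2 := hcen (S := S.erase r) (isTilingVertex_labelTiling.2 ⟨B, hB,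
        fun s hs => Finset.mem_erase.2 ⟨fun h => hrf (h ▸ hs), hS1 hs⟩,
        (Finset.erase_subset _ _).trans hS2⟩) (Finset.mem_erase.2 ⟨hrx.symm, hx⟩)
        (Finset.mem_erase.2 ⟨hrz.symm, hz⟩) (fun h => hy (Finset.mem_of_mem_erase h))
      rw [← e1] at e2
      exact Finset.notMem_erase r S (e2.ge hrS)
    · have e2 := hcen (S := insert r S) (isTilingVertex_labelTiling.2 ⟨B, hB,
        hS1.trans (Finset.subset_insert _ _),
        Finset.insert_subset (Finset.mem_union_right _ hr) hS2⟩) (Finset.mem_insert_of_mem hx)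
        (Finset.mem_insert_of_mem hz) (by simp [hry.symm, hy])
      rw [← e1] at e2
      exact hrS (e2.le (Finset.mem_insert_self r S))
  -- At the other triples, the new center is indistinguishable from one of the old vertices.
  have hagree : ∀ S, IsTilingVertex (labelTiling f') S → ∀ u v w, a u < a v → a v < a w →
      ¬ (u = x ∧ v = y ∧ w = z) → ∃ S', IsTilingVertex (labelTiling f) S' ∧ (u ∈ S' ↔ u ∈ S) ∧
        (v ∈ S' ↔ v ∈ S) ∧ (w ∈ S' ↔ w ∈ S) := by
    intro S hS u v w huv hvw hne
    rcases (hvert S hS).1 with h | rfl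
    · exact ⟨S, h, Iff.rfl, Iff.rfl, Iff.rfl⟩
    by_cases hx : x = u ∨ x = v ∨ x = w
    swap
    · refine ⟨_, v1, ?_, ?_, ?_⟩ <;> simp only [Finset.mem_insert] <;> grind
    by_cases hy : y = u ∨ y = v ∨ y = w
    swap
    · refine ⟨_, v0, ?_, ?_, ?_⟩ <;> simp only [Finset.mem_insert] <;> grind
    by_cases hz : z = u ∨ z = v ∨ z = w
    swap
    · refine ⟨_, v2, ?_, ?_, ?_⟩ <;> simp only [Finset.mem_insert] <;> grind
    exfalso
    apply hne
    rcases hx with rfl | rfl | rfl <;> rcases hy with rfl | rfl | rfl <;>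
      rcases hz with rfl | rfl | rfl <;> first | exact ⟨rfl, rfl, rfl⟩ | (exfalso; linarith)
  have harr : IsArrangement a f' := by
    refine isArrangement_of_vertex_compat (fun B hB => ?_) fun S S' hS hS' u v w huv hvw g1 g2 g3 g4
      g5 => ?_
    · by_cases b1 : B = {x, z}
      · subst b1
        rw [fxz]
        simp [nxy, nyz.symm, xA, zA]
      by_cases b2 : B = {y, z}
      · subst b2
        rw [fyz]
        simp [yA, zA]
      by_cases b3 : B = {x, y}
      · subst b3
        rw [fxy]
        simp [xA, yA]
      rw [fB B b1 b2 b3]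
      exact hf.disj B hB
    · by_contra g6
      by_cases hne : u = x ∧ v = y ∧ w = z
      · obtain ⟨rfl, rfl, rfl⟩ := hne
        exact (hvert S' hS').2 ⟨g4, g5, g6⟩
      · obtain ⟨R, hR, r1, r2, r3⟩ := hagree S hS u v w huv hvw hne
        obtain ⟨R', hR', r1', r2', r3'⟩ := hagree S' hS' u v w huv hvw hne
        exact g6 (r2'.1 (hf.vertex_compat hR hR' huv hvw (r2.2 g1) (fun h => g2 (r1.1 h))
          (fun h => g3 (r3.1 h)) (r1'.2 g4) (r3'.2 g5)))
  refine ⟨harr, hxy, hyz, yA, fxz ▸ Finset.mem_insert_self _ _, fun u v w huv hvw hne => ?_⟩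
  have huw := huv.trans hvw
  constructor
  · intro hv
    by_contra hv'
    obtain ⟨R, hR, r1, r2, r3⟩ := hagree _ (isTilingVertex_label_union (card_pair_of_lt huw)) u v w
      huv hvw hne
    refine hf.neg_of_vertex hR huv hvw (r1.2 (by simp)) (r3.2 (by simp)) (fun h => ?_) hv
    have n1 : v ≠ u := fun h => by simp [h] at huv
    have n2 : v ≠ w := fun h => by simp [h] at hvw
    simpa [hv', n1, n2] using r2.1 h
  · intro hv'
    obtain ⟨R, hR, r1, r2, r3⟩ := hagree _ (isTilingVertex_label (card_pair_of_lt huw)) u v w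
      huv hvw hne
    exact hf.pos_of_vertex hR huv hvw (r2.2 hv') (fun h => harr.notMem_left huw (r1.1 h))
      (fun h => harr.notMem_right huw (r3.1 h))

/-- An arrangement with a negative triple admits a flip that makes a negative triple positive. -/
theorem IsArrangement.exists_flip (hn : 2 ≤ n) (ha : Function.Injective a)
    (hf : IsArrangement a f) (hneg : ∃ x y z, a x < a y ∧ a y < a z ∧ y ∉ f {x, z}) :
    ∃ f' x y z, IsArrangement a f' ∧ IsFlipAt a f f' x y z := by
  obtain ⟨x, y, z, hxy, hyz, h1, h2⟩ := hf.exists_hexagon hn ha hneg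
  exact ⟨_, x, y, z, hf.isFlipAt_flipHexagon ha hxy hyz h1 h2⟩

/-- The arrangement whose vertices are the complements of the vertices of `f`. It is the image of
`f` under the central symmetry of the cube. -/
def complArrangement (f : Finset (Fin n) → Finset (Fin n)) : Finset (Fin n) → Finset (Fin n) :=
  fun B => (f B ∪ B)ᶜ

theorem IsArrangement.compl (hf : IsArrangement a f) : IsArrangement a (complArrangement f) where
  disj B _ := by
    rw [complArrangement, Finset.disjoint_left]
    intro s hs hsB
    exact Finset.mem_compl.1 hs (Finset.mem_union_right _ hsB)
  compat B B' hB hB' x y z hxy hyz h1 h2 h3 h4 h5 := by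
    have key : ∀ {s B}, B.card = 2 → s ∈ complArrangement f B ∪ B → s ∉ f B := by
      intro s B hB hs hs'
      rcases Finset.mem_union.1 hs with h | h
      · exact Finset.mem_compl.1 h (Finset.mem_union_left _ hs')
      · exact Finset.disjoint_left.1 (hf.disj B hB) hs' h
    simp only [complArrangement, Finset.mem_compl, not_not] at h2 h3 ⊢
    exact fun h => key hB h1 (hf.compat B' B hB' hB x y z hxy hyz h (key hB' h4) (key hB' h5) h2 h3)

theorem mem_complArrangement_iff {x y z : Fin n} (hxy : a x < a y) (hyz : a y < a z) :
    y ∈ complArrangement f {x, z} ↔ y ∉ f {x, z} := by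
  have n1 : y ≠ x := fun h => by simp [h] at hxy
  have n2 : y ≠ z := fun h => by simp [h] at hyz
  simp [complArrangement, n1, n2]

/-- An arrangement with a positive triple arises by a flip that makes a negative triple positive. -/
theorem IsArrangement.exists_flip_to (hn : 2 ≤ n) (ha : Function.Injective a)
    (hf : IsArrangement a f) (hpos : ∃ x y z, a x < a y ∧ a y < a z ∧ y ∈ f {x, z}) :
    ∃ f' x y z, IsArrangement a f' ∧ IsFlipAt a f' f x y z := by
  obtain ⟨x, y, z, hxy, hyz, h⟩ := hpos
  obtain ⟨g, x, y, z, hg, hflip⟩ := hf.compl.exists_flip hn ha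
    ⟨x, y, z, hxy, hyz, by rw [mem_complArrangement_iff hxy hyz, not_not]; exact h⟩
  have hxy := hflip.lt_left
  have hyz := hflip.lt_right
  refine ⟨complArrangement g, x, y, z, hg.compl, hxy, hyz, ?_, ?_, fun u v w huv hvw hne => ?_⟩
  · rw [mem_complArrangement_iff hxy hyz, not_not]; exact hflip.pos
  · have := hflip.neg
    rwa [mem_complArrangement_iff hxy hyz, not_not] at this
  · have := hflip.iff u v w huv hvw hne
    rw [mem_complArrangement_iff huv hvw] at this ⊢
    tauto

end Flip

/-! ### The effect of a flip and the potential of a cross-section -/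

section Potential

variable {n : ℕ} {a : Fin n → ℝ} {f f' : Finset (Fin n) → Finset (Fin n)} {x y z : Fin n}

theorem IsFlipAt.mem_iff (ha : Function.Injective a) (hf : IsArrangement a f)
    (hf' : IsArrangement a f') (h : IsFlipAt a f f' x y z) {r s t : Fin n} (hst : a s < a t)
    (hrs : r ≠ s) (hrt : r ≠ t) (hne : ({r, s, t} : Finset (Fin n)) ≠ {x, y, z}) :
    r ∈ f {s, t} ↔ r ∈ f' {s, t} := by
  rcases lt_or_gt_of_ne (ha.ne hrs) with h1 | h1
  · rw [hf.mem_left_iff h1 hst, hf'.mem_left_iff h1 hst,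
      h.iff r s t h1 hst fun ⟨e1, e2, e3⟩ => hne (by rw [e1, e2, e3])]
  rcases lt_or_gt_of_ne (ha.ne hrt) with h2 | h2
  · exact h.iff s r t h1 h2 fun ⟨e1, e2, e3⟩ => hne (by rw [e1, e2, e3, Finset.insert_comm])
  · rw [hf.mem_right_iff hst h2, hf'.mem_right_iff hst h2,
      h.iff s t r hst h2 fun ⟨e1, e2, e3⟩ => hne (by
        rw [e1, e2, e3, Finset.insert_comm, Finset.pair_comm])]

/-- The labels of the three pairs in a flipped triple agree outside the triple. Otherwise the
vertices of the two tilings would restrict to all subsets of `{x, y, r}`, although the tilings agree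
on the sign of this triple. -/
theorem IsFlipAt.mem_iff_mem (ha : Function.Injective a) (hf : IsArrangement a f)
    (hf' : IsArrangement a f') (h : IsFlipAt a f f' x y z) {r : Fin n} (hrx : r ≠ x) (hry : r ≠ y)
    (hrz : r ≠ z) :
    (r ∈ f {x, y} ↔ r ∈ f {x, z}) ∧ (r ∈ f {y, z} ↔ r ∈ f {x, z}) := by
  have hxy := h.lt_left
  have hyz := h.lt_right
  have hxz := hxy.trans hyz
  have nxy : x ≠ y := fun h => by simp [h] at hxy
  have nyz : y ≠ z := fun h => by simp [h] at hyz
  have nxz : x ≠ z := fun h => by simp [h] at hxz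
  have hr : r ∉ ({x, y, z} : Finset (Fin n)) := by simp [hrx, hry, hrz]
  have hrne : ∀ s t, ({r, s, t} : Finset (Fin n)) ≠ {x, y, z} := fun s t h => hr (h ▸ by simp)
  let W : Finset (Fin n) → Prop := fun S =>
    IsTilingVertex (labelTiling f) S ∨ IsTilingVertex (labelTiling f') S
  have hW : ∀ S S', W S → W S' → ∀ u v w, a u < a v → a v < a w → ¬ (u = x ∧ v = y ∧ w = z) →
      v ∈ S → u ∉ S → w ∉ S → u ∈ S' → w ∈ S' → v ∈ S' := by
    intro S S' hS hS' u v w huv hvw hne g1 g2 g3 g4 g5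
    by_contra g6
    have hpos : v ∈ f {u, w} := by
      rcases hS with hS | hS
      · exact hf.pos_of_vertex hS huv hvw g1 g2 g3
      · exact (h.iff u v w huv hvw hne).2 (hf'.pos_of_vertex hS huv hvw g1 g2 g3)
    rcases hS' with hS' | hS'
    · exact hf.neg_of_vertex hS' huv hvw g4 g5 g6 hpos
    · exact hf'.neg_of_vertex hS' huv hvw g4 g5 g6 ((h.iff u v w huv hvw hne).1 hpos)
  have hvert : ∀ (g : Finset (Fin n) → Finset (Fin n)) (B : Finset (Fin n)) (p : Fin n → Prop)
      [DecidablePred p], B.card = 2 → IsTilingVertex (labelTiling g) (g B ∪ B.filter p) :=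
    fun g B p _ hB => isTilingVertex_labelTiling.2 ⟨B, hB, Finset.subset_union_left,
      Finset.union_subset_union_right (Finset.filter_subset _ _)⟩
  -- The tile of `B` in the two tilings has vertices with all subsets of `{x, y}`.
  have hall : ∀ B, (B = {x, y} ∨ B = {x, z} ∨ B = {y, z}) → ∀ p : Fin n → Prop,
      ∃ S, W S ∧ (x ∈ S ↔ p x) ∧ (y ∈ S ↔ p y) ∧ (r ∈ S ↔ r ∈ f B) := by
    classical
    rintro B (rfl | rfl | rfl) p
    · refine ⟨_, .inl (hvert f _ p (card_pair_of_lt hxy)), ?_, ?_, ?_⟩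
      · simp [hf.notMem_left hxy]
      · simp [hf.notMem_right hxy]
      · simp [hrx, hry]
    · by_cases hp : p y
      · refine ⟨_, .inr (hvert f' _ p (card_pair_of_lt hxz)), ?_, ?_, ?_⟩
        · simp [hf'.notMem_left hxz]
        · simp [h.pos, hp]
        · simp [hrx, hrz, h.mem_iff ha hf hf' hxz hrx hrz (hrne _ _)]
      · refine ⟨_, .inl (hvert f _ p (card_pair_of_lt hxz)), ?_, ?_, ?_⟩
        · simp [hf.notMem_left hxz]
        · simp [h.neg, hp]
        · simp [hrx, hrz]
    · by_cases hp : p x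
      · refine ⟨_, .inl (hvert f _ p (card_pair_of_lt hyz)), ?_, ?_, ?_⟩
        · simp [(hf.mem_left_iff hxy hyz).2 h.neg, hp]
        · simp [hf.notMem_left hyz]
        · simp [hry, hrz]
      · refine ⟨_, .inr (hvert f' _ p (card_pair_of_lt hyz)), ?_, ?_, ?_⟩
        · simp [hp, show x ∉ f' {y, z} from fun h' => (hf'.mem_left_iff hxy hyz).1 h' h.pos]
        · simp [hf'.notMem_left hyz]
        · simp [hry, hrz, h.mem_iff ha hf hf' hyz hry hrz (hrne _ _)]
  have hcon : ∀ B B', (B = {x, y} ∨ B = {x, z} ∨ B = {y, z}) →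
      (B' = {x, y} ∨ B' = {x, z} ∨ B' = {y, z}) → r ∈ f B → r ∈ f B' := by
    intro B B' hB hB' hr1
    by_contra hr2
    obtain ⟨S0, w0, x0, y0, r0⟩ := hall B hB fun _ => False
    obtain ⟨S1, w1, x1, y1, r1⟩ := hall B hB (· = x)
    obtain ⟨S2, w2, x2, y2, r2⟩ := hall B hB (· = y)
    obtain ⟨S0', w0', x0', y0', r0'⟩ := hall B' hB' fun _ => True
    obtain ⟨S1', w1', x1', y1', r1'⟩ := hall B' hB' (· = x)
    obtain ⟨S2', w2', x2', y2', r2'⟩ := hall B' hB' (· = y)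
    rcases lt_or_gt_of_ne (ha.ne hrx) with h1 | h1
    · have := hW S1' S2 w1' w2 r x y h1 hxy (fun e => hrx e.1)
      grind
    rcases lt_or_gt_of_ne (ha.ne hry) with h2 | h2
    · have := hW S0 S0' w0 w0' x r y h1 h2 (fun e => hry e.2.1)
      grind
    · have := hW S2' S1 w2' w1 x y r hxy h2 (fun e => hrz e.2.2)
      grind
  exact ⟨⟨hcon _ _ (by simp) (by simp), hcon _ _ (by simp) (by simp)⟩,
    ⟨hcon _ _ (by simp) (by simp), hcon _ _ (by simp) (by simp)⟩⟩

/-- A flip exchanges the three tiles of a hexagon and keeps all other tiles. -/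
theorem IsFlipAt.hexagon (ha : Function.Injective a) (hf : IsArrangement a f)
    (hf' : IsArrangement a f') (h : IsFlipAt a f f' x y z) :
    f {y, z} = insert x (f {x, z}) ∧ f {x, y} = insert z (f {x, z}) ∧
      f' {x, z} = insert y (f {x, z}) ∧ f' {y, z} = f {x, z} ∧ f' {x, y} = f {x, z} ∧
      ∀ B, B.card = 2 → B ≠ {x, y} → B ≠ {y, z} → B ≠ {x, z} → f B = f' B := by
  have hxy := h.lt_left
  have hyz := h.lt_right
  have hxz := hxy.trans hyz
  have nxy : x ≠ y := fun h => by simp [h] at hxy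
  have nyz : y ≠ z := fun h => by simp [h] at hyz
  have nxz : x ≠ z := fun h => by simp [h] at hxz
  have m1 := hf.notMem_left hxy
  have m2 := hf.notMem_right hxy
  have m3 := hf.notMem_left hyz
  have m4 := hf.notMem_right hyz
  have m5 := hf.notMem_left hxz
  have m6 := hf.notMem_right hxz
  have m1' := hf'.notMem_left hxy
  have m2' := hf'.notMem_right hxy
  have m3' := hf'.notMem_left hyz
  have m4' := hf'.notMem_right hyz
  have m5' := hf'.notMem_left hxz
  have m6' := hf'.notMem_right hxz
  have c1 := (hf.mem_left_iff hxy hyz).2 h.neg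
  have c2 := (hf.mem_right_iff hxy hyz).2 h.neg
  have c3 : x ∉ f' {y, z} := fun h' => (hf'.mem_left_iff hxy hyz).1 h' h.pos
  have c4 : z ∉ f' {x, y} := fun h' => (hf'.mem_right_iff hxy hyz).1 h' h.pos
  have c5 := h.neg
  have c6 := h.pos
  have hcase : ∀ (Q : Fin n → Prop), Q x → Q y → Q z → (∀ r, r ≠ x → r ≠ y → r ≠ z → Q r) →
      ∀ r, Q r := by
    intro Q h1 h2 h3 h4 r
    by_cases hx : r = x
    · rwa [hx]
    by_cases hy : r = y
    · rwa [hy]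
    by_cases hz : r = z
    · rwa [hz]
    exact h4 r hx hy hz
  have hrne : ∀ r s t, r ≠ x → r ≠ y → r ≠ z → ({r, s, t} : Finset (Fin n)) ≠ {x, y, z} :=
    fun r s t h1 h2 h3 h => by
      have : r ∈ ({x, y, z} : Finset (Fin n)) := h ▸ by simp
      simp [h1, h2, h3] at this
  refine ⟨?_, ?_, ?_, ?_, ?_, fun B hB b1 b2 b3 => ?_⟩
  · refine Finset.ext (hcase _ ?_ ?_ ?_ fun r hx hy hz => ?_)
    · simp [c1]
    · simp [m3, nxy.symm, c5]
    · simp [m4, nxz.symm, m6]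
    · simp [hx, (h.mem_iff_mem ha hf hf' hx hy hz).2]
  · refine Finset.ext (hcase _ ?_ ?_ ?_ fun r hx hy hz => ?_)
    · simp [m1, nxz, m5]
    · simp [m2, nyz, c5]
    · simp [c2]
    · simp [hz, (h.mem_iff_mem ha hf hf' hx hy hz).1]
  · refine Finset.ext (hcase _ ?_ ?_ ?_ fun r hx hy hz => ?_)
    · simp [m5', nxy, m5]
    · simp [c6]
    · simp [m6', nyz.symm, m6]
    · simp [hy, h.mem_iff ha hf hf' hxz hx hz (hrne _ _ _ hx hy hz)]
  · refine Finset.ext (hcase _ ?_ ?_ ?_ fun r hx hy hz => ?_)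
    · simp [c3, m5]
    · simp [m3', c5]
    · simp [m4', m6]
    · rw [← h.mem_iff ha hf hf' hyz hy hz (hrne _ _ _ hx hy hz),
        (h.mem_iff_mem ha hf hf' hx hy hz).2]
  · refine Finset.ext (hcase _ ?_ ?_ ?_ fun r hx hy hz => ?_)
    · simp [m1', m5]
    · simp [m2', c5]
    · simp [c4, m6]
    · rw [← h.mem_iff ha hf hf' hxy hx hy (hrne _ _ _ hx hy hz),
        (h.mem_iff_mem ha hf hf' hx hy hz).1]
  · obtain ⟨s, t, hst, rfl⟩ := exists_pair_eq ha hB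
    ext r
    by_cases hrs : r = s
    · subst hrs
      simp [hf.notMem_left hst, hf'.notMem_left hst]
    by_cases hrt : r = t
    · subst hrt
      simp [hf.notMem_right hst, hf'.notMem_right hst]
    refine h.mem_iff ha hf hf' hst hrs hrt fun he => ?_
    have nst : s ≠ t := fun h => by simp [h] at hst
    have e : ({s, t} : Finset (Fin n)) = ({x, y, z} : Finset (Fin n)).erase r := by
      rw [← he, Finset.erase_insert]
      simp [hrs, hrt]
    have hr : r ∈ ({x, y, z} : Finset (Fin n)) := he ▸ by simp
    simp only [Finset.mem_insert, Finset.mem_singleton] at hr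
    rcases hr with rfl | rfl | rfl
    · refine b2 (e.trans ?_)
      rw [Finset.erase_insert]; simp [nxy, nxz]
    · refine b3 (e.trans ?_)
      rw [Finset.insert_comm, Finset.erase_insert]; simp [nxy.symm, nyz]
    · refine b1 (e.trans ?_)
      rw [Finset.pair_comm, Finset.insert_comm, Finset.erase_insert]; simp [nxz.symm, nyz.symm]

/-- The potential of a cross-section: each edge `(A, B)` counts one plus twice the number of
elements of `A` strictly between the two elements of `B`. Up to a constant, for the cross-section of
a tiling at height `k` this is the number of tiles cut in a segment plus twice the number of tiles
below. -/
noncomputable def potential (a : Fin n → ℝ) (H : Finset (FaceLabel n)) : ℕ :=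
  ∑ p ∈ H, (1 + 2 * (p.1 ∩ between a p.2).card)

theorem mem_crossSection_labelTiling {k : ℕ} {p : FaceLabel n} :
    p ∈ crossSection k (labelTiling f) ↔ p.2.card = 2 ∧ f p.2 = p.1 ∧ p.1.card + 1 = k := by
  rw [crossSection, Finset.mem_filter, mem_labelTiling, and_assoc]

theorem potential_crossSection (a : Fin n → ℝ) (f : Finset (Fin n) → Finset (Fin n)) (k : ℕ) :
    potential a (crossSection k (labelTiling f)) = ∑ B ∈ Finset.univ.powersetCard 2,
      if (f B).card + 1 = k then 1 + 2 * (f B ∩ between a B).card else 0 := by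
  rw [potential, crossSection, Finset.sum_filter, labelTiling, Finset.sum_image]
  rintro B - B' - h
  exact (Prod.mk.inj h).2

/-- A flip either does not change the cross-section or changes its potential by exactly one. -/
theorem IsFlipAt.potential_eq_or (ha : Function.Injective a) (hf : IsArrangement a f)
    (hf' : IsArrangement a f') (h : IsFlipAt a f f' x y z) (k : ℕ) :
    crossSection k (labelTiling f) = crossSection k (labelTiling f') ∨
      potential a (crossSection k (labelTiling f')) =
        potential a (crossSection k (labelTiling f)) + 1 := by
  have hxy := h.lt_left
  have hyz := h.lt_right
  have hxz := hxy.trans hyz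
  have nxy : x ≠ y := fun h => by simp [h] at hxy
  have nyz : y ≠ z := fun h => by simp [h] at hyz
  have nxz : x ≠ z := fun h => by simp [h] at hxz
  obtain ⟨e1, e2, e3, e4, e5, e6⟩ := h.hexagon ha hf hf'
  have xA := hf.notMem_left hxz
  have zA := hf.notMem_right hxz
  have yA := h.neg
  set A := f {x, z} with hA
  by_cases hk : A.card + 1 = k ∨ A.card + 2 = k
  · right
    have d1 : ({x, y} : Finset (Fin n)) ≠ {y, z} := fun h => by
      have : x ∈ ({y, z} : Finset (Fin n)) := h ▸ by simp
      simp [nxy, nxz] at this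
    have d2 : ({x, y} : Finset (Fin n)) ≠ {x, z} := fun h => by
      have : y ∈ ({x, z} : Finset (Fin n)) := h ▸ by simp
      simp [nxy.symm, nyz] at this
    have d3 : ({y, z} : Finset (Fin n)) ≠ {x, z} := fun h => by
      have : y ∈ ({x, z} : Finset (Fin n)) := h ▸ by simp
      simp [nxy.symm, nyz] at this
    have hsub : ({{x, y}, {y, z}, {x, z}} : Finset (Finset (Fin n))) ⊆
        Finset.univ.powersetCard 2 := by
      intro B hB
      simp only [Finset.mem_insert, Finset.mem_singleton] at hB
      rw [Finset.mem_powersetCard_univ]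
      rcases hB with rfl | rfl | rfl
      exacts [card_pair_of_lt hxy, card_pair_of_lt hyz, card_pair_of_lt hxz]
    have hsum : ∀ g : Finset (Fin n) → ℕ, ∑ B ∈ {{x, y}, {y, z}, {x, z}}, g B =
        g {x, y} + (g {y, z} + g {x, z}) := fun g => by
      rw [Finset.sum_insert (by simp [d1, d2]), Finset.sum_pair d3]
    rw [potential_crossSection, potential_crossSection, ← Finset.sum_sdiff hsub,
      ← Finset.sum_sdiff hsub, hsum, hsum, add_assoc]
    congr 1
    · refine Finset.sum_congr rfl fun B hB => ?_
      simp only [Finset.mem_sdiff, Finset.mem_powersetCard_univ, Finset.mem_insert,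
        Finset.mem_singleton, not_or] at hB
      rw [e6 B hB.1 hB.2.1 hB.2.2.1 hB.2.2.2]
    rw [e1, e2, e3, e4, e5, ← hA, Finset.card_insert_of_notMem xA, Finset.card_insert_of_notMem yA,
      Finset.card_insert_of_notMem zA]
    have i1 : insert z A ∩ between a {x, y} = A ∩ between a {x, y} :=
      Finset.insert_inter_of_notMem fun h => ((mem_between_pair hxy).1 h).2.not_gt hyz
    have i2 : insert x A ∩ between a {y, z} = A ∩ between a {y, z} :=
      Finset.insert_inter_of_notMem fun h => ((mem_between_pair hyz).1 h).1.not_gt hxy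
    have i3 : (insert y A ∩ between a {x, z}).card = (A ∩ between a {x, z}).card + 1 := by
      rw [Finset.insert_inter_of_mem ((mem_between_pair hxz).2 ⟨hxy, hyz⟩),
        Finset.card_insert_of_notMem fun h => yA (Finset.mem_inter.1 h).1]
    have i4 : (A ∩ between a {x, z}).card =
        (A ∩ between a {x, y}).card + (A ∩ between a {y, z}).card := by
      rw [← Finset.card_union_of_disjoint]
      · congr 1
        ext s
        simp only [Finset.mem_inter, Finset.mem_union, mem_between_pair hxy, mem_between_pair hyz,
          mem_between_pair hxz]
        constructor
        · rintro ⟨h1, h2, h3⟩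
          rcases lt_or_gt_of_ne (ha.ne fun h : s = y => yA (h ▸ h1)) with h4 | h4
          · exact .inl ⟨h1, h2, h4⟩
          · exact .inr ⟨h1, h4, h3⟩
        · rintro (⟨h1, h2, h3⟩ | ⟨h1, h2, h3⟩)
          · exact ⟨h1, h2, h3.trans hyz⟩
          · exact ⟨h1, hxy.trans h2, h3⟩
      · rw [Finset.disjoint_left]
        intro s h1 h2
        simp only [Finset.mem_inter, mem_between_pair hxy, mem_between_pair hyz] at h1 h2
        exact lt_asymm h1.2.2 h2.2.1
    rw [i1, i2, i3, i4]
    rcases hk with hk | hk <;> split_ifs <;> omega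
  · left
    ext ⟨A', B⟩
    simp only [mem_crossSection_labelTiling]
    by_cases b1 : B = {x, y}
    · subst b1
      rw [e2, e5]
      constructor <;> rintro ⟨-, rfl, h2⟩
      · rw [Finset.card_insert_of_notMem zA] at h2; omega
      · omega
    by_cases b2 : B = {y, z}
    · subst b2
      rw [e1, e4]
      constructor <;> rintro ⟨-, rfl, h2⟩
      · rw [Finset.card_insert_of_notMem xA] at h2; omega
      · omega
    by_cases b3 : B = {x, z}
    · subst b3
      rw [e3, ← hA]
      constructor <;> rintro ⟨-, rfl, h2⟩
      · omega
      · rw [Finset.card_insert_of_notMem yA] at h2; omega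
    refine and_congr_right fun hB => ?_
    rw [e6 B hB b1 b2 b3]

/-- A combinatorial tiling is determined by the signs of the triples. -/
theorem IsArrangement.labelTiling_eq (ha : Function.Injective a) (hf : IsArrangement a f)
    (hf' : IsArrangement a f')
    (h : ∀ u v w, a u < a v → a v < a w → (v ∈ f {u, w} ↔ v ∈ f' {u, w})) :
    labelTiling f = labelTiling f' := by
  have key : ∀ B, B.card = 2 → f B = f' B := by
    intro B hB
    obtain ⟨s, t, hst, rfl⟩ := exists_pair_eq ha hB
    ext r
    by_cases hrs : r = s
    · subst hrs
      simp [hf.notMem_left hst, hf'.notMem_left hst]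
    by_cases hrt : r = t
    · subst hrt
      simp [hf.notMem_right hst, hf'.notMem_right hst]
    rcases lt_or_gt_of_ne (ha.ne hrs) with h1 | h1
    · rw [hf.mem_left_iff h1 hst, hf'.mem_left_iff h1 hst, h r s t h1 hst]
    rcases lt_or_gt_of_ne (ha.ne hrt) with h2 | h2
    · exact h s r t h1 h2
    · rw [hf.mem_right_iff hst h2, hf'.mem_right_iff hst h2, h s t r hst h2]
  exact Finset.image_congr fun B hB => by
    rw [key B (Finset.mem_powersetCard_univ.1 hB)]

theorem sort_lt_sort_iff (ha : Function.Injective a) {p q : Fin n} :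
    a (Tuple.sort a p) < a (Tuple.sort a q) ↔ p < q :=
  ((Tuple.monotone_sort a).strictMono_of_injective
    (ha.comp (Tuple.sort a).injective)).lt_iff_lt

theorem card_between_sort (ha : Function.Injective a) {p q : Fin n} (hpq : p < q) :
    (between a {Tuple.sort a p, Tuple.sort a q}).card = q - p - 1 := by
  have : between a {Tuple.sort a p, Tuple.sort a q} =
      (Finset.Ioo p q).map (Tuple.sort a).toEmbedding := by
    ext s
    obtain ⟨t, rfl⟩ := (Tuple.sort a).surjective s
    rw [mem_between_pair ((sort_lt_sort_iff ha).2 hpq)]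
    simp only [Finset.mem_map_equiv, Equiv.symm_apply_apply, Finset.mem_Ioo]
    exact and_congr (sort_lt_sort_iff ha) (sort_lt_sort_iff ha)
  rw [this, Finset.card_map, Fin.card_Ioo]

/-- There are `n - m` pairs at distance `m` in the order of the points on the line. -/
theorem card_filter_between (ha : Function.Injective a) {m : ℕ} (hm : 1 ≤ m) :
    ((Finset.univ.powersetCard 2).filter fun B => (between a B).card + 1 = m).card = n - m := by
  rw [← Finset.card_range (n - m)]
  symm
  refine Finset.card_bij (fun t ht => {Tuple.sort a ⟨t, by have := Finset.mem_range.1 ht; omega⟩,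
    Tuple.sort a ⟨t + m, by have := Finset.mem_range.1 ht; omega⟩}) ?_ ?_ ?_
  · intro t ht
    have hlt : (⟨t, by have := Finset.mem_range.1 ht; omega⟩ : Fin n) <
      ⟨t + m, by have := Finset.mem_range.1 ht; omega⟩ := by simp; omega
    rw [Finset.mem_filter, Finset.mem_powersetCard_univ, card_between_sort ha hlt]
    refine ⟨card_pair_of_lt ((sort_lt_sort_iff ha).2 hlt), ?_⟩
    simp only
    omega
  · intro t ht t' ht' h
    have hlt : ∀ t (ht : t ∈ Finset.range (n - m)),
      (⟨t, by have := Finset.mem_range.1 ht; omega⟩ : Fin n) <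
        ⟨t + m, by have := Finset.mem_range.1 ht; omega⟩ := fun t ht => by simp; omega
    have := (pair_eq_pair_of_lt ((sort_lt_sort_iff ha).2 (hlt t' ht'))
      ((sort_lt_sort_iff ha).2 (hlt t ht)) h).1
    simpa using this
  · intro B hB
    rw [Finset.mem_filter, Finset.mem_powersetCard_univ] at hB
    obtain ⟨i, j, hij, rfl⟩ := exists_pair_eq ha hB.1
    obtain ⟨p, rfl⟩ := (Tuple.sort a).surjective i
    obtain ⟨q, rfl⟩ := (Tuple.sort a).surjective j
    have hpq : p < q := (sort_lt_sort_iff ha).1 hij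
    have h2 := hB.2
    rw [card_between_sort ha hpq] at h2
    have hpq' : (p : ℕ) < q := hpq
    have hq : (p : ℕ) + m = q := by omega
    refine ⟨p, Finset.mem_range.2 (by omega), ?_⟩
    simp only [hq, Fin.eta]

theorem potential_between (ha : Function.Injective a) {k : ℕ} (hk : 1 ≤ k) :
    potential a (crossSection k (labelTiling (between a))) = (n - k) * (2 * k - 1) := by
  rw [potential_crossSection, ← Finset.sum_filter, ← card_filter_between ha hk, ← smul_eq_mul]
  refine Finset.sum_const_nat (m := 2 * k - 1) fun B hB => ?_
  have := (Finset.mem_filter.1 hB).2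
  rw [Finset.inter_self]
  omega

theorem potential_complArrangement_between (ha : Function.Injective a) {k : ℕ} (hkn : k < n) :
    potential a (crossSection k (labelTiling (complArrangement (between a)))) = k := by
  rw [potential_crossSection, ← Finset.sum_filter]
  have h1 : (Finset.univ.powersetCard 2).filter
      (fun B => (complArrangement (between a) B).card + 1 = k) =
      (Finset.univ.powersetCard 2).filter fun B => (between a B).card + 1 = n - k := by
    refine Finset.filter_congr fun B hB => ?_
    have hB := Finset.mem_powersetCard_univ.1 hB
    rw [complArrangement, Finset.card_compl, Finset.card_union_of_disjoint
      ((isArrangement_between ha).disj B hB), Fintype.card_fin, hB]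
    have h2 := Finset.card_le_univ (between a B ∪ B)
    rw [Finset.card_union_of_disjoint ((isArrangement_between ha).disj B hB), Fintype.card_fin,
      hB] at h2
    omega
  rw [h1]
  have h2 := card_filter_between ha (m := n - k) (by omega)
  rw [Nat.sub_sub_self hkn.le] at h2
  conv_rhs => rw [← h2, ← mul_one (Finset.card _)]
  refine Finset.sum_const_nat fun B _ => ?_
  have : complArrangement (between a) B ∩ between a B = ∅ := by
    rw [← Finset.disjoint_iff_inter_eq_empty, Finset.disjoint_left]
    intro s hs hs'
    exact Finset.mem_compl.1 hs (Finset.mem_union_left _ hs')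
  simp [this]

end Potential

/-! ### Cross-sections and walks in the flip graph -/

section CrossSection

variable {n k : ℕ} {a : Fin n → ℝ} {f f' : Finset (Fin n) → Finset (Fin n)}

theorem sum_of_mem_cubeFace {p : FaceLabel n} {i j : Fin n} (hij : i ≠ j) (hp : p.2 = {i, j})
    (hd : Disjoint p.1 p.2) {y : Fin n → ℝ} (hy : y ∈ cubeFace p) :
    ∑ s, y s = p.1.card + (y i + y j) := by
  rw [← Finset.sum_subset (Finset.subset_univ (p.1 ∪ p.2)) fun s _ hs => ?_,
    Finset.sum_union hd, hp, Finset.sum_pair hij, Finset.sum_congr rfl hy.2.1]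
  · simp
  · rw [Finset.mem_union, not_or] at hs
    exact hy.2.2 s hs.1 hs.2

theorem add_smul_sub_mem_hypersimplex {u w : Fin n → ℝ}
    (hu : u ∈ hypersimplex n k) (hw : w ∈ hypersimplex n k) {t : ℝ} (h0 : 0 ≤ t) (h1 : t ≤ 1) :
    u + t • (w - u) ∈ hypersimplex n k := by
  refine ⟨fun i => ?_, ?_⟩
  · have h2 := hu.1 i
    have h3 := hw.1 i
    simp only [Pi.add_apply, Pi.smul_apply, Pi.sub_apply, smul_eq_mul]
    constructor <;> nlinarith
  · simp only [Pi.add_apply, Pi.smul_apply, Pi.sub_apply, smul_eq_mul, Finset.sum_add_distrib,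
      ← Finset.mul_sum, Finset.sum_sub_distrib, hu.2, hw.2]
    ring

theorem cubeVertex_mem_hypersimplex {S : Finset (Fin n)} (hS : S.card = k) :
    cubeVertex S ∈ hypersimplex n k := by
  refine ⟨fun i => ?_, ?_⟩
  · unfold cubeVertex
    split_ifs <;> norm_num
  · simp [cubeVertex, hS]

/-- The image of the hypersimplex is not a single point. -/
theorem exists_proj_ne (ha : Function.Injective a) (hk : 1 ≤ k) (hkn : k < n) (v : ℝ × ℝ) :
    ∃ w ∈ hypersimplex n k, proj a w ≠ v := by
  obtain ⟨S, -, hS⟩ := Finset.exists_subset_card_eq (s := (Finset.univ : Finset (Fin n))) (n := k)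
    (by simpa using hkn.le)
  obtain ⟨i, hi⟩ : S.Nonempty := Finset.card_pos.1 (by omega)
  obtain ⟨j, hj⟩ : ∃ j, j ∉ S := by
    by_contra! h
    have : S = Finset.univ := Finset.eq_univ_of_forall h
    rw [this, Finset.card_univ, Fintype.card_fin] at hS
    omega
  by_contra! hno
  have h1 := hno _ (cubeVertex_mem_hypersimplex hS)
  have hS' : (insert j (S.erase i)).card = k := by
    rw [Finset.card_insert_of_notMem fun h => hj (Finset.mem_of_mem_erase h),
      Finset.card_erase_of_mem hi]
    omega
  have h2 := hno _ (cubeVertex_mem_hypersimplex hS')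
  have h3 := congrArg Prod.fst (h1.trans h2.symm)
  rw [proj_fst, proj_fst] at h3
  simp only [cubeVertex, ite_mul, one_mul, zero_mul, Finset.sum_ite_mem, Finset.univ_inter] at h3
  rw [Finset.sum_insert fun h => hj (Finset.mem_of_mem_erase h),
    ← Finset.add_sum_erase S a hi] at h3
  have hij : a i = a j := by linarith
  exact hj (ha hij ▸ hi)

open Filter Topology in
/-- The cross-section of a fine zonotopal tiling is a hypertriangulation. Tiles meeting the height
`k` line outside of the cross-section do so in vertices, so the cross-section covers all but
finitely many points of the segment, and it is closed. -/
theorem IsFineZonotopalTiling.isHypertriangulation (ha : Function.Injective a) (hk : 1 ≤ k)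
    (hkn : k < n) {T : Finset (FaceLabel n)} (hT : IsFineZonotopalTiling a T) :
    IsHypertriangulation a k (crossSection k T) where
  disjoint p hp := hT.disjoint p (Finset.mem_filter.1 hp).1
  card_fst p hp := (Finset.mem_filter.1 hp).2
  card_snd p hp := hT.card_eq p (Finset.mem_filter.1 hp).1
  inter p hp q hq := by
    rw [← image_inter_eq_of_preimage_unique fun u hu w hw h =>
      hT.preimage_unique ha (Finset.mem_filter.1 hp).1 (Finset.mem_filter.1 hq).1 hu.1 hw.1 h]
    congr 1
    ext u
    simp only [Set.mem_inter_iff]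
    tauto
  cover := by
    refine (Set.iUnion₂_subset fun p _ => Set.image_mono Set.inter_subset_right).antisymm ?_
    set X := ⋃ p ∈ crossSection k T, proj a '' (cubeFace p ∩ hypersimplex n k) with hX
    have hXc : IsClosed X := by
      refine ((crossSection k T).isCompact_biUnion fun p _ => ?_).isClosed
      refine ((isCompact_cubeFace p).inter_right ?_).image (continuous_proj a)
      exact (isCompact_unitCube n).isClosed.inter (isClosed_eq (by fun_prop) continuous_const)
    let N : Set (ℝ × ℝ) := ⋃ p ∈ T, {proj a (cubeVertex p.1), proj a (cubeVertex (p.1 ∪ p.2))}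
    have hN : N.Finite := T.finite_toSet.biUnion fun p _ => by simp
    have hXN : ∀ u ∈ hypersimplex n k, proj a u ∈ X ∪ N := by
      intro u hu
      have hz : proj a u ∈ zonotope a := ⟨u, hu.1, rfl⟩
      rw [← hT.cover] at hz
      simp only [Set.mem_iUnion, exists_prop] at hz
      obtain ⟨p, hp, y, hy, hyu⟩ := hz
      have hys : ∑ s, y s = k := by
        rw [← hu.2, ← proj_snd a, ← proj_snd a, hyu]
      obtain ⟨i, j, hij, hB⟩ := Finset.card_eq_two.1 (hT.card_eq p hp)
      have hsum := sum_of_mem_cubeFace hij hB (hT.disjoint p hp) hy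
      rw [hys] at hsum
      have hi := hy.1 i
      have hj := hy.1 j
      have hiA : i ∉ p.1 := Finset.disjoint_right.1 (hT.disjoint p hp) (by simp [hB])
      have hjA : j ∉ p.1 := Finset.disjoint_right.1 (hT.disjoint p hp) (by simp [hB])
      have hb1 : p.1.card ≤ k := by
        have : (p.1.card : ℝ) ≤ k := by linarith
        exact_mod_cast this
      have hb2 : k ≤ p.1.card + 2 := by
        have : (k : ℝ) ≤ p.1.card + 2 := by linarith
        exact_mod_cast this
      by_cases hpk : p.1.card + 1 = k
      · left
        exact Set.mem_biUnion (Finset.mem_filter.2 ⟨hp, hpk⟩) ⟨y, ⟨hy, hy.1, hys⟩, hyu⟩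
      right
      refine Set.mem_biUnion hp ?_
      rw [← hyu]
      rcases (by omega : k = p.1.card ∨ k = p.1.card + 2) with h | h
      · left
        congr 1
        have h' : (k : ℝ) = p.1.card := by exact_mod_cast h
        funext s
        by_cases hs : s ∈ p.1
        · simp [cubeVertex, hs, hy.2.1 s hs]
        by_cases hs' : s ∈ p.2
        · simp only [cubeVertex, hs, if_false]
          rw [hB, Finset.mem_insert, Finset.mem_singleton] at hs'
          rcases hs' with rfl | rfl <;> linarith
        · simp [cubeVertex, hs, hy.2.2 s hs hs']
      · right
        congr 1
        have h' : (k : ℝ) = p.1.card + 2 := by exact_mod_cast h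
        funext s
        by_cases hs : s ∈ p.1
        · simp [cubeVertex, hs, hy.2.1 s hs]
        by_cases hs' : s ∈ p.2
        · simp only [cubeVertex, Finset.mem_union, hs', or_true, if_true]
          rw [hB, Finset.mem_insert, Finset.mem_singleton] at hs'
          rcases hs' with rfl | rfl <;> linarith
        · simp [cubeVertex, hs, hs', hy.2.2 s hs hs']
    rintro _ ⟨u, hu, rfl⟩
    obtain ⟨w, hw, hwu⟩ := exists_proj_ne ha hk hkn (proj a u)
    let γ : ℝ → ℝ × ℝ := fun t => proj a (u + t • (w - u))
    have hγ : Continuous γ := (continuous_proj a).comp (by fun_prop)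
    have hγ0 : γ 0 = proj a u := by simp [γ]
    have hγt : ∀ t, γ t = proj a u + t • (proj a w - proj a u) := fun t => by
      simp only [γ, proj_add]
      congr 1
      rw [Prod.ext_iff]
      simp only [proj_fst, proj_snd, Prod.smul_fst, Prod.smul_snd, Prod.fst_sub, Prod.snd_sub,
        Pi.smul_apply, Pi.sub_apply, smul_eq_mul, ← Finset.sum_sub_distrib, Finset.mul_sum,
        ← sub_mul, mul_assoc, and_self]
    have hev : ∀ᶠ t in 𝓝[>] (0 : ℝ), γ t ∉ N \ {proj a u} := by
      have hopen : IsOpen (N \ {proj a u})ᶜ := (hN.sdiff).isClosed.isOpen_compl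
      exact nhdsWithin_le_nhds (hγ.continuousAt.preimage_mem_nhds (hopen.mem_nhds (by simp [hγ0])))
    refine hXc.mem_of_frequently_of_tendsto (b := 𝓝[>] (0 : ℝ)) (f := γ) ?_ (by
      rw [← hγ0]; exact hγ.continuousWithinAt.tendsto)
    refine Eventually.frequently ?_
    filter_upwards [hev, Ioo_mem_nhdsGT (zero_lt_one (α := ℝ))] with t h1 h2
    refine (hXN _ (add_smul_sub_mem_hypersimplex hu hw h2.1.le h2.2.le)).resolve_right fun h3 => ?_
    refine h1 ⟨h3, fun h4 => ?_⟩
    rw [Set.mem_singleton_iff, hγt, add_eq_left, smul_eq_zero, sub_eq_zero] at h4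
    exact h4.elim h2.1.ne' hwu

/-- The vertex of the flip graph given by the cross-section of a combinatorial tiling. -/
def sectionVertex (ha : Function.Injective a) (hk : 1 ≤ k) (hkn : k < n)
    (hf : IsArrangement a f) : LiftingHypertriangulation a k :=
  have hT := hf.isFineZonotopalTiling (by omega) ha
  ⟨crossSection k (labelTiling f), hT.isHypertriangulation ha hk hkn, _, hT, rfl⟩

theorem exists_eq_sectionVertex (ha : Function.Injective a) (hk : 1 ≤ k) (hkn : k < n)
    (H : LiftingHypertriangulation a k) :
    ∃ (f : Finset (Fin n) → Finset (Fin n)) (hf : IsArrangement a f),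
      H = sectionVertex ha hk hkn hf := by
  obtain ⟨H, hH, T, hT, rfl⟩ := H
  obtain ⟨f, hf, rfl⟩ := hT.exists_isArrangement (by omega) ha
  exact ⟨f, hf, rfl⟩

/-- A flip from `f` to `f'` gives a walk of which the length is the difference of potentials. -/
theorem IsFlipAt.exists_walk (ha : Function.Injective a) (hk : 1 ≤ k) (hkn : k < n)
    (hf : IsArrangement a f) (hf' : IsArrangement a f') {x y z : Fin n}
    (h : IsFlipAt a f f' x y z) :
    ∃ w : (liftingFlipGraph a k).Walk (sectionVertex ha hk hkn hf) (sectionVertex ha hk hkn hf'),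
      potential a (sectionVertex ha hk hkn hf).1 + w.length =
        potential a (sectionVertex ha hk hkn hf').1 := by
  rcases h.potential_eq_or ha hf hf' k with h1 | h1
  · have : sectionVertex ha hk hkn hf = sectionVertex ha hk hkn hf' := Subtype.ext h1
    rw [this]
    exact ⟨.nil, rfl⟩
  · have hadj : (liftingFlipGraph a k).Adj (sectionVertex ha hk hkn hf)
        (sectionVertex ha hk hkn hf') :=
      ⟨fun h2 => by
        have h3 : crossSection k (labelTiling f) = crossSection k (labelTiling f') :=
          congrArg Subtype.val h2
        rw [h3] at h1
        omega, _, _, hf.isFineZonotopalTiling (by omega) ha,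
        hf'.isFineZonotopalTiling (by omega) ha, rfl, rfl, h.isFlip ha hf hf'⟩
    exact ⟨.cons hadj .nil, h1.symm⟩

/-- From any cross-section, flips that increase the potential lead to the maximal one. -/
theorem IsArrangement.exists_walk_to_max (ha : Function.Injective a) (hk : 1 ≤ k) (hkn : k < n)
    (m : ℕ) : ∀ {f : Finset (Fin n) → Finset (Fin n)} (hf : IsArrangement a f),
      (Finset.univ.filter fun t : Fin n × Fin n × Fin n =>
        a t.1 < a t.2.1 ∧ a t.2.1 < a t.2.2 ∧ t.2.1 ∉ f {t.1, t.2.2}).card = m →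
      ∃ w : (liftingFlipGraph a k).Walk (sectionVertex ha hk hkn hf)
        (sectionVertex ha hk hkn (isArrangement_between ha)),
        potential a (sectionVertex ha hk hkn hf).1 + w.length =
          potential a (sectionVertex ha hk hkn (isArrangement_between ha)).1 := by
  induction m using Nat.strong_induction_on with
  | _ m ih =>
    intro f hf hm
    by_cases hneg : ∃ x y z, a x < a y ∧ a y < a z ∧ y ∉ f {x, z}
    · obtain ⟨f', x, y, z, hf', h⟩ := hf.exists_flip (by omega) ha hneg
      obtain ⟨w, hw⟩ := h.exists_walk ha hk hkn hf hf'
      obtain ⟨w', hw'⟩ := ih _ (by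
        rw [← hm]
        refine Finset.card_lt_card (Finset.ssubset_iff_of_subset (fun t ht => ?_) |>.2
          ⟨(x, y, z), by simp [h.lt_left, h.lt_right, h.neg], by simp [h.pos]⟩)
        simp only [Finset.mem_filter, Finset.mem_univ, true_and] at ht ⊢
        obtain ⟨h1, h2, h3⟩ := ht
        refine ⟨h1, h2, fun h4 => h3 ((h.iff _ _ _ h1 h2 ?_).1 h4)⟩
        rintro ⟨h5, h6, h7⟩
        rw [h5, h6, h7] at h3
        exact h3 h.pos) hf' rfl
      exact ⟨w.append w', by rw [SimpleGraph.Walk.length_append, ← hw', ← hw, add_assoc]⟩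
    · push Not at hneg
      have : sectionVertex ha hk hkn hf = sectionVertex ha hk hkn (isArrangement_between ha) := by
        refine Subtype.ext (congrArg (crossSection k) (hf.labelTiling_eq ha
          (isArrangement_between ha) fun u v w huv hvw => ?_))
        exact iff_of_true (hneg u v w huv hvw)
          ((mem_between_pair (huv.trans hvw)).2 ⟨huv, hvw⟩)
      rw [this]
      exact ⟨.nil, rfl⟩

/-- Flips that increase the potential lead to any cross-section from the minimal one. -/
theorem IsArrangement.exists_walk_from_min (ha : Function.Injective a) (hk : 1 ≤ k) (hkn : k < n)
    (m : ℕ) : ∀ {f : Finset (Fin n) → Finset (Fin n)} (hf : IsArrangement a f),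
      (Finset.univ.filter fun t : Fin n × Fin n × Fin n =>
        a t.1 < a t.2.1 ∧ a t.2.1 < a t.2.2 ∧ t.2.1 ∈ f {t.1, t.2.2}).card = m →
      ∃ w : (liftingFlipGraph a k).Walk
        (sectionVertex ha hk hkn (isArrangement_between ha).compl) (sectionVertex ha hk hkn hf),
        potential a (sectionVertex ha hk hkn (isArrangement_between ha).compl).1 + w.length =
          potential a (sectionVertex ha hk hkn hf).1 := by
  induction m using Nat.strong_induction_on with
  | _ m ih =>
    intro f hf hm
    by_cases hpos : ∃ x y z, a x < a y ∧ a y < a z ∧ y ∈ f {x, z}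
    · obtain ⟨f', x, y, z, hf', h⟩ := hf.exists_flip_to (by omega) ha hpos
      obtain ⟨w, hw⟩ := h.exists_walk ha hk hkn hf' hf
      obtain ⟨w', hw'⟩ := ih _ (by
        rw [← hm]
        refine Finset.card_lt_card (Finset.ssubset_iff_of_subset (fun t ht => ?_) |>.2
          ⟨(x, y, z), by simp [h.lt_left, h.lt_right, h.pos], by simp [h.neg]⟩)
        simp only [Finset.mem_filter, Finset.mem_univ, true_and] at ht ⊢
        obtain ⟨h1, h2, h3⟩ := ht
        refine ⟨h1, h2, (h.iff _ _ _ h1 h2 ?_).1 h3⟩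
        rintro ⟨h5, h6, h7⟩
        rw [h5, h6, h7] at h3
        exact h.neg h3) hf' rfl
      exact ⟨w'.append w, by rw [SimpleGraph.Walk.length_append, ← hw, ← hw', add_assoc]⟩
    · push Not at hpos
      have : sectionVertex ha hk hkn hf =
          sectionVertex ha hk hkn (isArrangement_between ha).compl := by
        refine Subtype.ext (congrArg (crossSection k) (hf.labelTiling_eq ha
          (isArrangement_between ha).compl fun u v w huv hvw => ?_))
        refine iff_of_false (hpos u v w huv hvw) ?_
        rw [mem_complArrangement_iff huv hvw, not_not]
        exact (mem_between_pair (huv.trans hvw)).2 ⟨huv, hvw⟩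
      rw [this]
      exact ⟨.nil, rfl⟩

theorem potential_le_of_adj (ha : Function.Injective a) (hk : 1 ≤ k) (hkn : k < n)
    {H₁ H₂ : LiftingHypertriangulation a k} (h : (liftingFlipGraph a k).Adj H₁ H₂) :
    potential a H₂.1 ≤ potential a H₁.1 + 1 := by
  obtain ⟨-, T₁, T₂, h1, h2, h3, h4, h5⟩ := h
  obtain ⟨f, hf, rfl⟩ := h1.exists_isArrangement (by omega) ha
  obtain ⟨f', hf', rfl⟩ := h2.exists_isArrangement (by omega) ha
  obtain ⟨x, y, z, h6 | h6⟩ := h5.exists_isFlipAt ha hf hf'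
  · rw [← h3, ← h4]
    rcases h6.potential_eq_or ha hf hf' k with h | h
    · rw [h]; omega
    · omega
  · rw [← h3, ← h4]
    rcases h6.potential_eq_or ha hf' hf k with h | h
    · rw [h]; omega
    · omega

theorem potential_le_add_length (ha : Function.Injective a) (hk : 1 ≤ k) (hkn : k < n)
    {H₁ H₂ : LiftingHypertriangulation a k} (w : (liftingFlipGraph a k).Walk H₁ H₂) :
    potential a H₂.1 ≤ potential a H₁.1 + w.length := by
  induction w with
  | nil => simp
  | cons h w ih =>
    have := potential_le_of_adj ha hk hkn h
    rw [SimpleGraph.Walk.length_cons]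
    omega

end CrossSection

/-! ### The diameter -/

theorem mainTheorem3 {n k : ℕ} (a : Fin n → ℝ) (ha : Function.Injective a)
    (hk : 1 ≤ k) (hkn : k < n) :
    (liftingFlipGraph a k).Connected ∧
      ((liftingFlipGraph a k).diam : ℤ) = 2 * (k : ℤ) * ((n : ℤ) - (k : ℤ)) - (n : ℤ) := by
  set Hmax := sectionVertex ha hk hkn (isArrangement_between ha) with hHmax
  set Hmin := sectionVertex ha hk hkn (isArrangement_between ha).compl with hHmin
  have hmax : potential a Hmax.1 = (n - k) * (2 * k - 1) := potential_between ha hk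
  have hmin : potential a Hmin.1 = k := potential_complArrangement_between ha hkn
  have hup : ∀ H, ∃ w : (liftingFlipGraph a k).Walk H Hmax,
      potential a H.1 + w.length = potential a Hmax.1 := by
    intro H
    obtain ⟨f, hf, rfl⟩ := exists_eq_sectionVertex ha hk hkn H
    exact hf.exists_walk_to_max ha hk hkn _ rfl
  have hdown : ∀ H, ∃ w : (liftingFlipGraph a k).Walk Hmin H,
      potential a Hmin.1 + w.length = potential a H.1 := by
    intro H
    obtain ⟨f, hf, rfl⟩ := exists_eq_sectionVertex ha hk hkn H
    exact hf.exists_walk_from_min ha hk hkn _ rfl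
  have : Nonempty (LiftingHypertriangulation a k) := ⟨Hmax⟩
  have : Finite (LiftingHypertriangulation a k) := Subtype.finite
  have hconn : (liftingFlipGraph a k).Connected := ⟨fun H₁ H₂ => by
    obtain ⟨w₁, -⟩ := hup H₁
    obtain ⟨w₂, -⟩ := hup H₂
    exact ⟨w₁.append w₂.reverse⟩⟩
  refine ⟨hconn, ?_⟩
  have hupper : (liftingFlipGraph a k).diam + potential a Hmin.1 ≤ potential a Hmax.1 := by
    obtain ⟨H₁, H₂, h⟩ := (liftingFlipGraph a k).exists_dist_eq_diam
    obtain ⟨u₁, hu₁⟩ := hup H₁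
    obtain ⟨u₂, hu₂⟩ := hup H₂
    obtain ⟨d₁, hd₁⟩ := hdown H₁
    obtain ⟨d₂, hd₂⟩ := hdown H₂
    -- The walks through the top and through the bottom together have twice the length claimed.
    have h1 := SimpleGraph.dist_le (u₁.append u₂.reverse)
    have h2 := SimpleGraph.dist_le (d₁.reverse.append d₂)
    rw [SimpleGraph.Walk.length_append, SimpleGraph.Walk.length_reverse] at h1 h2
    omega
  have hlower : potential a Hmax.1 ≤ potential a Hmin.1 + (liftingFlipGraph a k).diam := by
    obtain ⟨w, hw⟩ := hconn.exists_walk_length_eq_dist Hmin Hmax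
    have h1 := potential_le_add_length ha hk hkn w
    have h2 := SimpleGraph.dist_le_diam (SimpleGraph.connected_iff_ediam_ne_top.1 hconn)
      (u := Hmin) (v := Hmax)
    omega
  rw [hmax, hmin] at hupper hlower
  have heq : (n - k) * (2 * k - 1) = k + (liftingFlipGraph a k).diam := by omega
  have heq' : ((n : ℤ) - k) * (2 * k - 1) = k + ((liftingFlipGraph a k).diam : ℤ) := by
    have := congrArg (Nat.cast (R := ℤ)) heq
    push_cast [Nat.cast_sub hkn.le, Nat.cast_sub (show 1 ≤ 2 * k by omega)] at this
    exact this
  linarith
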